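/- **Definitions.** Let $\mathcal P_{0,1}$ be the set of formal power series $u\in\mathbb C[[z]]$ with $u(0)=0$, $u'(0)=1$. For a probability measure $\nu$ on $\mathbb R$ with all moments $m_n(\nu)$ finite, let $G_\nu(z)=\sum_{n\ge0} m_n(\nu)z^{-(n+1)}$ (formal series in $1/z$), let $K_\nu(z)=\frac1z+R_\nu(z)$ be its inverse under composition, and call the power series $R_\nu$ the $R$-transform of $\nu$. Free convolution is given by $R_{\mu\boxplus\nu}=R_\mu+R_\nu$. A *free convolution semigroup* is a family $\{\mu_t\}_{t\in[0,\infty)}$ of probability measures on $\mathbb R$ with finite moments such that $\mu_0=\delta_0$, $\mu_s\boxplus\mu_t=\mu_{s+t}$ and $R_{\mu_t}=tR_\mu$, where $\mu=\mu_1$; write $K_t=K_{\mu_t}$. A family of polynomials $P_n(\cdot,t)\in\mathbb C[x]$ ($n\ge0$, $t\ge0$) is a *generalized free Sheffer system* for $\{\mu_t\}$ if there are $u,v\in\mathcal P_{0,1}$, not depending on $t$, with $$\sum_{n\ge0}P_n(x,t)z^n=\frac1{u(z)\,(K_t(v(z))-x)},$$ and a *free Sheffer system* if this holds with $u=v$.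 A *free Meixner system* is a pair $(\{\mu_t\},\{P_n\})$ of a free convolution semigroup and a generalized free Sheffer system for it such that for every $t\ge 0$ the polynomials $P_n(\cdot,t)$ are monic of degree $n$ and pairwise orthogonal with respect to $\mu_t$. It is *non-trivial* if $\mu_1$ has non-zero variance. For $c\in\mathbb R\setminus\{0\}$, $d\in\mathbb R$, $l>0$, the affine change of $x$ and rescaling of $t$ with parameters $(c,d,l)$ replaces $\mu_t$ by the image of $\mu_{lt}$ under $x\mapsto cx+dt$, and $P_n(x,t)$ by $c^nP_n\big((x-dt)/c,\,lt\big)$. Let $\sigma_{\alpha,\beta}(dx)=\frac1{2\pi\beta}\sqrt{4\beta-(x-\alpha)^2}\,\mathbf 1_{[\alpha-2\sqrt\beta,\alpha+2\sqrt\beta]}(x)\,dx$ ($\beta>0$), $\sigma_{\alpha,0}=\delta_\alpha$, and $\sigma_t=\sigma_{0,t}$. Let $U_n(x,t)=t^{n/2}U_n(x/\sqrt t)$, with $U_n(2\cos\theta)=\frac{\sin(n+1)\theta}{\sin\theta}$ and $U_n(x,0)=x^n$. **Theorem.** A pair $(\{\mu_t\},\{P_n\})$ is a non-trivial free Meixner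 system if and only if some affine change of $x$ and rescaling of $t$ turns it into one of the systems listed below. In particular each listed system is a non-trivial free Meixner system. Each is moreover a free Sheffer system with the stated function $u$, $$\sum_{n\ge0}P_n(x,t)z^n=\frac1{u(z)(K_t(u(z))-x)}=\frac1{1+t\,u(z)R_\mu(u(z))-u(z)x},$$ and has the stated $R$-transform $R_\mu$ and expansion in shifted Chebyshev polynomials. In all cases $P_0=1$ and $\mu_0=\delta_0$; the formulas for $\mu_t$ are for $t>0$, and all other formulas are for $t\ge0$. * **Semicircular / Chebyshev.** $P_1=x$, $P_{n+1}=xP_n-tP_{n-1}$ for $n\ge1$; $P_n(x,t)=U_n(x,t)$; $\mu_t=\sigma_t$; $u(z)=z$; $R_\mu(z)=z$. * **Poisson / Charlier.** $P_1=x-t$, $P_{n+1}=(x-(t+1))P_n-tP_{n-1}$ for $n\ge1$; $P_n=Q_n+Q_{n-1}$ for $n\ge1$, where $Q_n(x,t)=U_n(x-(t+1),t)$; $$\mu_t(dx)=\frac tx\,\sigma_{1+t,t}(dx)+\max(1-t,0)\,\delta_0,\qquad u(z)=\frac z{1+z},\qquad R_\mu(z)=\frac1{1-z}.$$ * **The three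 remaining cases**, with a parameter $a\ge0$. Put $\alpha(t)=a(t+2)$, $\beta(t)=t+1$. Then $P_1=x-at$, $P_2=(x-\alpha(t))P_1-tP_0$, $P_{n+1}=(x-\alpha(t))P_n-\beta(t)P_{n-1}$ for $n\ge2$. With $Q_n(x,t)=U_n(x-\alpha(t),\beta(t))$, $P_1=Q_1+2aQ_0$ and $P_n=Q_n+2aQ_{n-1}+Q_{n-2}$ for $n\ge2$. Furthermore $$u(z)=\frac z{1+2az+z^2},\qquad R_\mu(z)=\frac{z^{-1}-\sqrt{(2a-z^{-1})^2-4}}2,$$ where the root is $z^{-1}S(z)$, with $S$ the formal power series such that $S^2=(2az-1)^2-4z^2$ and $S(0)=1$. The measures are: * **Continuous binomial / Meixner–Pollaczek**, $0\le a<1$: $$\mu_t(dx)=\frac{t\beta(t)}{x^2+t^2(1-a^2)}\,\sigma_{\alpha(t),\beta(t)}(dx).$$ * **Gamma / Laguerre**, $a=1$: $$\mu_t(dx)=\frac{t(1+t)}{x^2}\,\sigma_{2+t,1+t}(dx).$$ * **Negative binomial / Meixner**, $a>1$: $$\mu_t(dx)=\frac{t\beta(t)}{x^2-t^2(a^2-1)}\,\sigma_{\alpha(t),\beta(t)}(dx)+\max\Big(1-t\,\frac{a-\sqrt{a^2-1}}{2\sqrt{a^2-1}},\,0\Big)\,\delta_{t\sqrt{a^2-1}}.$$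 -/

import Mathlib

open MeasureTheory
open scoped NNReal

noncomputable section

namespace FreeMeixner

/-! ### Formal power series, Cauchy transform, `R`-transform, free convolution -/

/-- `𝒫₀,₁`: formal power series `u` with `u(0) = 0`, `u'(0) = 1`. -/
def IsP01 (u : PowerSeries ℂ) : Prop :=
  PowerSeries.constantCoeff u = 0 ∧ PowerSeries.coeff 1 u = 1

/-- The `n`-th moment of a measure on the line. -/
def moment (ν : Measure ℝ) (n : ℕ) : ℝ := ∫ x, x ^ n ∂ν

/-- All moments of the measure are finite. -/
def HasAllMoments (ν : Measure ℝ) : Prop := ∀ n : ℕ, Integrable (fun x : ℝ => x ^ n) ν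

/-- The Cauchy transform `G_ν(z) = ∑ₙ mₙ(ν) z^{-(n+1)}`, written as a formal power series in the
variable `1 / z`. -/
def cauchySeries (ν : Measure ℝ) : PowerSeries ℂ :=
  PowerSeries.X * PowerSeries.mk (fun n => (moment ν n : ℂ))

/-- The `R`-transform `R_ν(z) = K_ν(z) - 1 / z`, where `K_ν` is the inverse of `G_ν` under
composition.  If `h = cauchySeries ν` and `h⁻¹` is its compositional inverse, then
`K_ν(z) = 1 / h⁻¹(z)`; with `h⁻¹(z) = z k(z)` this is `K_ν(z) = z⁻¹ (1 / k(z))`, so that the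
`n`-th coefficient of `R_ν` is the `(n+1)`-st coefficient of `1 / k`. (The case distinction is
only there for measures which are not of total mass one.) -/
def rTransform (ν : Measure ℝ) : PowerSeries ℂ :=
  open Classical in
  if h : IsUnit (PowerSeries.coeff 1 (cauchySeries ν)) then
    PowerSeries.mk fun n => PowerSeries.coeff (n + 1)
      (PowerSeries.mk fun k =>
        PowerSeries.coeff (k + 1) ((cauchySeries ν).substInvOfIsUnit h))⁻¹
  else 0

theorem coeff_one_cauchySeries (ν : Measure ℝ) [IsProbabilityMeasure ν] :
    PowerSeries.coeff 1 (cauchySeries ν) = 1 := by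
  rw [cauchySeries, ← zero_add 1, PowerSeries.coeff_succ_X_mul]
  simp [moment]

theorem constantCoeff_cauchySeries (ν : Measure ℝ) :
    PowerSeries.constantCoeff (cauchySeries ν) = 0 := by
  simp [cauchySeries]

/-- `K_ν(G_ν(z)) = z`, with `w = 1 / z` and denominators cleared. -/
theorem cauchySeries_eq (ν : Measure ℝ) [IsProbabilityMeasure ν] :
    cauchySeries ν = PowerSeries.X *
      (1 + cauchySeries ν * (rTransform ν).subst (cauchySeries ν)) := by
  have h1 := coeff_one_cauchySeries ν
  have h0 := constantCoeff_cauchySeries ν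
  have hU : IsUnit (PowerSeries.coeff 1 (cauchySeries ν)) := by simp [h1]
  set g := cauchySeries ν with hg
  have hs : PowerSeries.HasSubst g := PowerSeries.HasSubst.of_constantCoeff_zero' h0
  set h := g.substInvOfIsUnit hU with hh
  set k : PowerSeries ℂ := PowerSeries.mk fun k => PowerSeries.coeff (k + 1) h with hk
  have hXk : h = PowerSeries.X * k := by
    ext n
    cases n with
    | zero => simp [hh]
    | succ n => simp [hk, PowerSeries.coeff_succ_X_mul]
  have hk0 : PowerSeries.constantCoeff k = 1 := by
    have : PowerSeries.coeff 1 h = 1 := by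
      rw [hh, PowerSeries.coeff_one_substInvOfIsUnit]
      have : hU.unit = 1 := Units.ext h1
      simp [this]
    rw [← this]; simp [hk]
  have hR : 1 + PowerSeries.X * rTransform ν = k⁻¹ := by
    ext n
    cases n with
    | zero => simp [hk0]
    | succ n =>
      rw [map_add, PowerSeries.coeff_succ_X_mul, rTransform, dif_pos hU]
      simp only [PowerSeries.coeff_one, Nat.succ_ne_zero, if_false, zero_add, PowerSeries.coeff_mk]
      rfl
  have hkk : k * (1 + PowerSeries.X * rTransform ν) = 1 := by
    rw [hR]; exact PowerSeries.mul_inv_cancel _ (by simp [hk0])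
  have hmain : h * (1 + PowerSeries.X * rTransform ν) = PowerSeries.X := by
    rw [hXk, mul_assoc, hkk, mul_one]
  have := congrArg (PowerSeries.substAlgHom (R := ℂ) hs) hmain
  simp only [map_mul, map_add, map_one, PowerSeries.coe_substAlgHom, PowerSeries.subst_X hs] at this
  rw [hh, PowerSeries.subst_substInvOfIsUnit_left _ h0] at this
  exact this.symm

/-- `ρ = μ ⊞ ν` (additive free convolution of measures with finite moments, through moments):
`R_ρ = R_μ + R_ν`. -/
def IsFreeConvolution (μ ν ρ : Measure ℝ) : Prop :=
  rTransform ρ = rTransform μ + rTransform ν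

/-- A free convolution semigroup `{μ_t}`, `t ∈ [0, ∞)`, of probability measures with finite
moments. -/
structure IsFreeConvolutionSemigroup (μ : ℝ≥0 → Measure ℝ) : Prop where
  isProbabilityMeasure : ∀ t, IsProbabilityMeasure (μ t)
  hasAllMoments : ∀ t, HasAllMoments (μ t)
  zero : μ 0 = Measure.dirac 0
  add : ∀ s t, IsFreeConvolution (μ s) (μ t) (μ (s + t))
  rTransform_eq : ∀ t, rTransform (μ t) = ((t : ℝ) : ℂ) • rTransform (μ 1)

/-! ### Free Sheffer systems and free Meixner systems -/

/-- The formal power series `∑ₙ Pₙ(x, t) zⁿ` in `z`, with coefficients in `ℂ[x]`. -/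
def genSeries (P : ℕ → ℝ≥0 → Polynomial ℂ) (t : ℝ≥0) : PowerSeries (Polynomial ℂ) :=
  PowerSeries.mk fun n => P n t

/-- A power series in `z` with complex coefficients, as a power series with coefficients
in `ℂ[x]`. -/
def inZ (f : PowerSeries ℂ) : PowerSeries (Polynomial ℂ) :=
  PowerSeries.map Polynomial.C f

/-- The indeterminate `x` as a (constant) power series in `z`. -/
def varX : PowerSeries (Polynomial ℂ) := PowerSeries.C Polynomial.X

/-- `{Pₙ(x, t)}` is the generalized free Sheffer system of `{μ_t}` with functions `u, v`:
`∑ₙ Pₙ(x, t) zⁿ = 1 / (u(z) (K_t(v(z)) - x))`.  Since `K_t(v) = 1 / v + R_t(v)`, clearing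
denominators gives `(∑ₙ Pₙ(x, t) zⁿ) u(z) (1 + v(z) R_t(v(z)) - v(z) x) = v(z)`. -/
structure IsGeneralizedFreeSheffer (μ : ℝ≥0 → Measure ℝ) (P : ℕ → ℝ≥0 → Polynomial ℂ)
    (u v : PowerSeries ℂ) : Prop where
  isP01_left : IsP01 u
  isP01_right : IsP01 v
  genSeries_mul : ∀ t, genSeries P t *
    (inZ u * (1 + inZ (v * (rTransform (μ t)).subst v) - inZ v * varX)) = inZ v

/-- A free Sheffer system: the case `u = v`. -/
def IsFreeSheffer (μ : ℝ≥0 → Measure ℝ) (P : ℕ → ℝ≥0 → Polynomial ℂ) (u : PowerSeries ℂ) : Prop :=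
  IsGeneralizedFreeSheffer μ P u u

/-- `{pₙ}` is a family of monic polynomials, `pₙ` of degree `n`, orthogonal with respect
to `ν`. -/
structure IsMonicOrthogonal (ν : Measure ℝ) (p : ℕ → Polynomial ℂ) : Prop where
  monic : ∀ n, (p n).Monic
  natDegree_eq : ∀ n, (p n).natDegree = n
  orthogonal : ∀ m n, m ≠ n → ∫ x : ℝ, (p m).eval (x : ℂ) * (p n).eval (x : ℂ) ∂ν = 0

/-- A free Meixner system: polynomials orthogonal with respect to a free convolution semigroup
that form a generalized free Sheffer system for the same semigroup. -/
structure IsFreeMeixner (μ : ℝ≥0 → Measure ℝ) (P : ℕ → ℝ≥0 → Polynomial ℂ) : Prop where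
  semigroup : IsFreeConvolutionSemigroup μ
  orthogonal : ∀ t, IsMonicOrthogonal (μ t) (fun n => P n t)
  sheffer : ∃ u v : PowerSeries ℂ, IsGeneralizedFreeSheffer μ P u v

/-- Non-triviality: `μ₁` has non-zero variance. -/
def IsNontrivial (μ : ℝ≥0 → Measure ℝ) : Prop :=
  ProbabilityTheory.variance (fun x : ℝ => x) (μ 1) ≠ 0

/-- A non-trivial free Meixner system with
`∑ₙ Pₙ(x, t) zⁿ = 1 / (u(z) (K_t(u(z)) - x)) = 1 / (1 + t u(z) R_μ(u(z)) - u(z) x)`,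
where `R_μ` is the `R`-transform of `μ = μ₁`. -/
structure IsFreeMeixnerWith (μ : ℝ≥0 → Measure ℝ) (P : ℕ → ℝ≥0 → Polynomial ℂ)
    (u : PowerSeries ℂ) : Prop where
  isFreeMeixner : IsFreeMeixner μ P
  isNontrivial : IsNontrivial μ
  isFreeSheffer : IsFreeSheffer μ P u
  genSeries_mul : ∀ t : ℝ≥0, genSeries P t *
    (1 + inZ (((t : ℝ) : ℂ) • (u * (rTransform (μ 1)).subst u)) - inZ u * varX) = 1

/-! ### Affine changes of `x` and rescaling of `t` -/

/-- The laws of `c X(l t) + d t`, when `μ_t` is the law of `X(t)`. -/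
def affineMeasure (c d : ℝ) (l : ℝ≥0) (μ : ℝ≥0 → Measure ℝ) : ℝ≥0 → Measure ℝ :=
  fun t => (μ (l * t)).map fun x => c * x + d * t

/-- The monic polynomials `cⁿ Pₙ((x - d t) / c, l t)`. -/
def affinePoly (c d : ℝ) (l : ℝ≥0) (P : ℕ → ℝ≥0 → Polynomial ℂ) : ℕ → ℝ≥0 → Polynomial ℂ :=
  fun n t => Polynomial.C ((c : ℂ) ^ n) *
    (P n (l * t)).comp
      (Polynomial.C ((c : ℂ)⁻¹) * (Polynomial.X - Polynomial.C ((d : ℂ) * ((t : ℝ) : ℂ))))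

/-! ### Semicircular distributions and Chebyshev polynomials -/

/-- The semicircular distribution with mean `α` and variance `β ≥ 0`. -/
def semicircle (α β : ℝ) : Measure ℝ :=
  if β = 0 then Measure.dirac α
  else (volume.restrict (Set.Icc (α - 2 * √β) (α + 2 * √β))).withDensity fun x =>
    ENNReal.ofReal (1 / (2 * Real.pi * β) * √(4 * β - (x - α) ^ 2))

/-- The monic Chebyshev polynomials of the second kind
`U_n(x, t) = t^{n/2} U_n(x / √t)`, where `U_n(2 cos θ) = sin ((n + 1) θ) / sin θ`.
The latter polynomial is Mathlib's `Polynomial.Chebyshev.S`; `scaleRoots p s` is the polynomial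
`sⁿ p(x / s)`, `n = deg p` (which is `xⁿ` for `s = 0` and `p` monic). -/
def chebU (n : ℕ) (t : ℝ) : Polynomial ℂ :=
  (Polynomial.Chebyshev.S ℂ n).scaleRoots ((√t : ℝ) : ℂ)

theorem monic_S_and_degree (n : ℕ) : (Polynomial.Chebyshev.S ℂ n).Monic ∧
    (Polynomial.Chebyshev.S ℂ n).degree = (n : WithBot ℕ) := by
  induction n using Nat.twoStepInduction with
  | zero => simp
  | one => simp [Polynomial.monic_X]
  | more n ih1 ih2 =>
    have hd : (Polynomial.X * Polynomial.Chebyshev.S ℂ ((n + 1 : ℕ) : ℤ)).degree =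
        ((n + 2 : ℕ) : WithBot ℕ) := by
      rw [Polynomial.degree_mul, ih2.2, Polynomial.degree_X]; norm_cast; ring
    have hl : (Polynomial.Chebyshev.S ℂ (n : ℤ)).degree <
        (Polynomial.X * Polynomial.Chebyshev.S ℂ ((n + 1 : ℕ) : ℤ)).degree := by
      rw [hd, ih1.2]; norm_cast; omega
    have e2 : Polynomial.Chebyshev.S ℂ ((n + 2 : ℕ) : ℤ) =
        Polynomial.X * Polynomial.Chebyshev.S ℂ ((n + 1 : ℕ) : ℤ)
          - Polynomial.Chebyshev.S ℂ (n : ℤ) := by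
      push_cast; exact Polynomial.Chebyshev.S_add_two ℂ n
    rw [e2]
    exact ⟨(Polynomial.monic_X.mul ih2.1).sub_of_left hl,
      by rw [Polynomial.degree_sub_eq_left_of_degree_lt hl, hd]⟩

/-- `U_n(√t y, t) = t^{n/2} U_n(y)`. -/
theorem eval_chebU (n : ℕ) (t : ℝ) (y : ℂ) : (chebU n t).eval (((√t : ℝ) : ℂ) * y) =
    ((√t : ℝ) : ℂ) ^ n * (Polynomial.Chebyshev.S ℂ n).eval y := by
  rw [chebU, Polynomial.scaleRoots_eval_mul,
    Polynomial.natDegree_eq_of_degree_eq_some (monic_S_and_degree n).2]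

/-- The shifted Chebyshev polynomials `U_n(x - α, β)`. -/
def shiftedChebU (n : ℕ) (α β : ℝ) : Polynomial ℂ :=
  (chebU n β).comp (Polynomial.X - Polynomial.C (α : ℂ))

/-! ### The recursively defined polynomials -/

/-- Semicircular / Chebyshev: `P_{n+1} = x P_n - t P_{n-1}`. -/
def semicircularPoly : ℕ → ℝ≥0 → Polynomial ℂ
  | 0, _ => 1
  | 1, _ => Polynomial.X
  | n + 2, t => Polynomial.X * semicircularPoly (n + 1) t
      - Polynomial.C ((t : ℝ) : ℂ) * semicircularPoly n t

/-- Poisson / Charlier: `P_1 = x - t` and `P_{n+1} = (x - (t + 1)) P_n - t P_{n-1}`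
for `n ≥ 1`. -/
def poissonPoly : ℕ → ℝ≥0 → Polynomial ℂ
  | 0, _ => 1
  | 1, t => Polynomial.X - Polynomial.C ((t : ℝ) : ℂ)
  | n + 2, t => (Polynomial.X - Polynomial.C (((t : ℝ) + 1 : ℝ) : ℂ)) * poissonPoly (n + 1) t
      - Polynomial.C ((t : ℝ) : ℂ) * poissonPoly n t

/-- The coefficient `α(t) = a (t + 2)` of the last three cases. -/
def alphaCoeff (a : ℝ) (t : ℝ≥0) : ℝ := a * (t + 2)

/-- The coefficient `β(t) = t + 1` of the last three cases. -/
def betaCoeff (t : ℝ≥0) : ℝ := t + 1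

/-- The last three cases, with parameter `a`: `P_1 = x - a t`, `P_2 = (x - α(t)) P_1 - t P_0`,
and `P_{n+1} = (x - α(t)) P_n - β(t) P_{n-1}` for `n ≥ 2`. -/
def meixnerPoly (a : ℝ) : ℕ → ℝ≥0 → Polynomial ℂ
  | 0, _ => 1
  | 1, t => Polynomial.X - Polynomial.C ((a * t : ℝ) : ℂ)
  | 2, t => (Polynomial.X - Polynomial.C (alphaCoeff a t : ℂ)) * meixnerPoly a 1 t
      - Polynomial.C ((t : ℝ) : ℂ) * meixnerPoly a 0 t
  | n + 3, t => (Polynomial.X - Polynomial.C (alphaCoeff a t : ℂ)) * meixnerPoly a (n + 2) t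
      - Polynomial.C (betaCoeff t : ℂ) * meixnerPoly a (n + 1) t

/-! ### The explicit measures (all of them are `δ₀` at `t = 0`) -/

/-- `μ_t = σ_t`. -/
def semicircularMeasure (t : ℝ≥0) : Measure ℝ := semicircle 0 t

/-- `μ_t(dx) = (t / x) σ_{1+t,t}(dx) + max(1 - t, 0) δ₀`. -/
def poissonMeasure (t : ℝ≥0) : Measure ℝ :=
  if t = 0 then Measure.dirac 0
  else (semicircle (1 + t) t).withDensity (fun x => ENNReal.ofReal (t / x))
    + ENNReal.ofReal (max (1 - t) 0) • Measure.dirac 0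

/-- Continuous binomial, `0 ≤ a < 1`:
`μ_t(dx) = t β(t) / (x² + t² (1 - a²)) σ_{α(t),β(t)}(dx)`. -/
def continuousBinomialMeasure (a : ℝ) (t : ℝ≥0) : Measure ℝ :=
  if t = 0 then Measure.dirac 0
  else (semicircle (alphaCoeff a t) (betaCoeff t)).withDensity fun x =>
    ENNReal.ofReal (t * betaCoeff t / (x ^ 2 + t ^ 2 * (1 - a ^ 2)))

/-- Gamma, `a = 1`: `μ_t(dx) = t (1 + t) / x² σ_{2+t,1+t}(dx)`. -/
def gammaMeasure (t : ℝ≥0) : Measure ℝ :=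
  if t = 0 then Measure.dirac 0
  else (semicircle (2 + t) (1 + t)).withDensity fun x =>
    ENNReal.ofReal (t * (1 + t) / x ^ 2)

/-- Negative binomial, `a > 1`:
`μ_t(dx) = t β(t) / (x² - t² (a² - 1)) σ_{α(t),β(t)}(dx)
  + max(1 - t (a - √(a² - 1)) / (2 √(a² - 1)), 0) δ_{t √(a² - 1)}`. -/
def negativeBinomialMeasure (a : ℝ) (t : ℝ≥0) : Measure ℝ :=
  if t = 0 then Measure.dirac 0
  else ((semicircle (alphaCoeff a t) (betaCoeff t)).withDensity fun x =>
      ENNReal.ofReal (t * betaCoeff t / (x ^ 2 - t ^ 2 * (a ^ 2 - 1))))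
    + ENNReal.ofReal (max (1 - t * ((a - √(a ^ 2 - 1)) / (2 * √(a ^ 2 - 1)))) 0) •
      Measure.dirac (t * √(a ^ 2 - 1))

/-! ### The explicit series -/

/-- `u(z) = z / (1 + 2 a z + z²)`. -/
def meixnerU (a : ℝ) : PowerSeries ℂ :=
  PowerSeries.X * (1 + PowerSeries.C ((2 * a : ℝ) : ℂ) * PowerSeries.X + PowerSeries.X ^ 2)⁻¹

/-- `R(z) = (z⁻¹ - √((2 a - z⁻¹)² - 4)) / 2`, as a formal power series: the root is `z⁻¹ S(z)`,
where `S(z) = √((2 a z - 1)² - 4 z²)` is the power series with constant term `1`. -/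
def IsMeixnerR (a : ℝ) (R : PowerSeries ℂ) : Prop :=
  ∃ S : PowerSeries ℂ, PowerSeries.constantCoeff S = 1 ∧
    S ^ 2 = (PowerSeries.C ((2 * a : ℝ) : ℂ) * PowerSeries.X - 1) ^ 2 - 4 * PowerSeries.X ^ 2 ∧
    2 * PowerSeries.X * R = 1 - S

end FreeMeixner

end

open MeasureTheory
open scoped NNReal

noncomputable section

namespace FreeMeixner

/-! Everything is governed by four real parameters. A system is described by a three-term recursion
whose coefficients are affine in `t`: `a + b t` for the shift and `c + d t` for the product, with
the exceptional first values `b t` and `d t` (`IsThreeTerm`). Its generating function is `A / (D_t -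
z x)`, where `A = 1 + a z + c z²` and `D_t = A + t z (b + d z)`.

If `ν` is a probability measure under which `P_1, P_2, …` have mean zero (`IsCentering`), then
integrating the generating function gives `1`. Expanding it geometrically in `x` instead gives the
moment series of `ν` at `z / D_t`. Comparing the two yields `G(z / D_t) = z / A`, with `G` read as a
series in the inverse variable, and therefore `R(z / A) = t (b + d z)`. This is linear in `t`, so
the semigroup law, the Sheffer property with `u = z / A` and the formula for `R` all follow from
centering alone, and orthogonality follows from centering and the recursion
(`isFreeMeixnerWith_of_isThreeTerm`).

Conversely, in a free Meixner system `P_n(0, 0) = 0` for `n ≥ 1`, which forces `u = v`. The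
generating function then expands `x P_n` in the `P_i` with coefficients affine in `t`. Pairing with
`P_0` and `P_1` kills all but finitely many of these coefficients, and the survivors are moments of
`μ_1`, hence real. Positivity of the norm of `P_2` for small `t` gives `c ≥ 0`
(`IsFreeMeixner.exists_isThreeTerm`). An affine change acts on `(a, b, c, d)` by scalings and a
translation of `b`; the normal forms are `a = c = 0`, then `c = 0 ≠ a`, then `c > 0` with one
invariant `|a| / (2 √c)`. The recursion determines the moments, and compact support of the listed
measures makes them determinate (`ext_of_moment_eq`).

It remains to see that each listed measure is centering. The polynomials are short combinations of
shifted Chebyshev polynomials. Clearing the denominator of the density reduces integrals to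
Chebyshev orthogonality and produces a constant-coefficient linear recursion for the means of the
`P_n`. These means vanish either because the recursion only has solutions growing too fast, or
because total mass and mean are known from the Stieltjes transform of the semicircle. -/

/-! ### Polynomials as test functions. -/

theorem integrable_eval {ν : Measure ℝ} (h : HasAllMoments ν) (p : Polynomial ℂ) :
    Integrable (fun x : ℝ => p.eval (x : ℂ)) ν := by
  induction p using Polynomial.induction_on' with
  | add p q hp hq =>
    simp only [Polynomial.eval_add]
    exact hp.add hq
  | monomial n a =>
    have := ((h n).ofReal (𝕜 := ℂ)).const_mul a
    simpa [Polynomial.eval_monomial] using this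

/-- Integration of polynomials against a measure with finite moments. -/
def momentFunctional (ν : Measure ℝ) (h : HasAllMoments ν) : Polynomial ℂ →ₗ[ℂ] ℂ where
  toFun p := ∫ x : ℝ, p.eval (x : ℂ) ∂ν
  map_add' p q := by
    simpa using integral_add (integrable_eval h p) (integrable_eval h q)
  map_smul' a p := by
    simpa using integral_const_mul a (fun x : ℝ => p.eval (x : ℂ))

theorem momentFunctional_apply {ν : Measure ℝ} (h : HasAllMoments ν) (p : Polynomial ℂ) :
    momentFunctional ν h p = ∫ x : ℝ, p.eval (x : ℂ) ∂ν := rfl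

theorem momentFunctional_C_mul {ν : Measure ℝ} (h : HasAllMoments ν) (a : ℂ) (p : Polynomial ℂ) :
    momentFunctional ν h (Polynomial.C a * p) = a * momentFunctional ν h p := by
  rw [← Polynomial.smul_eq_C_mul, map_smul, smul_eq_mul]

theorem momentFunctional_X_pow {ν : Measure ℝ} (h : HasAllMoments ν) (n : ℕ) :
    momentFunctional ν h (Polynomial.X ^ n) = (moment ν n : ℂ) := by
  rw [momentFunctional_apply, moment, ← integral_complex_ofReal]
  simp

theorem momentFunctional_one {ν : Measure ℝ} [IsProbabilityMeasure ν] (h : HasAllMoments ν) :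
    momentFunctional ν h 1 = 1 := by
  simp [momentFunctional_apply]


/-- The polynomials `p 0, …, p (N - 1)` span those of degree below `N`: subtract the leading
coefficient times the top one and descend. -/
theorem eq_zero_of_degree_lt {φ : Polynomial ℂ →ₗ[ℂ] ℂ} {p : ℕ → Polynomial ℂ} {N : ℕ}
    (hm : ∀ n, (p n).Monic) (hd : ∀ n, (p n).natDegree = n) (h : ∀ n < N, φ (p n) = 0)
    {q : Polynomial ℂ} (hq : q.degree < (N : WithBot ℕ)) : φ q = 0 := by
  induction N generalizing q with
  | zero =>
    have : q = 0 := by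
      rw [← Polynomial.degree_eq_bot]
      simpa [Nat.WithBot.lt_zero_iff] using hq
    simp [this]
  | succ N ih =>
    have hr : (q - Polynomial.C (q.coeff N) * p N).degree < (N : WithBot ℕ) := by
      rw [Polynomial.degree_lt_iff_coeff_zero]
      intro m hmN
      rcases hmN.eq_or_lt with rfl | hlt
      · have : (p N).coeff N = 1 := by
          have := (hm N).coeff_natDegree
          rwa [hd] at this
        simp [this]
      · have h1 : q.coeff m = 0 :=
          Polynomial.coeff_eq_zero_of_degree_lt (hq.trans_le (by exact_mod_cast hlt))
        have h2 : (p N).coeff m = 0 :=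
          Polynomial.coeff_eq_zero_of_natDegree_lt (by rw [hd]; exact hlt)
        simp [h1, h2]
    have := ih (fun n hn => h n (hn.trans (Nat.lt_succ_self N))) hr
    rw [map_sub, ← Polynomial.smul_eq_C_mul, map_smul, h N (Nat.lt_succ_self N)] at this
    simpa using this

/-! ### Determinacy of compactly supported measures -/

/-- Markov's inequality for `x ^ (2 * n)` bounds the mass of `|x| ≥ M'` by `(M / M') ^ (2 * n)`,
which tends to zero when `M' > M`. -/
theorem ae_abs_le_of_moment_le {μ : Measure ℝ} [IsProbabilityMeasure μ] (hμ : HasAllMoments μ)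
    {M : ℝ} (hM : 0 ≤ M) (h : ∀ n, moment μ (2 * n) ≤ M ^ (2 * n)) : ∀ᵐ x ∂μ, |x| ≤ M := by
  have key : ∀ M' : ℝ, M < M' → μ {x | M' ≤ |x|} = 0 := by
    intro M' hM'
    have hpos : 0 < M' := hM.trans_lt hM'
    have hb : ∀ n : ℕ, μ.real {x | M' ≤ |x|} ≤ ((M / M') ^ 2) ^ n := by
      intro n
      have h1 := mul_meas_ge_le_integral_of_nonneg (μ := μ) (f := fun x : ℝ => x ^ (2 * n))
        (Filter.Eventually.of_forall fun x => (even_two_mul n).pow_nonneg x) (hμ (2 * n))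
        (M' ^ (2 * n))
      have hsub : {x : ℝ | M' ≤ |x|} ⊆ {x | M' ^ (2 * n) ≤ x ^ (2 * n)} := by
        intro x hx
        simp only [Set.mem_ofPred_eq] at hx ⊢
        rw [← (even_two_mul n).pow_abs x]
        exact pow_le_pow_left₀ hpos.le hx _
      have h2 : μ.real {x | M' ≤ |x|} ≤ μ.real {x | M' ^ (2 * n) ≤ x ^ (2 * n)} :=
        measureReal_mono hsub
      have h3 := h n
      rw [moment] at h3
      have hp : 0 < M' ^ (2 * n) := by positivity
      rw [← pow_mul, div_pow, le_div_iff₀ hp]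
      nlinarith
    have hlt : (M / M') ^ 2 < 1 := by
      rw [div_pow, div_lt_one (by positivity)]
      exact pow_lt_pow_left₀ hM' hM (by norm_num)
    have hlim := tendsto_pow_atTop_nhds_zero_of_lt_one (by positivity) hlt
    have : μ.real {x | M' ≤ |x|} ≤ 0 := ge_of_tendsto' hlim hb
    have h0 : μ.real {x | M' ≤ |x|} = 0 := le_antisymm this measureReal_nonneg
    exact (measureReal_eq_zero_iff).1 h0
  have : ∀ k : ℕ, ∀ᵐ x ∂μ, |x| < M + 1 / ((k : ℝ) + 1) := by
    intro k
    rw [ae_iff]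
    simp only [not_lt]
    exact key _ (by linarith [Nat.one_div_pos_of_nat (α := ℝ) (n := k)])
  filter_upwards [ae_all_iff.2 this] with x hx
  refine le_of_forall_pos_lt_add fun ε hε => ?_
  obtain ⟨k, hk⟩ := exists_nat_one_div_lt hε
  linarith [hx k]

/-- Bounded support allows the exponential series to be integrated term by term. -/
theorem hasSum_charFun {μ : Measure ℝ} [IsProbabilityMeasure μ] (hμ : HasAllMoments μ)
    {M : ℝ} (h : ∀ᵐ x ∂μ, |x| ≤ M) (t : ℝ) :
    HasSum (fun n : ℕ => (t * Complex.I) ^ n / (n.factorial : ℂ) * (moment μ n : ℂ))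
      (charFun μ t) := by
  let F : ℕ → ℝ → ℂ := fun n x => (t * Complex.I) ^ n / (n.factorial : ℂ) * ((x ^ n : ℝ) : ℂ)
  have hF : ∀ n, Integrable (F n) μ := fun n => ((hμ n).ofReal (𝕜 := ℂ)).const_mul _
  have hn : ∀ n x, ‖F n x‖ = |t| ^ n / n.factorial * |x| ^ n := by
    intro n x
    simp [F]
  have hsum : Summable fun n => ∫ x, ‖F n x‖ ∂μ := by
    refine Summable.of_nonneg_of_le (fun n => integral_nonneg fun x => norm_nonneg _) (fun n => ?_)
      (Real.summable_pow_div_factorial (|t| * M))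
    have : ∫ x, ‖F n x‖ ∂μ ≤ ∫ x, |t| ^ n / n.factorial * M ^ n ∂μ := by
      refine integral_mono_ae (hF n).norm (integrable_const _) ?_
      filter_upwards [h] with x hx
      rw [hn]
      gcongr
    refine this.trans (le_of_eq ?_)
    simp only [integral_const, probReal_univ, one_smul]
    rw [mul_pow]; ring
  have hs := hasSum_integral_of_summable_integral_norm hF hsum
  have e1 : (fun n : ℕ => (t * Complex.I) ^ n / (n.factorial : ℂ) * (moment μ n : ℂ)) =
      fun n => ∫ x, F n x ∂μ := by
    ext n
    simp only [F]
    rw [moment, ← integral_complex_ofReal, integral_const_mul]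
  have e2 : charFun μ t = ∫ x, ∑' n, F n x ∂μ := by
    rw [charFun_apply_real]
    congr 1
    ext x
    rw [Complex.exp_eq_exp_ℂ, NormedSpace.exp_eq_tsum_div]
    refine tsum_congr fun n => ?_
    simp only [F]
    push_cast
    rw [show (t : ℂ) * x * Complex.I = t * Complex.I * x by ring, mul_pow (t * Complex.I)]; ring
  rw [e1, e2]
  exact hs

/-- Only `ν` is assumed bounded. Equality of the even moments carries the bound over to `μ`, and
then both characteristic functions have the same expansion. -/
theorem ext_of_moment_eq {μ ν : Measure ℝ} [IsProbabilityMeasure μ] [IsProbabilityMeasure ν]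
    (hμ : HasAllMoments μ) (hν : HasAllMoments ν) {M : ℝ} (hM : ∀ᵐ x ∂ν, |x| ≤ M)
    (h : ∀ n, moment μ n = moment ν n) : μ = ν := by
  have hM0 : 0 ≤ M := by
    obtain ⟨x, hx⟩ := hM.exists
    exact (abs_nonneg x).trans hx
  have hb : ∀ n, moment μ (2 * n) ≤ M ^ (2 * n) := by
    intro n
    rw [h, moment]
    have : ∫ x, x ^ (2 * n) ∂ν ≤ ∫ x, M ^ (2 * n) ∂ν := by
      refine integral_mono_ae (hν _) (integrable_const _) ?_
      filter_upwards [hM] with x hx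
      rw [← (even_two_mul n).pow_abs x]
      exact pow_le_pow_left₀ (abs_nonneg x) hx _
    simpa using this
  refine Measure.ext_of_charFun (funext fun t => ?_)
  refine (hasSum_charFun hμ (ae_abs_le_of_moment_le hμ hM0 hb) t).unique ?_
  simp only [h]
  exact hasSum_charFun hν hM t

/-! ### Three-term recursions -/

/-- The polynomials `P_n(·, t)` satisfy `P_1 = x - b t`, `P_2 = (x - (a + b t)) P_1 - d t` and
`P_{n+1} = (x - (a + b t)) P_n - (c + d t) P_{n-1}` for `n ≥ 2`. -/
structure IsThreeTerm (a b c d : ℝ) (P : ℕ → ℝ≥0 → Polynomial ℂ) : Prop where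
  zero : ∀ t, P 0 t = 1
  one : ∀ t, P 1 t = Polynomial.X - Polynomial.C ((b * t : ℝ) : ℂ)
  two : ∀ t, P 2 t = (Polynomial.X - Polynomial.C ((a + b * t : ℝ) : ℂ)) * P 1 t
    - Polynomial.C ((d * t : ℝ) : ℂ)
  add_three : ∀ n t, P (n + 3) t = (Polynomial.X - Polynomial.C ((a + b * t : ℝ) : ℂ)) * P (n + 2) t
    - Polynomial.C ((c + d * t : ℝ) : ℂ) * P (n + 1) t

namespace IsThreeTerm

variable {a b c d : ℝ} {P P' : ℕ → ℝ≥0 → Polynomial ℂ}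

theorem unique (h : IsThreeTerm a b c d P) (h' : IsThreeTerm a b c d P') : P = P' := by
  suffices H : ∀ n, P n = P' n ∧ P (n + 1) = P' (n + 1) ∧ P (n + 2) = P' (n + 2) from
    funext fun n => (H n).1
  intro n
  induction n with
  | zero =>
    have e1 : P 1 = P' 1 := funext fun t => by rw [h.one, h'.one]
    exact ⟨funext fun t => by rw [h.zero, h'.zero], e1,
      funext fun t => by rw [h.two, h'.two, e1]⟩
  | succ n ih =>
    exact ⟨ih.2.1, ih.2.2, funext fun t => by rw [h.add_three, h'.add_three, ih.2.1, ih.2.2]⟩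

theorem monic_and_natDegree (h : IsThreeTerm a b c d P) (t : ℝ≥0) (n : ℕ) :
    (P n t).Monic ∧ (P n t).natDegree = n := by
  have step : ∀ (p q : Polynomial ℂ) (k : ℕ) (r : ℂ), p.Monic → p.natDegree = k + 1 →
      q.natDegree ≤ k + 1 → ((Polynomial.X - Polynomial.C r) * p - q).Monic ∧
        ((Polynomial.X - Polynomial.C r) * p - q).natDegree = k + 2 := by
    intro p q k r hp hk hq
    have hX := Polynomial.monic_X_sub_C r
    have hm := hX.mul hp
    have hd : ((Polynomial.X - Polynomial.C r) * p).natDegree = k + 2 := by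
      rw [hX.natDegree_mul hp, Polynomial.natDegree_X_sub_C, hk]; ring
    have hlt : q.natDegree < ((Polynomial.X - Polynomial.C r) * p).natDegree := by omega
    exact ⟨hm.sub_of_left (Polynomial.degree_lt_degree hlt),
      by rw [Polynomial.natDegree_sub_eq_left_of_natDegree_lt hlt, hd]⟩
  -- Three consecutive indices are carried because `P 2` obeys an exceptional recursion, so the
  -- uniform one starts only at `P 3`.
  suffices H : ((P n t).Monic ∧ (P n t).natDegree = n) ∧
      ((P (n + 1) t).Monic ∧ (P (n + 1) t).natDegree = n + 1) ∧
      ((P (n + 2) t).Monic ∧ (P (n + 2) t).natDegree = n + 2) from H.1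
  induction n with
  | zero =>
    have h1 : (P 1 t).Monic ∧ (P 1 t).natDegree = 1 := by
      rw [h.one]
      exact ⟨Polynomial.monic_X_sub_C _, Polynomial.natDegree_X_sub_C _⟩
    refine ⟨by rw [h.zero]; simp [Polynomial.monic_one], h1, ?_⟩
    rw [zero_add, h.two]
    exact step _ _ 0 _ h1.1 h1.2 ((Polynomial.natDegree_C _).le.trans (by omega))
  | succ n ih =>
    refine ⟨ih.2.1, ih.2.2, ?_⟩
    rw [h.add_three n t]
    refine step _ _ (n + 1) _ ih.2.2.1 ih.2.2.2 ?_
    exact (Polynomial.natDegree_C_mul_le _ _).trans (by rw [ih.2.1.2]; omega)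

/-- Multiplication by `X` moves the index by at most one, so each power of `X` can be absorbed by
the recursion. For `k + 1 < n` the index is at least two, hence only the uniform recursion enters.
-/
theorem eq_zero_X_pow_mul (h : IsThreeTerm a b c d P) (t : ℝ≥0) {φ : Polynomial ℂ →ₗ[ℂ] ℂ}
    (hφ : ∀ n, φ (P (n + 1) t) = 0) (k : ℕ) : ∀ n, k < n → φ (Polynomial.X ^ k * P n t) = 0 := by
  induction k with
  | zero =>
    intro n hn
    obtain ⟨m, rfl⟩ := Nat.exists_eq_succ_of_ne_zero hn.ne'
    simpa using hφ m
  | succ k ih =>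
    intro n hn
    obtain ⟨m, rfl⟩ : ∃ m, n = m + 2 := ⟨n - 2, by omega⟩
    have e : Polynomial.X ^ (k + 1) * P (m + 2) t = Polynomial.X ^ k * P (m + 3) t +
        ((a + b * t : ℝ) : ℂ) • (Polynomial.X ^ k * P (m + 2) t) +
        ((c + d * t : ℝ) : ℂ) • (Polynomial.X ^ k * P (m + 1) t) := by
      rw [Polynomial.smul_eq_C_mul, Polynomial.smul_eq_C_mul, h.add_three m t]; ring
    rw [e, map_add, map_add, map_smul, map_smul, ih _ (by omega), ih _ (by omega), ih _ (by omega)]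
    simp

theorem eq_zero_mul (h : IsThreeTerm a b c d P) (t : ℝ≥0) {φ : Polynomial ℂ →ₗ[ℂ] ℂ}
    (hφ : ∀ n, φ (P (n + 1) t) = 0) {m n : ℕ} (hmn : m ≠ n) : φ (P m t * P n t) = 0 := by
  wlog hlt : m < n generalizing m n
  · rw [mul_comm]
    exact this hmn.symm (lt_of_le_of_ne (not_lt.1 hlt) hmn.symm)
  have : (φ ∘ₗ LinearMap.mulRight ℂ (P n t)) (P m t) = 0 := by
    refine eq_zero_of_degree_lt (p := fun k => Polynomial.X ^ k) (N := n)
      (fun k => Polynomial.monic_X_pow k) (fun k => Polynomial.natDegree_X_pow k) (fun k hk => ?_) ?_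
    · simpa using h.eq_zero_X_pow_mul t hφ k n hk
    · refine (Polynomial.degree_le_natDegree).trans_lt ?_
      rw [(h.monic_and_natDegree t m).2]
      exact_mod_cast hlt
  simpa using this

end IsThreeTerm

/-- `ν` is a probability measure with finite moments for which `p_1, p_2, …` have mean zero. -/
structure IsCentering (ν : Measure ℝ) (p : ℕ → Polynomial ℂ) : Prop where
  isProbabilityMeasure : IsProbabilityMeasure ν
  hasAllMoments : HasAllMoments ν
  integral_eq_zero : ∀ n, ∫ x : ℝ, (p (n + 1)).eval (x : ℂ) ∂ν = 0

/-- The functional is known on the basis `p 0 = 1, p 1, …`, so all moments are determined. -/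
theorem IsCentering.ext {μ ν : Measure ℝ} {p : ℕ → Polynomial ℂ} (hμ : IsCentering μ p)
    (hν : IsCentering ν p) (h0 : p 0 = 1) (hm : ∀ n, (p n).Monic) (hd : ∀ n, (p n).natDegree = n)
    {M : ℝ} (hM : ∀ᵐ x ∂ν, |x| ≤ M) : μ = ν := by
  have := hμ.isProbabilityMeasure
  have := hν.isProbabilityMeasure
  refine ext_of_moment_eq hμ.hasAllMoments hν.hasAllMoments hM fun n => ?_
  have h : ∀ k, (momentFunctional μ hμ.hasAllMoments - momentFunctional ν hν.hasAllMoments)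
      (p k) = 0 := by
    intro k
    rw [LinearMap.sub_apply]
    cases k with
    | zero => rw [h0, momentFunctional_one, momentFunctional_one, sub_self]
    | succ k =>
      rw [momentFunctional_apply, momentFunctional_apply, hμ.integral_eq_zero,
        hν.integral_eq_zero, sub_self]
  have := eq_zero_of_degree_lt (N := n + 1) hm hd (fun k _ => h k) (q := Polynomial.X ^ n)
    (by rw [Polynomial.degree_X_pow]; exact_mod_cast Nat.lt_succ_self n)
  rw [LinearMap.sub_apply, momentFunctional_X_pow, momentFunctional_X_pow, sub_eq_zero] at this
  exact_mod_cast this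

/-! ### Power series -/

section PowerSeries

open PowerSeries

/-- A series `u` in `𝒫₀,₁` has a compositional inverse. This matters because `R`-transforms are
found in the form `R(u)`. -/
theorem subst_left_injective {u : PowerSeries ℂ} (h0 : constantCoeff u = 0)
    (h1 : coeff 1 u = 1) {f g : PowerSeries ℂ} (h : f.subst u = g.subst u) : f = g := by
  have hU : IsUnit (coeff 1 u) := by simp [h1]
  have hu : HasSubst u := HasSubst.of_constantCoeff_zero' h0
  have hi : HasSubst (u.substInvOfIsUnit hU) := HasSubst.substInvOfIsUnit _ hU
  have := congrArg (fun F : PowerSeries ℂ => F.subst (u.substInvOfIsUnit hU)) h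
  simp only [subst_comp_subst_apply hu hi, subst_substInvOfIsUnit_right u h0 hU] at this
  simpa [X_subst] using this

/-- Application of a linear functional to the coefficients of a series. -/
def mapFunctional (φ : Polynomial ℂ →ₗ[ℂ] ℂ) (G : PowerSeries (Polynomial ℂ)) : PowerSeries ℂ :=
  PowerSeries.mk fun n => φ (coeff n G)

theorem mapFunctional_inZ_mul (φ : Polynomial ℂ →ₗ[ℂ] ℂ) (f : PowerSeries ℂ)
    (G : PowerSeries (Polynomial ℂ)) :
    mapFunctional φ (inZ f * G) = f * mapFunctional φ G := by
  ext n
  simp only [mapFunctional, coeff_mk, coeff_mul, inZ, coeff_map, map_sum,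
    ← Polynomial.smul_eq_C_mul, map_smul, smul_eq_mul]

/-- Here `H = 1 / (1 - w x)` is expanded as `∑ wⁱ xⁱ`. Since `w` has no constant term, the
coefficient of `z^N` sees only the powers `i ≤ N`, so finite geometric sums suffice. -/
theorem mapFunctional_geometric (φ : Polynomial ℂ →ₗ[ℂ] ℂ) {w : PowerSeries ℂ}
    (hw : constantCoeff w = 0) {H : PowerSeries (Polynomial ℂ)}
    (h : H * (1 - inZ w * varX) = 1) :
    mapFunctional φ H = (PowerSeries.mk fun n => φ (Polynomial.X ^ n)).subst w := by
  have hw' : X ∣ w := X_dvd_iff.2 hw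
  have hlow : ∀ N n, N < n → coeff N (w ^ n) = 0 := fun N n hn =>
    X_pow_dvd_iff.1 (pow_dvd_pow_of_dvd hw' n) N hn
  ext N
  rw [coeff_subst' (HasSubst.of_constantCoeff_zero' hw), finsum_eq_sum_of_support_subset
    (s := Finset.range (N + 1))]
  · set y := inZ w * varX with hy
    have hgeom : H = ∑ i ∈ Finset.range (N + 1), y ^ i + H * y ^ (N + 1) := by
      have := mul_neg_geom_sum y (N + 1)
      calc H = H * ((1 - y) * ∑ i ∈ Finset.range (N + 1), y ^ i + y ^ (N + 1)) := by
            rw [this]; ring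
        _ = (H * (1 - y)) * ∑ i ∈ Finset.range (N + 1), y ^ i + H * y ^ (N + 1) := by ring
        _ = _ := by rw [h, one_mul]
    have hyp : ∀ i, y ^ i = inZ (w ^ i) * PowerSeries.C (Polynomial.X ^ i) := by
      intro i
      rw [hy, mul_pow, inZ, inZ, varX, map_pow, map_pow]
    have hz : coeff N (H * y ^ (N + 1)) = 0 := by
      have hdvd : X ^ (N + 1) ∣ H * y ^ (N + 1) := by
        rw [hy, mul_pow]
        refine Dvd.dvd.mul_left (Dvd.dvd.mul_right (pow_dvd_pow_of_dvd ?_ _) _) _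
        rw [X_dvd_iff, inZ, ← coeff_zero_eq_constantCoeff_apply, coeff_map]
        simp [hw]
      exact X_pow_dvd_iff.1 hdvd N (Nat.lt_succ_self N)
    rw [mapFunctional, coeff_mk, hgeom, map_add, hz, add_zero, map_sum, map_sum]
    refine Finset.sum_congr rfl fun i _ => ?_
    rw [hyp, coeff_mul_C, inZ, coeff_map, ← Polynomial.smul_eq_C_mul, map_smul, coeff_mk,
      smul_eq_mul, smul_eq_mul, mul_comm]
  · intro n hn
    by_contra hcon
    simp only [Finset.coe_range, Set.mem_Iio, not_lt] at hcon
    exact hn (by simp [hlow N n (by omega)])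

/-- The series `1 + a z + c z²`. -/
def quadSeries (a c : ℝ) : PowerSeries ℂ := 1 + C ((a : ℝ) : ℂ) * X + C ((c : ℝ) : ℂ) * X ^ 2

theorem constantCoeff_quadSeries (a c : ℝ) : constantCoeff (quadSeries a c) = 1 := by
  simp [quadSeries]

theorem quadSeries_mul_inv (a c : ℝ) : quadSeries a c * (quadSeries a c)⁻¹ = 1 :=
  PowerSeries.mul_inv_cancel _ (by simp [constantCoeff_quadSeries])

/-- The series `u(z) = z / (1 + a z + c z²)`. -/
def shefferU (a c : ℝ) : PowerSeries ℂ := X * (quadSeries a c)⁻¹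

theorem isP01_shefferU (a c : ℝ) : IsP01 (shefferU a c) := by
  refine ⟨by simp [shefferU], ?_⟩
  rw [shefferU, ← zero_add 1, coeff_succ_X_mul]
  simp [PowerSeries.constantCoeff_inv, constantCoeff_quadSeries]

theorem quadSeries_mul_shefferU (a c : ℝ) : quadSeries a c * shefferU a c = X := by
  rw [shefferU, mul_left_comm, quadSeries_mul_inv, mul_one]

theorem inZ_mul (f g : PowerSeries ℂ) : inZ (f * g) = inZ f * inZ g := map_mul _ _ _

theorem inZ_add (f g : PowerSeries ℂ) : inZ (f + g) = inZ f + inZ g := map_add _ _ _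

theorem inZ_one : inZ 1 = 1 := map_one _

theorem inZ_X : inZ X = X := by simp [inZ]

/-! ### Generating function and `R`-transform of a three-term recursion. -/

/-- Each coefficient is one instance of the recursion. The exceptional values at `n = 1` and `n = 2`
leave the remainders `a` and `c`, which is why the right side is `1 + a z + c z²` and not `1`. -/
theorem IsThreeTerm.genSeries_mul {a b c d : ℝ} {P : ℕ → ℝ≥0 → Polynomial ℂ}
    (h : IsThreeTerm a b c d P) (t : ℝ≥0) :
    genSeries P t * (inZ (quadSeries (a + b * t) (c + d * t)) - inZ X * varX) =
      inZ (quadSeries a c) := by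
  have e : genSeries P t * (inZ (quadSeries (a + b * t) (c + d * t)) - inZ X * varX) =
      genSeries P t + genSeries P t * X *
        C (Polynomial.C ((a + b * t : ℝ) : ℂ) - Polynomial.X) +
      genSeries P t * X ^ 2 * C (Polynomial.C ((c + d * t : ℝ) : ℂ)) := by
    simp only [inZ, quadSeries, varX, map_add, map_mul, map_sub, map_pow, map_one, map_X, map_C]
    ring
  rw [e]
  ext1 n
  match n with
  | 0 => simp [genSeries, h.zero, inZ, quadSeries]
  | 1 =>
    simp only [map_add, coeff_mul_C, genSeries, coeff_succ_mul_X, coeff_mk, coeff_mul_X_pow']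
    simp [h.zero, h.one, inZ, quadSeries, coeff_X_pow]
  | 2 =>
    simp only [map_add, coeff_mul_C, genSeries, coeff_succ_mul_X, coeff_mk, coeff_mul_X_pow']
    simp [h.zero, h.two, h.one, inZ, quadSeries, coeff_one]
    ring
  | n + 3 =>
    simp only [map_add, coeff_mul_C, genSeries, coeff_succ_mul_X, coeff_mk, coeff_mul_X_pow']
    simp [h.add_three, inZ, quadSeries, coeff_X_pow, coeff_one]
    ring

/-- With `w = z / D`, the generating series is `(A / D) / (1 - w x)`. A centering functional sends
it to `1`, so the moment series at `w` equals `D / A`, and multiplying by `w` gives `z / A`. -/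
theorem IsThreeTerm.cauchySeries_subst {a b c d : ℝ} {P : ℕ → ℝ≥0 → Polynomial ℂ}
    (h : IsThreeTerm a b c d P) {t : ℝ≥0} {ν : Measure ℝ} (hν : IsCentering ν (fun n => P n t)) :
    (cauchySeries ν).subst (shefferU (a + b * t) (c + d * t)) = shefferU a c := by
  have := hν.isProbabilityMeasure
  set D := quadSeries (a + b * t) (c + d * t) with hD
  set A := quadSeries a c with hA
  set w := shefferU (a + b * t) (c + d * t) with hw
  have hDw : D * w = X := quadSeries_mul_shefferU _ _
  have hA1 : A * A⁻¹ = 1 := quadSeries_mul_inv _ _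
  set φ := momentFunctional ν hν.hasAllMoments with hφ
  have hH : inZ (A⁻¹ * D) * genSeries P t * (1 - inZ w * varX) = 1 := by
    calc inZ (A⁻¹ * D) * genSeries P t * (1 - inZ w * varX)
        = inZ A⁻¹ * (genSeries P t * (inZ D - inZ (D * w) * varX)) := by
          simp only [inZ_mul]; ring
      _ = inZ (A * A⁻¹) := by rw [hDw, h.genSeries_mul, inZ_mul, mul_comm]
      _ = 1 := by rw [hA1, inZ_one]
  have hw0 : constantCoeff w = 0 := (isP01_shefferU _ _).1
  have hgeo := mapFunctional_geometric φ hw0 hH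
  have hone : mapFunctional φ (genSeries P t) = 1 := by
    ext n
    rw [mapFunctional, coeff_mk, genSeries, coeff_mk, coeff_one]
    cases n with
    | zero => simp [h.zero, hφ, momentFunctional_one]
    | succ n =>
      rw [if_neg n.succ_ne_zero, hφ, momentFunctional_apply]
      exact hν.integral_eq_zero n
  have hmk : (PowerSeries.mk fun n => φ (Polynomial.X ^ n)) =
      PowerSeries.mk fun n => (moment ν n : ℂ) := by
    ext n; simp only [coeff_mk, hφ, momentFunctional_X_pow]
  rw [mapFunctional_inZ_mul, hone, mul_one, hmk] at hgeo
  have hs : HasSubst w := HasSubst.of_constantCoeff_zero' hw0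
  rw [cauchySeries, subst_mul hs, subst_X hs, ← hgeo]
  calc w * (A⁻¹ * D) = A⁻¹ * (D * w) := by ring
    _ = shefferU a c := by rw [hDw, shefferU, mul_comm]

/-- Substituting `w` in `cauchySeries_eq` gives `u = w (1 + u R(u))`. Since `D w = z` and `A u = z`,
this says `D = A + z R(u)`, and `D - A = t z (b + d z)`. -/
theorem IsThreeTerm.rTransform_subst {a b c d : ℝ} {P : ℕ → ℝ≥0 → Polynomial ℂ}
    (h : IsThreeTerm a b c d P) {t : ℝ≥0} {ν : Measure ℝ} (hν : IsCentering ν (fun n => P n t)) :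
    (rTransform ν).subst (shefferU a c) = ((t : ℝ) : ℂ) • (C (b : ℂ) + C (d : ℂ) * X) := by
  have := hν.isProbabilityMeasure
  have hw0 := (isP01_shefferU (a + b * t) (c + d * t)).1
  have hs := HasSubst.of_constantCoeff_zero' hw0
  have hg : HasSubst (cauchySeries ν) :=
    HasSubst.of_constantCoeff_zero' (constantCoeff_cauchySeries ν)
  have key := congrArg (substAlgHom (R := ℂ) hs) (cauchySeries_eq ν)
  simp only [map_mul, map_add, map_one, coe_substAlgHom, subst_X hs,
    subst_comp_subst_apply hg hs, h.cauchySeries_subst hν] at key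
  set R := (rTransform ν).subst (shefferU a c) with hR
  have hDw := quadSeries_mul_shefferU (a + b * t) (c + d * t)
  have hAu := quadSeries_mul_shefferU a c
  set w := shefferU (a + b * t) (c + d * t)
  set u := shefferU a c
  have e1 : X * quadSeries (a + b * t) (c + d * t) = X * (quadSeries a c + X * R) := by
    calc X * quadSeries (a + b * t) (c + d * t)
        = quadSeries a c * (quadSeries (a + b * t) (c + d * t)) * u := by rw [← hAu]; ring
      _ = quadSeries a c * (quadSeries (a + b * t) (c + d * t)) * (w * (1 + u * R)) := by
          rw [← key]
      _ = (quadSeries (a + b * t) (c + d * t) * w) * (quadSeries a c + (quadSeries a c * u) * R) := by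
          ring
      _ = _ := by rw [hDw, hAu]
  have e2 := mul_left_cancel₀ X_ne_zero e1
  have e3 : X * R = X * (((t : ℝ) : ℂ) • (C (b : ℂ) + C (d : ℂ) * X)) := by
    have : X * R = quadSeries (a + b * t) (c + d * t) - quadSeries a c := by rw [e2]; ring
    rw [this, smul_eq_C_mul]
    simp only [quadSeries, Complex.ofReal_add, Complex.ofReal_mul, map_add, map_mul]
    ring
  exact mul_left_cancel₀ X_ne_zero e3

theorem IsThreeTerm.genSeries_mul_shefferU {a b c d : ℝ} {P : ℕ → ℝ≥0 → Polynomial ℂ}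
    (h : IsThreeTerm a b c d P) (t : ℝ≥0) :
    genSeries P t * (1 + inZ (shefferU a c * (((t : ℝ) : ℂ) • (C (b : ℂ) + C (d : ℂ) * X)))
      - inZ (shefferU a c) * varX) = 1 := by
  have hA1 := quadSeries_mul_inv a c
  have hD : quadSeries (a + b * t) (c + d * t) = quadSeries a c +
      X * (((t : ℝ) : ℂ) • (C (b : ℂ) + C (d : ℂ) * X)) := by
    rw [smul_eq_C_mul]
    simp only [quadSeries, Complex.ofReal_add, Complex.ofReal_mul, map_add, map_mul]
    ring
  have e := h.genSeries_mul t
  rw [hD] at e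
  set Y := (((t : ℝ) : ℂ) • (C (b : ℂ) + C (d : ℂ) * X) : PowerSeries ℂ)
  have hu : shefferU a c = X * (quadSeries a c)⁻¹ := rfl
  rw [hu]
  have hA2 : inZ (quadSeries a c) * inZ (quadSeries a c)⁻¹ = 1 := by
    rw [← inZ_mul, hA1, inZ_one]
  have e' := congrArg (· * inZ (quadSeries a c)⁻¹) e
  simp only [hA2] at e'
  refine Eq.trans ?_ e'
  rw [← hA2]
  simp only [inZ_mul, inZ_add]
  ring

end PowerSeries

/-! ### Sufficiency -/

/-- It holds because `(x - b t)²` is `P_2 + a P_1 + d t`. Thus `d ≠ 0` is exactly non-triviality. -/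
theorem variance_eq_of_isThreeTerm {a b c d : ℝ} {P : ℕ → ℝ≥0 → Polynomial ℂ}
    (h : IsThreeTerm a b c d P) {t : ℝ≥0} {ν : Measure ℝ} (hν : IsCentering ν (fun n => P n t)) :
    ProbabilityTheory.variance (fun x : ℝ => x) ν = d * t := by
  have := hν.isProbabilityMeasure
  set φ := momentFunctional ν hν.hasAllMoments with hφ
  have h1 : φ (P 1 t) = 0 := hν.integral_eq_zero 0
  have h2 : φ (P 2 t) = 0 := hν.integral_eq_zero 1
  have hone : φ 1 = 1 := momentFunctional_one _
  have hC : ∀ r : ℂ, φ (Polynomial.C r) = r := fun r => by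
    rw [← mul_one (Polynomial.C r), hφ, momentFunctional_C_mul, ← hφ, hone, mul_one]
  have hmean : ∫ x, x ∂ν = b * t := by
    have e : φ Polynomial.X = ((∫ x, x ∂ν : ℝ) : ℂ) := by
      have := momentFunctional_X_pow hν.hasAllMoments 1
      simpa [moment] using this
    rw [h.one, map_sub, hC, e, sub_eq_zero] at h1
    exact_mod_cast h1
  rw [ProbabilityTheory.variance_eq_integral (by fun_prop), hmean]
  have e : φ ((Polynomial.X - Polynomial.C ((b * t : ℝ) : ℂ)) ^ 2) =
      ((∫ x, (x - b * t) ^ 2 ∂ν : ℝ) : ℂ) := by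
    rw [hφ, momentFunctional_apply, ← integral_complex_ofReal]
    simp
  have e2 : (Polynomial.X - Polynomial.C ((b * t : ℝ) : ℂ)) ^ 2 =
      P 2 t + Polynomial.C ((a : ℝ) : ℂ) * P 1 t + Polynomial.C ((d * t : ℝ) : ℂ) := by
    rw [h.two, h.one, Complex.ofReal_add, map_add]; ring
  rw [e2, map_add, map_add, h2, hφ, momentFunctional_C_mul, ← hφ, h1, hC] at e
  simp only [mul_zero, zero_add] at e
  exact_mod_cast e.symm

/-- No free convolution has to be computed: `R(u) = t (b + d z)` is linear in `t`, and `u` can be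
cancelled. -/
theorem isFreeMeixnerWith_of_isThreeTerm {a b c d : ℝ} {μ : ℝ≥0 → Measure ℝ}
    {P : ℕ → ℝ≥0 → Polynomial ℂ} (hP : IsThreeTerm a b c d P) (hd : d ≠ 0)
    (hμ0 : μ 0 = Measure.dirac 0) (hμ : ∀ t, IsCentering (μ t) (fun n => P n t)) :
    IsFreeMeixnerWith μ P (shefferU a c) := by
  have hR := fun t => hP.rTransform_subst (hμ t)
  have hu := isP01_shefferU a c
  have hs : PowerSeries.HasSubst (shefferU a c) := PowerSeries.HasSubst.of_constantCoeff_zero' hu.1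
  have hR1 : ∀ t, rTransform (μ t) = ((t : ℝ) : ℂ) • rTransform (μ 1) := by
    intro t
    refine subst_left_injective hu.1 hu.2 ?_
    rw [PowerSeries.subst_smul hs, hR, hR]
    simp
  have hsh : IsFreeSheffer μ P (shefferU a c) := by
    refine ⟨hu, hu, fun t => ?_⟩
    rw [hR, mul_left_comm, hP.genSeries_mul_shefferU, mul_one]
  refine ⟨⟨⟨fun t => (hμ t).isProbabilityMeasure, fun t => (hμ t).hasAllMoments, hμ0,
    fun s t => ?_, hR1⟩, fun t => ⟨fun n => (hP.monic_and_natDegree t n).1,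
      fun n => (hP.monic_and_natDegree t n).2, fun m n hmn => ?_⟩, _, _, hsh⟩, ?_, hsh, fun t => ?_⟩
  · rw [IsFreeConvolution, hR1 (s + t), hR1 s, hR1 t]
    push_cast
    rw [add_smul]
  · have := hP.eq_zero_mul t (φ := momentFunctional _ (hμ t).hasAllMoments)
      (fun n => (hμ t).integral_eq_zero n) hmn
    simpa [momentFunctional_apply] using this
  · rw [IsNontrivial, variance_eq_of_isThreeTerm hP (hμ 1)]
    simpa using hd
  · rw [hR, NNReal.coe_one, Complex.ofReal_one, one_smul, ← mul_smul_comm]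
    exact hP.genSeries_mul_shefferU t

/-! ### Necessity -/

theorem IsFreeMeixner.zero {μ : ℝ≥0 → Measure ℝ} {P : ℕ → ℝ≥0 → Polynomial ℂ}
    (h : IsFreeMeixner μ P) (t : ℝ≥0) : P 0 t = 1 :=
  Polynomial.eq_one_of_monic_natDegree_zero ((h.orthogonal t).monic 0)
    ((h.orthogonal t).natDegree_eq 0)

theorem IsFreeMeixner.isCentering {μ : ℝ≥0 → Measure ℝ} {P : ℕ → ℝ≥0 → Polynomial ℂ}
    (h : IsFreeMeixner μ P) (t : ℝ≥0) : IsCentering (μ t) (fun n => P n t) := by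
  refine ⟨h.semigroup.isProbabilityMeasure t, h.semigroup.hasAllMoments t, fun n => ?_⟩
  simpa [h.zero] using (h.orthogonal t).orthogonal (n + 1) 0 n.succ_ne_zero

section PowerSeries

open PowerSeries

/-- Set `t = 0` and `x = 0`. Since `μ_0 = δ₀`, centering gives `P_n(0, 0) = 0` for `n ≥ 1`, and the
`R`-transform vanishes, so the defining identity collapses to `u = v`. -/
theorem IsFreeMeixner.isFreeSheffer {μ : ℝ≥0 → Measure ℝ} {P : ℕ → ℝ≥0 → Polynomial ℂ}
    (h : IsFreeMeixner μ P) : ∃ u, IsFreeSheffer μ P u := by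
  obtain ⟨u, v, huv⟩ := h.sheffer
  have hv : HasSubst v := HasSubst.of_constantCoeff_zero' huv.isP01_right.1
  have hR : rTransform (μ 0) = 0 := by
    rw [h.semigroup.rTransform_eq]; simp
  have key := congrArg (PowerSeries.map (Polynomial.evalRingHom (0 : ℂ))) (huv.genSeries_mul 0)
  have hz : ∀ f : PowerSeries ℂ, PowerSeries.map (Polynomial.evalRingHom (0 : ℂ)) (inZ f) = f := by
    intro f; ext n; simp [inZ]
  have hG : PowerSeries.map (Polynomial.evalRingHom (0 : ℂ)) (genSeries P 0) = 1 := by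
    ext n
    rw [coeff_map, genSeries, coeff_mk, coeff_one]
    cases n with
    | zero => simp [h.zero]
    | succ n =>
      have := (h.isCentering 0).integral_eq_zero n
      rw [h.semigroup.zero] at this
      simpa using this
  have h0 : (0 : PowerSeries ℂ).subst v = 0 := by
    rw [← coe_substAlgHom hv, map_zero]
  rw [hR, h0, mul_zero] at key
  simp only [map_mul, map_add, map_sub, map_one, hz, hG, varX, map_C] at key
  have : u = v := by simpa using key
  exact ⟨u, by rw [IsFreeSheffer]; nth_rw 2 [this]; exact huv⟩

theorem exists_mul_eq_X {u : PowerSeries ℂ} (hu : IsP01 u) :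
    ∃ A : PowerSeries ℂ, constantCoeff A = 1 ∧ A * u = X := by
  obtain ⟨k, hk⟩ := X_dvd_iff.2 hu.1
  have hk1 : constantCoeff k = 1 := by
    have := hu.2
    rw [hk, ← zero_add 1, coeff_succ_X_mul] at this
    simpa using this
  refine ⟨k⁻¹, by simp [PowerSeries.constantCoeff_inv, hk1], ?_⟩
  rw [hk, mul_left_comm, PowerSeries.inv_mul_cancel _ (by simp [hk1]), mul_one]

/-- The series are `A = z / u` and `B = R_μ(u)`. The Sheffer identity is multiplied by `A²`, and one
factor `z = A u` is then cancelled. -/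
theorem IsFreeMeixner.exists_genSeries_mul {μ : ℝ≥0 → Measure ℝ} {P : ℕ → ℝ≥0 → Polynomial ℂ}
    (h : IsFreeMeixner μ P) : ∃ A B : PowerSeries ℂ, constantCoeff A = 1 ∧ ∀ t : ℝ≥0,
      genSeries P t * (inZ (A + X * (((t : ℝ) : ℂ) • B)) - X * varX) = inZ A := by
  obtain ⟨u, hu⟩ := h.isFreeSheffer
  obtain ⟨A, hA, hAu⟩ := exists_mul_eq_X hu.isP01_left
  have hs : HasSubst u := HasSubst.of_constantCoeff_zero' hu.isP01_left.1
  refine ⟨A, (rTransform (μ 1)).subst u, hA, fun t => ?_⟩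
  have e := hu.genSeries_mul t
  rw [h.semigroup.rTransform_eq, subst_smul hs] at e
  set Y := ((t : ℝ) : ℂ) • (rTransform (μ 1)).subst u
  have hne : X ≠ (0 : PowerSeries (Polynomial ℂ)) := X_ne_zero
  refine mul_left_cancel₀ hne ?_
  have hX : inZ A * inZ u = X := by rw [← inZ_mul, hAu, inZ_X]
  calc X * (genSeries P t * (inZ (A + X * Y) - X * varX))
      = inZ A * inZ A * (genSeries P t * (inZ u * (1 + inZ (u * Y) - inZ u * varX))) := by
        rw [inZ_add, inZ_mul X, inZ_X, ← hX, inZ_mul u]; ring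
    _ = inZ A * (inZ A * inZ u) := by rw [e]; ring
    _ = _ := by rw [hX, mul_comm]

end PowerSeries

/-- The expansion of `x P_n` obtained from the generating function. -/
theorem X_mul_eq_sum {A B : PowerSeries ℂ} {P : ℕ → ℝ≥0 → Polynomial ℂ} {t : ℝ≥0}
    (h : genSeries P t * (inZ (A + PowerSeries.X * (((t : ℝ) : ℂ) • B)) - PowerSeries.X * varX) =
      inZ A) (n : ℕ) :
    Polynomial.X * P n t = ∑ i ∈ Finset.HasAntidiagonal.antidiagonal (n + 1),
      (PowerSeries.coeff i.2 (A + PowerSeries.X * (((t : ℝ) : ℂ) • B))) • P i.1 t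
        - Polynomial.C (PowerSeries.coeff (n + 1) A) := by
  have := congrArg (PowerSeries.coeff (n + 1)) h
  rw [mul_sub, map_sub, PowerSeries.coeff_mul, ← mul_assoc, varX, PowerSeries.coeff_mul_C,
    PowerSeries.coeff_succ_mul_X] at this
  simp only [inZ, PowerSeries.coeff_map, genSeries, PowerSeries.coeff_mk] at this
  rw [← this, mul_comm]
  simp only [Polynomial.smul_eq_C_mul, mul_comm]
  ring

theorem momentFunctional_ofReal {ν : Measure ℝ} (h : HasAllMoments ν) {p : Polynomial ℂ}
    {r : ℝ → ℝ} (hp : ∀ x : ℝ, p.eval (x : ℂ) = (r x : ℂ)) :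
    momentFunctional ν h p = ((∫ x, r x ∂ν : ℝ) : ℂ) := by
  rw [momentFunctional_apply, ← integral_complex_ofReal]
  simp only [hp]

/-- Let `α k` and `β k` be the coefficients of `A` and `B`. Pairing the expansion of `x P_n` with
`P_0` shows that `t β n` is the integral of `x P_n`, which is zero for `n ≥ 2`. Pairing with `P_1`
then shows `α n = 0` for `n ≥ 3`, as `P_1` has non-zero norm at `t = 1`. What is left of the
expansion is a three-term recursion. -/
theorem IsFreeMeixner.exists_isThreeTerm {μ : ℝ≥0 → Measure ℝ} {P : ℕ → ℝ≥0 → Polynomial ℂ}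
    (h : IsFreeMeixner μ P) (hnt : IsNontrivial μ) :
    ∃ a b c d : ℝ, 0 ≤ c ∧ 0 < d ∧ IsThreeTerm a b c d P := by
  obtain ⟨A, B, hA, hG⟩ := h.exists_genSeries_mul
  have hprob := fun t => h.semigroup.isProbabilityMeasure t
  set φ := fun t => momentFunctional (μ t) (h.semigroup.hasAllMoments t) with hφ
  set α := fun k => PowerSeries.coeff k A with hα
  set β := fun k => PowerSeries.coeff k B with hβ
  have he : ∀ (t : ℝ≥0) (k : ℕ), PowerSeries.coeff (k + 1)
      (A + PowerSeries.X * (((t : ℝ) : ℂ) • B)) = α (k + 1) + t * β k := by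
    intro t k
    rw [map_add, PowerSeries.coeff_succ_X_mul]
    simp [hα, hβ]
  have he0 : ∀ t : ℝ≥0, PowerSeries.coeff 0
      (A + PowerSeries.X * (((t : ℝ) : ℂ) • B)) = 1 := by
    intro t; simp [hA]
  have hXP := fun t => X_mul_eq_sum (hG t)
  have horth : ∀ t m n, m ≠ n → φ t (P m t * P n t) = 0 := by
    intro t m n hmn
    simpa [hφ, momentFunctional_apply] using (h.orthogonal t).orthogonal m n hmn
  have hone : ∀ t, φ t 1 = 1 := fun t => momentFunctional_one _
  have hzero : ∀ t n, φ t (P (n + 1) t) = 0 := fun t n => (h.isCentering t).integral_eq_zero n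
  have hC : ∀ t (r : ℂ) p, φ t (Polynomial.C r * p) = r * φ t p := fun t r p =>
    momentFunctional_C_mul _ r p
  have hlow : ∀ t (N n : ℕ) (q : Polynomial ℂ), N ≤ n → q.degree < (N : WithBot ℕ) →
      φ t (q * P n t) = 0 := by
    intro t N n q hNn hq
    exact eq_zero_of_degree_lt (φ := φ t ∘ₗ LinearMap.mulRight ℂ (P n t))
      (h.orthogonal t).monic (h.orthogonal t).natDegree_eq
      (fun k hk => horth t k n (by omega)) hq
  -- pairing with `P 0` and `P 1`
  have hX0 : ∀ t n, φ t (Polynomial.X * P n t) = t * β n := by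
    intro t n
    rw [hXP, map_sub, map_sum, Finset.sum_eq_single (0, n + 1)]
    · have := hC t (PowerSeries.coeff (n + 1) A) 1
      rw [mul_one, hone, mul_one] at this
      rw [map_smul, h.zero, hone, this, he]
      simp [hα]
    · rintro ⟨i, j⟩ hij hne
      obtain ⟨k, rfl⟩ : ∃ k, i = k + 1 := by
        refine Nat.exists_eq_succ_of_ne_zero ?_
        rintro rfl
        rw [Finset.HasAntidiagonal.mem_antidiagonal, zero_add] at hij
        exact hne (Prod.ext rfl hij)
      rw [map_smul, hzero, smul_zero]
    · simp
  have hX1 : ∀ t n, φ t (Polynomial.X * P n t * P 1 t) =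
      PowerSeries.coeff n (A + PowerSeries.X * (((t : ℝ) : ℂ) • B)) * φ t (P 1 t * P 1 t) := by
    intro t n
    rw [hXP, sub_mul, map_sub, hC, hzero, mul_zero, sub_zero, Finset.sum_mul, map_sum,
      Finset.sum_eq_single (1, n)]
    · rw [smul_mul_assoc, map_smul, smul_eq_mul]
    · rintro ⟨i, j⟩ hij hne
      have : i ≠ 1 := by
        rintro rfl
        rw [Finset.HasAntidiagonal.mem_antidiagonal] at hij
        exact hne (by rw [show j = n by omega])
      rw [smul_mul_assoc, map_smul, horth t i 1 this, smul_zero]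
    · intro hn
      exact absurd (Finset.HasAntidiagonal.mem_antidiagonal.2 (by omega)) hn
  -- the first polynomials
  have hP1 : ∀ t, P 1 t = Polynomial.X - Polynomial.C (t * β 0) := by
    intro t
    have := hXP t 0
    rw [Finset.Nat.sum_antidiagonal_eq_sum_range_succ_mk, Finset.sum_range_succ,
      Finset.sum_range_succ, Finset.sum_range_zero, show 0 + 1 - 0 = 0 + 1 from rfl,
      show 0 + 1 - (0 + 1) = 0 from rfl, he, he0, h.zero, mul_one, zero_add, zero_add,
      Polynomial.smul_eq_C_mul, mul_one, one_smul] at this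
    rw [this]
    simp only [hα, map_add]
    ring
  have hN : ∀ t, φ t (P 1 t * P 1 t) = t * β 1 := by
    intro t
    rw [← hX0]
    nth_rw 1 [hP1]
    rw [sub_mul, map_sub, hC, hzero, mul_zero, sub_zero]
  -- The coefficients are a priori complex. Each of the four survivors is identified with an
  -- expression in integrals of real functions against `μ 1`.
  set b := ∫ x, x ∂(μ 1) with hb
  have hβ0 : β 0 = b := by
    have e1 := hX0 1 0
    rw [h.zero, mul_one] at e1
    have e2 := momentFunctional_ofReal (h.semigroup.hasAllMoments 1) (p := Polynomial.X)
      (r := fun x => x) (fun x => by simp)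
    rw [← hb] at e2
    rw [← e2]
    simpa using e1.symm
  have hP1r : ∀ (t : ℝ≥0) (x : ℝ), (P 1 t).eval (x : ℂ) = ((x - b * t : ℝ) : ℂ) := by
    intro t x
    rw [hP1, hβ0]
    simp [mul_comm]
  set d := ProbabilityTheory.variance (fun x : ℝ => x) (μ 1) with hd
  have hβ1 : β 1 = d := by
    have e1 := hN 1
    have e2 := momentFunctional_ofReal (h.semigroup.hasAllMoments 1) (p := P 1 1 * P 1 1)
      (r := fun x => (x - b) ^ 2) (fun x => by
        rw [Polynomial.eval_mul, hP1r]; push_cast; simp; ring)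
    have e3 : ∫ x, (x - b) ^ 2 ∂(μ 1) = d := by
      rw [hd, ProbabilityTheory.variance_eq_integral (by fun_prop), hb]
    rw [e3] at e2
    rw [← e2]
    simpa using e1.symm
  have hd0 : d ≠ 0 := hnt
  have hdpos : 0 < d := lt_of_le_of_ne (ProbabilityTheory.variance_nonneg _ _) hd0.symm
  have hdC : (d : ℂ) ≠ 0 := by exact_mod_cast hd0
  -- vanishing of the higher coefficients
  have hβn : ∀ n, β (n + 2) = 0 := by
    intro n
    have e := hX0 1 (n + 2)
    rw [hlow 1 2 (n + 2) Polynomial.X (by omega)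
      (by rw [Polynomial.degree_X]; exact_mod_cast Nat.one_lt_two)] at e
    simpa using e.symm
  have hαn : ∀ n, α (n + 3) = 0 := by
    intro n
    have e := hX1 1 (n + 3)
    have hdeg : (Polynomial.X * P 1 1).degree < ((3 : ℕ) : WithBot ℕ) := by
      rw [Polynomial.degree_mul, Polynomial.degree_X, hP1, Polynomial.degree_X_sub_C]
      exact_mod_cast Nat.lt_succ_self 2
    rw [mul_right_comm, hlow 1 3 (n + 3) _ (by omega) hdeg, he, hN, hβ1, hβn] at e
    simpa [hdC] using e.symm
  -- the second polynomial
  have hP2 : ∀ t, P 2 t = (Polynomial.X - Polynomial.C (α 1 + t * β 0)) * P 1 t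
      - Polynomial.C (t * β 1) := by
    intro t
    have := hXP t 1
    rw [Finset.Nat.sum_antidiagonal_eq_sum_range_succ_mk, Finset.sum_range_succ,
      Finset.sum_range_succ, Finset.sum_range_succ, Finset.sum_range_zero,
      show 1 + 1 - 0 = 1 + 1 from rfl, show 1 + 1 - 1 = 0 + 1 from rfl,
      show 1 + 1 - (1 + 1) = 0 from rfl, he, he, he0, h.zero] at this
    simp only [Polynomial.smul_eq_C_mul, zero_add, mul_one, map_add, map_one, one_mul,
      Nat.reduceAdd] at this
    simp only [map_add]
    rw [sub_mul, this]
    simp only [hα]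
    ring
  -- Obtained by solving `∫ x P_1² = (α 1 + b) d`, the pairing of `x P_1` with `P_1` at `t = 1`.
  set a := (∫ x, x * (x - b) ^ 2 ∂(μ 1)) / d - b with ha
  have hα1 : α 1 = a := by
    have e1 := hX1 1 1
    have e2 := momentFunctional_ofReal (h.semigroup.hasAllMoments 1)
      (p := Polynomial.X * P 1 1 * P 1 1)
      (r := fun x => x * (x - b) ^ 2) (fun x => by
        rw [Polynomial.eval_mul, Polynomial.eval_mul, hP1r]; push_cast; simp; ring)
    have e3 : ∫ x, x * (x - b) ^ 2 ∂(μ 1) = (a + b) * d := by rw [ha]; field_simp; ring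
    rw [e3] at e2
    rw [e2, he, hN, hβ1, hβ0] at e1
    have : ((a : ℂ) + b) * d = (α 1 + b) * d := by simpa using e1
    exact (add_right_cancel (mul_right_cancel₀ hdC this)).symm
  have hP2r : ∀ (t : ℝ≥0) (x : ℝ), (P 2 t).eval (x : ℂ) =
      (((x - (a + b * t)) * (x - b * t) - d * t : ℝ) : ℂ) := by
    intro t x
    rw [hP2, hβ0, hβ1, hα1, Polynomial.eval_sub, Polynomial.eval_mul, hP1r]
    simp [mul_comm]
  -- The integral of `x P_2 P_1` is computed twice: from the expansion of `x P_2`, and by writing `x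
  -- P_1` as `P_2` plus lower terms, which leaves the integral of `P_2²`.
  have hN2 : ∀ t : ℝ≥0, (α 2 + t * d) * (t * d) =
      ((∫ x, ((x - (a + b * t)) * (x - b * t) - d * t) ^ 2 ∂(μ t) : ℝ) : ℂ) := by
    intro t
    have e1 := hX1 t 2
    rw [he, hN, hβ1] at e1
    have e2 := momentFunctional_ofReal (h.semigroup.hasAllMoments t) (p := P 2 t * P 2 t)
      (r := fun x => ((x - (a + b * t)) * (x - b * t) - d * t) ^ 2) (fun x => by
        rw [Polynomial.eval_mul, hP2r]; push_cast; ring)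
    rw [← e2, ← e1]
    have e3 : Polynomial.X * P 2 t * P 1 t = P 2 t * P 2 t +
        Polynomial.C (α 1 + t * β 0) * (P 1 t * P 2 t) + Polynomial.C (t * β 1) * P 2 t := by
      nth_rw 3 [hP2]
      ring
    rw [e3, map_add, map_add, hC, hC, hzero, horth t 1 2 (by norm_num)]
    simp [hφ]
  set c := (∫ x, ((x - (a + b)) * (x - b) - d) ^ 2 ∂(μ 1)) / d - d with hc
  have hα2 : α 2 = c := by
    have e := hN2 1
    have e3 : ∫ x, ((x - (a + b)) * (x - b) - d) ^ 2 ∂(μ 1) = (c + d) * d := by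
      rw [hc]; field_simp; ring
    simp only [NNReal.coe_one, mul_one, e3] at e
    have : (α 2 + d) * d = ((c : ℂ) + d) * d := by simpa using e
    exact add_right_cancel (mul_right_cancel₀ hdC this)
  have hpos : ∀ t : ℝ≥0, 0 ≤ (c + t * d) * (t * d) := by
    intro t
    have e := hN2 t
    rw [hα2] at e
    have e' : (c + t * d) * (t * d) =
        ∫ x, ((x - (a + b * t)) * (x - b * t) - d * t) ^ 2 ∂(μ t) := by
      exact_mod_cast e
    rw [e']
    exact integral_nonneg fun x => sq_nonneg _
  have hc0 : 0 ≤ c := by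
    by_contra hneg
    have hneg : c < 0 := not_le.1 hneg
    -- At this time the norm of `P_2` would be `-c² / 4`.
    have ht : 0 < -c / (2 * d) := div_pos (by linarith) (by linarith)
    have e : 0 ≤ (c + -c / (2 * d) * d) * (-c / (2 * d) * d) := hpos ⟨-c / (2 * d), ht.le⟩
    have hd' : -c / (2 * d) * d = -c / 2 := by field_simp
    rw [hd'] at e
    nlinarith
  refine ⟨a, b, c, d, hc0, hdpos, h.zero, fun t => ?_, fun t => ?_, fun n t => ?_⟩
  · rw [hP1, hβ0]; simp [mul_comm]
  · rw [hP2, hβ0, hβ1, hα1]; simp [mul_comm]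
  · have := hXP t (n + 2)
    -- Only the last three summands survive, those with `P_{n+1}`, `P_{n+2}` and `P_{n+3}`.
    rw [Finset.Nat.sum_antidiagonal_eq_sum_range_succ_mk, Finset.sum_range_succ,
      Finset.sum_range_succ, Finset.sum_range_succ, Finset.sum_eq_zero] at this
    · rw [show n + 2 + 1 - (n + 1) = 1 + 1 by omega, show n + 2 + 1 - (n + 2) = 0 + 1 by omega,
        show n + 2 + 1 - (n + 2 + 1) = 0 by omega, he, he, he0] at this
      have hz : PowerSeries.coeff (n + 2 + 1) A = 0 := hαn n
      rw [hz, zero_add, zero_add, one_add_one_eq_two, hα1, hα2, hβ0, hβ1] at this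
      simp only [Polynomial.smul_eq_C_mul, map_add, map_mul, map_one, map_zero] at this
      simp only [Complex.ofReal_add, Complex.ofReal_mul, map_add, map_mul]
      linear_combination -this
    · intro i hi
      obtain ⟨k, hk⟩ : ∃ k, n + 2 + 1 - i = k + 2 + 1 := ⟨n - i, by
        have := Finset.mem_range.1 hi; omega⟩
      simp only [hk]
      rw [he, hβn, hαn]
      simp

/-! ### Shifted Chebyshev polynomials -/

theorem chebU_zero (t : ℝ) : chebU 0 t = 1 := by
  simp [chebU]

theorem chebU_one (t : ℝ) : chebU 1 t = Polynomial.X := by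
  ext n
  rw [chebU, Polynomial.coeff_scaleRoots]
  simp only [Nat.cast_one, Polynomial.Chebyshev.S_one, Polynomial.natDegree_X,
    Polynomial.coeff_X]
  by_cases h : 1 = n <;> simp [h]

/-- `scaleRoots` multiplies the `i`-th coefficient by `√t` to the power degree minus `i`, so a drop
of the degree by two costs a factor `t`. -/
theorem chebU_add_two {t : ℝ} (ht : 0 ≤ t) (n : ℕ) :
    chebU (n + 2) t = Polynomial.X * chebU (n + 1) t - Polynomial.C (t : ℂ) * chebU n t := by
  have hd := fun n : ℕ => Polynomial.natDegree_eq_of_degree_eq_some (monic_S_and_degree n).2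
  have hs : ((√t : ℝ) : ℂ) ^ 2 = t := by exact_mod_cast congrArg Complex.ofReal (Real.sq_sqrt ht)
  have hS : Polynomial.Chebyshev.S ℂ ((n + 2 : ℕ) : ℤ) =
      Polynomial.X * Polynomial.Chebyshev.S ℂ ((n + 1 : ℕ) : ℤ)
        - Polynomial.Chebyshev.S ℂ (n : ℤ) := by
    push_cast; exact Polynomial.Chebyshev.S_add_two ℂ n
  ext i
  rw [Polynomial.coeff_sub, Polynomial.coeff_C_mul]
  have h0 : (Polynomial.Chebyshev.S ℂ n).coeff i * ((√t : ℝ) : ℂ) ^ (n + 2 - i) =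
      t * (chebU n t).coeff i := by
    rw [chebU, Polynomial.coeff_scaleRoots, hd]
    by_cases hi : i ≤ n
    · rw [show n + 2 - i = (n - i) + 2 by omega, pow_add, hs]; ring
    · rw [Polynomial.coeff_eq_zero_of_natDegree_lt (by rw [hd]; omega)]; simp
  rw [← h0, chebU, Polynomial.coeff_scaleRoots, hd, hS, Polynomial.coeff_sub, sub_mul]
  congr 1
  cases i with
  | zero => simp
  | succ i =>
    rw [Polynomial.coeff_X_mul, Polynomial.coeff_X_mul, chebU, Polynomial.coeff_scaleRoots, hd]
    rw [show n + 2 - (i + 1) = n + 1 - i by omega]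

theorem shiftedChebU_zero (α β : ℝ) : shiftedChebU 0 α β = 1 := by
  simp [shiftedChebU, chebU_zero]

theorem shiftedChebU_one (α β : ℝ) :
    shiftedChebU 1 α β = Polynomial.X - Polynomial.C (α : ℂ) := by
  simp [shiftedChebU, chebU_one]

theorem shiftedChebU_add_two (α : ℝ) {β : ℝ} (hβ : 0 ≤ β) (n : ℕ) :
    shiftedChebU (n + 2) α β = (Polynomial.X - Polynomial.C (α : ℂ)) * shiftedChebU (n + 1) α β
      - Polynomial.C (β : ℂ) * shiftedChebU n α β := by
  simp [shiftedChebU, chebU_add_two hβ]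

/-- The parametrization `θ ↦ α + 2 √β cos θ` of the support of `σ_{α,β}`. -/
def circleParam (α β θ : ℝ) : ℝ := α + 2 * √β * Real.cos θ

theorem measurable_circleParam (α β : ℝ) : Measurable (circleParam α β) := by
  unfold circleParam; fun_prop

theorem eval_shiftedChebU (n : ℕ) (α β θ : ℝ) :
    (shiftedChebU n α β).eval (circleParam α β θ : ℂ) * Real.sin θ =
      ((√β ^ n * Real.sin ((n + 1) * θ) : ℝ) : ℂ) := by
  have e : (circleParam α β θ : ℂ) - α = ((√β : ℝ) : ℂ) * (2 * Complex.cos θ) := by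
    simp only [circleParam]; push_cast; ring
  rw [shiftedChebU, Polynomial.eval_comp, Polynomial.eval_sub, Polynomial.eval_X,
    Polynomial.eval_C, e, eval_chebU, mul_assoc, Complex.ofReal_sin,
    Polynomial.Chebyshev.S_two_mul_complex_cos]
  push_cast
  rfl

theorem abs_sin_nat_succ_mul_le (n : ℕ) (θ : ℝ) :
    |Real.sin ((n + 1) * θ)| ≤ (n + 1) * |Real.sin θ| := by
  induction n with
  | zero => simp
  | succ n ih =>
    have e : Real.sin (((n + 1 : ℕ) + 1) * θ) =
        Real.sin ((n + 1) * θ) * Real.cos θ + Real.cos ((n + 1) * θ) * Real.sin θ := by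
      rw [← Real.sin_add]; push_cast; ring_nf
    rw [e]
    refine (abs_add_le _ _).trans ?_
    rw [abs_mul, abs_mul]
    have h1 := Real.abs_cos_le_one θ
    have h2 := Real.abs_cos_le_one ((n + 1) * θ)
    push_cast
    nlinarith [abs_nonneg (Real.sin ((n + 1) * θ)), abs_nonneg (Real.sin θ)]

/-- The growth `(n + 1) √β ^ n` on the support is what later excludes the fast solutions of linear
recursions. -/
theorem norm_eval_shiftedChebU_le (n : ℕ) (α β : ℝ) {θ : ℝ} (hθ : θ ∈ Set.Ioo 0 Real.pi) :
    ‖(shiftedChebU n α β).eval (circleParam α β θ : ℂ)‖ ≤ (n + 1) * √β ^ n := by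
  have hs := Real.sin_pos_of_mem_Ioo hθ
  have h := congrArg norm (eval_shiftedChebU n α β θ)
  rw [norm_mul, Complex.norm_real, Complex.norm_real, Real.norm_eq_abs, Real.norm_eq_abs, abs_mul,
    abs_of_nonneg (pow_nonneg (Real.sqrt_nonneg β) n)] at h
  have h2 := abs_sin_nat_succ_mul_le n θ
  rw [abs_of_pos hs] at h h2
  refine le_of_mul_le_mul_right ?_ hs
  rw [h]
  calc √β ^ n * |Real.sin ((n + 1) * θ)| ≤ √β ^ n * ((n + 1) * Real.sin θ) := by gcongr
    _ = _ := by ring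

/-! ### Integration against semicircular distributions -/

theorem image_circleParam (α : ℝ) {β : ℝ} (hβ : 0 < β) :
    circleParam α β '' Set.Icc 0 Real.pi = Set.Icc (α - 2 * √β) (α + 2 * √β) := by
  have hs : 0 < 2 * √β := by positivity
  have : circleParam α β = (fun y => α + 2 * √β * y) ∘ Real.cos := rfl
  rw [this, Set.image_comp, Real.bijOn_cos.image_eq]
  ext x
  simp only [Set.mem_image, Set.mem_Icc]
  constructor
  · rintro ⟨y, ⟨h1, h2⟩, rfl⟩
    constructor <;> nlinarith
  · rintro ⟨h1, h2⟩
    refine ⟨(x - α) / (2 * √β), ⟨?_, ?_⟩, ?_⟩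
    · rw [le_div_iff₀ hs]; linarith
    · rw [div_le_iff₀ hs]; linarith
    · field_simp; ring

/-- The image of `σ_{α,β}` under the inverse of `circleParam α β`. -/
def semicircleAngle : Measure ℝ :=
  (volume.restrict (Set.Ioo 0 Real.pi)).withDensity fun θ =>
    ENNReal.ofReal (2 / Real.pi * Real.sin θ ^ 2)

/-- Under `x = α + 2 √β cos θ` both the square root and the Jacobian become `2 √β sin θ`, which
gives the density `(2 / π) sin² θ`. -/
theorem semicircle_eq_map (α : ℝ) {β : ℝ} (hβ : 0 < β) :
    semicircle α β = Measure.map (circleParam α β) semicircleAngle := by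
  have hs : 0 < √β := Real.sqrt_pos.2 hβ
  rw [semicircle, if_neg hβ.ne', semicircleAngle, restrict_Ioo_eq_restrict_Icc]
  refine Measure.ext_of_lintegral _ fun F hF => ?_
  rw [lintegral_map hF (measurable_circleParam α β),
    lintegral_withDensity_eq_lintegral_mul _ (by fun_prop) hF,
    lintegral_withDensity_eq_lintegral_mul (g := fun θ => F (circleParam α β θ)) _ (by fun_prop)
      (hF.comp (measurable_circleParam α β)), ← image_circleParam α hβ,
    lintegral_image_eq_lintegral_abs_deriv_mul (f' := fun θ => 2 * √β * (-Real.sin θ))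
      measurableSet_Icc]
  · refine setLIntegral_congr_fun measurableSet_Icc fun θ hθ => ?_
    have hsin : 0 ≤ Real.sin θ := Real.sin_nonneg_of_mem_Icc hθ
    simp only [Pi.mul_apply]
    rw [← mul_assoc, ← ENNReal.ofReal_mul (abs_nonneg _)]
    congr 2
    have e : 4 * β - (circleParam α β θ - α) ^ 2 = (2 * √β * Real.sin θ) ^ 2 := by
      rw [circleParam]
      have h1 := Real.sq_sqrt hβ.le
      have h2 := Real.sin_sq_add_cos_sq θ
      linear_combination (-4 : ℝ) * h1 + 4 * (√β) ^ 2 * (-1 : ℝ) * h2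
    rw [e, Real.sqrt_sq (by positivity), mul_neg, abs_neg, abs_of_nonneg (by positivity)]
    nth_rw 2 [← Real.sq_sqrt hβ.le]
    field_simp
  · intro θ _
    have := ((Real.hasDerivAt_cos θ).const_mul (2 * √β)).const_add α
    exact this.hasDerivWithinAt
  · intro x hx y hy hxy
    refine Real.injOn_cos hx hy ?_
    simp only [circleParam, add_right_inj] at hxy
    exact mul_left_cancel₀ (by positivity) hxy

theorem withDensity_semicircle_eq_map (α : ℝ) {β : ℝ} (hβ : 0 < β) {w : ℝ → ℝ}
    (hw : Measurable w) :
    (semicircle α β).withDensity (fun x => ENNReal.ofReal (w x)) =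
      Measure.map (circleParam α β) ((volume.restrict (Set.Ioo 0 Real.pi)).withDensity
        fun θ => ENNReal.ofReal (2 / Real.pi * Real.sin θ ^ 2 * w (circleParam α β θ))) := by
  have hp := measurable_circleParam α β
  rw [semicircle_eq_map α hβ, semicircleAngle]
  refine Measure.ext_of_lintegral _ fun F hF => ?_
  rw [lintegral_withDensity_eq_lintegral_mul _ (by fun_prop) hF, lintegral_map (by fun_prop) hp,
    lintegral_map hF hp,
    lintegral_withDensity_eq_lintegral_mul _ (by fun_prop) (by fun_prop),
    lintegral_withDensity_eq_lintegral_mul _ (by fun_prop) (by fun_prop)]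
  refine lintegral_congr fun θ => ?_
  simp only [Pi.mul_apply]
  rw [ENNReal.ofReal_mul (p := 2 / Real.pi * Real.sin θ ^ 2) (by positivity), mul_assoc]

/-- The density `w` is admissible for `σ_{α,β}`: nonnegative, and with at most inverse square root
singularities at the ends of the support. -/
structure IsAdmissible (α β : ℝ) (w : ℝ → ℝ) : Prop where
  pos : 0 < β
  measurable : Measurable w
  nonneg : ∀ θ ∈ Set.Ioo 0 Real.pi, 0 ≤ w (circleParam α β θ)
  bounded : ∃ C, ∀ θ ∈ Set.Ioo 0 Real.pi, Real.sin θ ^ 2 * w (circleParam α β θ) ≤ C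

/-- The measure with density `w` with respect to `σ_{α,β}`. -/
def weighted (α β : ℝ) (w : ℝ → ℝ) : Measure ℝ :=
  (semicircle α β).withDensity fun x => ENNReal.ofReal (w x)

namespace IsAdmissible

variable {α β : ℝ} {w : ℝ → ℝ}

theorem integral_eq (h : IsAdmissible α β w) {f : ℝ → ℂ} (hf : Measurable f) :
    ∫ x, f x ∂(weighted α β w) = ∫ θ in Set.Ioo 0 Real.pi,
      ((2 / Real.pi * Real.sin θ ^ 2 * w (circleParam α β θ) : ℝ) : ℂ) *
        f (circleParam α β θ) := by
  have hp := measurable_circleParam α β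
  have hw := h.measurable
  rw [weighted, withDensity_semicircle_eq_map α h.pos hw,
    integral_map hp.aemeasurable hf.aestronglyMeasurable,
    integral_withDensity_eq_integral_toReal_smul (by fun_prop) (by simp)]
  refine setIntegral_congr_fun measurableSet_Ioo fun θ hθ => ?_
  rw [ENNReal.toReal_ofReal, Complex.real_smul]
  have := h.nonneg θ hθ
  positivity

theorem ae_of_forall (h : IsAdmissible α β w) {p : ℝ → Prop} (hp : MeasurableSet {x | p x})
    (H : ∀ θ ∈ Set.Ioo 0 Real.pi, p (circleParam α β θ)) : ∀ᵐ x ∂(weighted α β w), p x := by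
  rw [weighted, withDensity_semicircle_eq_map α h.pos h.measurable,
    ae_map_iff (measurable_circleParam α β).aemeasurable hp]
  refine (withDensity_absolutelyContinuous _ _).ae_le ?_
  change ∀ᵐ θ ∂(volume.restrict (Set.Ioo 0 Real.pi)), p (circleParam α β θ)
  rw [ae_restrict_iff' measurableSet_Ioo]
  exact Filter.Eventually.of_forall H

theorem isFiniteMeasure (h : IsAdmissible α β w) : IsFiniteMeasure (weighted α β w) := by
  have hw := h.measurable
  have hp := measurable_circleParam α β
  rw [weighted, withDensity_semicircle_eq_map α h.pos hw]
  obtain ⟨C, hC⟩ := h.bounded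
  have : IsFiniteMeasure ((volume.restrict (Set.Ioo 0 Real.pi)).withDensity
        fun θ => ENNReal.ofReal (2 / Real.pi * Real.sin θ ^ 2 * w (circleParam α β θ))) := by
    refine isFiniteMeasure_withDensity (ne_of_lt ?_)
    calc ∫⁻ θ in Set.Ioo 0 Real.pi,
          ENNReal.ofReal (2 / Real.pi * Real.sin θ ^ 2 * w (circleParam α β θ))
        ≤ ∫⁻ θ in Set.Ioo 0 Real.pi, ENNReal.ofReal (2 / Real.pi * C) := by
          refine setLIntegral_mono' measurableSet_Ioo fun θ hθ => ENNReal.ofReal_le_ofReal ?_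
          rw [mul_assoc]
          exact mul_le_mul_of_nonneg_left (hC θ hθ) (by positivity)
      _ < ⊤ := by
          rw [setLIntegral_const]
          exact ENNReal.mul_lt_top ENNReal.ofReal_lt_top (by simp)
  infer_instance

theorem abs_circleParam_le (α : ℝ) (β : ℝ) (θ : ℝ) :
    |circleParam α β θ| ≤ |α| + 2 * √β := by
  rw [circleParam]
  refine (abs_add_le _ _).trans ?_
  rw [abs_mul, abs_of_nonneg (by positivity : (0 : ℝ) ≤ 2 * √β)]
  nlinarith [Real.abs_cos_le_one θ, Real.sqrt_nonneg β]

theorem ae_abs_le (h : IsAdmissible α β w) :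
    ∀ᵐ x ∂(weighted α β w), |x| ≤ |α| + 2 * √β :=
  h.ae_of_forall (measurableSet_le (by fun_prop) (by fun_prop))
    fun θ _ => abs_circleParam_le α β θ

end IsAdmissible

theorem hasAllMoments_of_ae_abs_le {ν : Measure ℝ} [IsFiniteMeasure ν] {M : ℝ}
    (h : ∀ᵐ x ∂ν, |x| ≤ M) : HasAllMoments ν := by
  intro n
  refine Integrable.of_bound (by fun_prop) (M ^ n) ?_
  filter_upwards [h] with x hx
  rw [Real.norm_eq_abs, abs_pow]
  exact pow_le_pow_left₀ (abs_nonneg x) hx n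

theorem semicircle_eq_weighted (α β : ℝ) : semicircle α β = weighted α β fun _ => 1 := by
  simp [weighted]

theorem isAdmissible_one (α : ℝ) {β : ℝ} (hβ : 0 < β) : IsAdmissible α β fun _ => 1 :=
  ⟨hβ, measurable_const, fun _ _ => zero_le_one, 1, fun θ _ => by
    simpa using Real.sin_sq_le_one θ⟩

theorem integral_sin_mul_sin (n : ℕ) :
    ∫ θ in Set.Ioo 0 Real.pi, Real.sin θ * Real.sin ((n + 1) * θ) =
      if n = 0 then Real.pi / 2 else 0 := by
  rw [← integral_Ioc_eq_integral_Ioo, ← intervalIntegral.integral_of_le Real.pi_pos.le]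
  have hcos : ∀ m : ℕ, ∫ θ in (0 : ℝ)..Real.pi, Real.cos ((m + 1 : ℕ) * θ) = 0 := by
    intro m
    rw [intervalIntegral.integral_comp_mul_left (f := Real.cos) (by positivity), integral_cos,
      Real.sin_nat_mul_pi]
    simp
  have e : ∀ θ : ℝ, Real.sin θ * Real.sin ((n + 1) * θ) =
      Real.cos (n * θ) / 2 - Real.cos ((n + 2 : ℕ) * θ) / 2 := by
    intro θ
    have h1 : (n : ℝ) * θ = (n + 1) * θ - θ := by ring
    have h2 : ((n + 2 : ℕ) : ℝ) * θ = (n + 1) * θ + θ := by push_cast; ring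
    rw [h1, h2, Real.cos_sub, Real.cos_add]; ring
  simp only [e]
  rw [intervalIntegral.integral_sub (by apply Continuous.intervalIntegrable; fun_prop)
    (by apply Continuous.intervalIntegrable; fun_prop), intervalIntegral.integral_div,
    intervalIntegral.integral_div, hcos (n + 1)]
  rcases n with _ | n
  · simp
  · rw [hcos n]; simp

/-- One factor of `sin² θ` clears the denominator of `U_n`, leaving the orthogonality of `sin θ` and
`sin ((n + 1) θ)`. -/
theorem integral_shiftedChebU (n : ℕ) (α : ℝ) {β : ℝ} (hβ : 0 < β) :
    ∫ x : ℝ, (shiftedChebU n α β).eval (x : ℂ) ∂(semicircle α β) = if n = 0 then 1 else 0 := by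
  have hm : Measurable fun x : ℝ => (shiftedChebU n α β).eval (x : ℂ) :=
    ((shiftedChebU n α β).continuous.comp Complex.continuous_ofReal).measurable
  rw [semicircle_eq_weighted, (isAdmissible_one α hβ).integral_eq hm]
  have e : ∀ θ : ℝ, ((2 / Real.pi * Real.sin θ ^ 2 * 1 : ℝ) : ℂ) *
      (shiftedChebU n α β).eval (circleParam α β θ : ℂ) =
      ((2 / Real.pi * √β ^ n * (Real.sin θ * Real.sin ((n + 1) * θ)) : ℝ) : ℂ) := by
    intro θ
    have := eval_shiftedChebU n α β θ
    calc _ = ((2 / Real.pi * Real.sin θ : ℝ) : ℂ) *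
          ((shiftedChebU n α β).eval (circleParam α β θ : ℂ) * Real.sin θ) := by
          push_cast; ring
      _ = _ := by rw [this]; push_cast; ring
  simp only [e]
  rw [integral_complex_ofReal, integral_const_mul, integral_sin_mul_sin]
  rcases n with _ | n
  · have := Real.pi_ne_zero
    simp only [if_true, pow_zero]
    rw [← Complex.ofReal_one]
    congr 1
    field_simp
  · simp

/-! ### Linear recursions with slowly growing solutions -/

/-- As `p k = z ^ k * p 0`, the bound gives `‖p 0‖ ≤ C (k + 1) (s / ‖z‖) ^ k`, which tends to zero.
-/
theorem eq_zero_of_geometric {p : ℕ → ℂ} {z : ℂ} {s C : ℝ} (hs : 0 < s) (hz : s < ‖z‖)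
    (hp : ∀ k, p (k + 1) = z * p k) (hb : ∀ k, ‖p k‖ ≤ C * (k + 1) * s ^ k) (k : ℕ) : p k = 0 := by
  have hpk : ∀ k, p k = z ^ k * p 0 := by
    intro k
    induction k with
    | zero => simp
    | succ k ih => rw [hp, ih, pow_succ]; ring
  have hz0 : 0 < ‖z‖ := hs.trans hz
  have hle : ∀ k : ℕ, ‖p 0‖ ≤ C * (k * (s / ‖z‖) ^ k + (s / ‖z‖) ^ k) := by
    intro k
    have h := hb k
    rw [hpk, norm_mul, norm_pow] at h
    have hzk : 0 < ‖z‖ ^ k := pow_pos hz0 k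
    rw [div_pow]
    calc ‖p 0‖ = ‖z‖ ^ k * ‖p 0‖ / ‖z‖ ^ k := by field_simp
      _ ≤ C * (k + 1) * s ^ k / ‖z‖ ^ k := by gcongr
      _ = _ := by ring
  have hr0 : 0 ≤ s / ‖z‖ := by positivity
  have hr1 : s / ‖z‖ < 1 := (div_lt_one hz0).2 hz
  have hlim := ((tendsto_self_mul_const_pow_of_lt_one hr0 hr1).add
    (tendsto_pow_atTop_nhds_zero_of_lt_one hr0 hr1)).const_mul C
  rw [add_zero, mul_zero] at hlim
  have h0 : ‖p 0‖ ≤ 0 := ge_of_tendsto' hlim hle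
  rw [hpk, norm_le_zero_iff.1 h0, mul_zero]

/-- The recursion factors: `p (k + 1) - y * p k` is geometric with ratio `z`, hence zero, and then
`p` is geometric with ratio `y`. Equal roots, as they occur for `a = 1`, need no separate argument.
-/
theorem eq_zero_of_two_term {p : ℕ → ℂ} {y z : ℂ} {s C : ℝ} (hs : 0 < s) (hy : s < ‖y‖)
    (hz : s < ‖z‖) (hp : ∀ k, p (k + 2) = (y + z) * p (k + 1) - y * z * p k)
    (hb : ∀ k, ‖p k‖ ≤ C * (k + 1) * s ^ k) (k : ℕ) : p k = 0 := by
  have hC : 0 ≤ C := by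
    have := (norm_nonneg _).trans (hb 0)
    simpa using this
  have hd : ∀ k, p (k + 1) - y * p k = 0 := by
    refine eq_zero_of_geometric (C := C * (2 * s + ‖y‖)) hs hz (fun k => ?_) (fun k => ?_)
    · rw [hp]; ring
    · refine (norm_sub_le _ _).trans ?_
      rw [norm_mul]
      have h1 := hb (k + 1)
      have h2 := mul_le_mul_of_nonneg_left (hb k) (norm_nonneg y)
      push_cast at h1
      have h3 : C * ((k : ℝ) + 1 + 1) * s ^ (k + 1) ≤ C * (2 * (k + 1)) * s ^ (k + 1) := by
        gcongr
        have : (0 : ℝ) ≤ k := Nat.cast_nonneg k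
        linarith
      calc _ ≤ C * (2 * (k + 1)) * s ^ (k + 1) + ‖y‖ * (C * (k + 1) * s ^ k) := by linarith
        _ = _ := by ring
  exact eq_zero_of_geometric hs hy (fun k => by rw [← sub_eq_zero]; exact hd k) hb k

/-! ### Weighted semicircular distributions -/

namespace IsAdmissible

variable {α β : ℝ} {w : ℝ → ℝ}

theorem hasAllMoments (h : IsAdmissible α β w) : HasAllMoments (weighted α β w) :=
  have := h.isFiniteMeasure
  hasAllMoments_of_ae_abs_le h.ae_abs_le

/-- Integration of polynomials against a weighted semicircular distribution. -/
def functional (h : IsAdmissible α β w) : Polynomial ℂ →ₗ[ℂ] ℂ :=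
  momentFunctional (weighted α β w) h.hasAllMoments

theorem functional_apply (h : IsAdmissible α β w) (p : Polynomial ℂ) :
    h.functional p = ∫ x : ℝ, p.eval (x : ℂ) ∂(weighted α β w) := rfl

theorem functional_C_mul (h : IsAdmissible α β w) (a : ℂ) (p : Polynomial ℂ) :
    h.functional (Polynomial.C a * p) = a * h.functional p :=
  momentFunctional_C_mul _ a p

theorem functional_C (h : IsAdmissible α β w) (a : ℂ) :
    h.functional (Polynomial.C a) = a * h.functional 1 := by
  rw [← functional_C_mul, mul_one]

theorem measurable_eval (p : Polynomial ℂ) : Measurable fun x : ℝ => p.eval (x : ℂ) :=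
  (p.continuous.comp Complex.continuous_ofReal).measurable

theorem functional_mul {w' : ℝ → ℝ} (h : IsAdmissible α β w) (h' : IsAdmissible α β w')
    {q : Polynomial ℂ} {κ : ℂ} (hq : ∀ θ ∈ Set.Ioo 0 Real.pi,
      q.eval (circleParam α β θ : ℂ) * w (circleParam α β θ) = κ * w' (circleParam α β θ))
    (p : Polynomial ℂ) : h.functional (q * p) = κ * h'.functional p := by
  rw [functional_apply, functional_apply, h.integral_eq (measurable_eval _),
    h'.integral_eq (measurable_eval _), ← integral_const_mul]
  refine setIntegral_congr_fun measurableSet_Ioo fun θ hθ => ?_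
  have := hq θ hθ
  simp only [Polynomial.eval_mul, Complex.ofReal_mul]
  linear_combination (((2 / Real.pi : ℝ) : ℂ) * ((Real.sin θ ^ 2 : ℝ) : ℂ) *
    p.eval (circleParam α β θ : ℂ)) * this

/-- Multiplying by the denominator `q` of the density leaves a constant multiple of the semicircle,
where Chebyshev orthogonality applies. -/
theorem functional_mul_shiftedChebU (h : IsAdmissible α β w)
    {q : Polynomial ℂ} {κ : ℂ} (hq : ∀ θ ∈ Set.Ioo 0 Real.pi,
      q.eval (circleParam α β θ : ℂ) * w (circleParam α β θ) = κ) (n : ℕ) :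
    h.functional (q * shiftedChebU n α β) = if n = 0 then κ else 0 := by
  rw [h.functional_mul (isAdmissible_one α h.pos) (κ := κ) (fun θ hθ => by simpa using hq θ hθ),
    functional_apply, ← semicircle_eq_weighted, integral_shiftedChebU n α h.pos]
  simp

theorem norm_functional_shiftedChebU_le (h : IsAdmissible α β w) (n : ℕ) :
    ‖h.functional (shiftedChebU n α β)‖ ≤
      (weighted α β w).real Set.univ * (n + 1) * √β ^ n := by
  have := h.isFiniteMeasure
  have hae := h.ae_of_forall (p := fun x : ℝ => ‖(shiftedChebU n α β).eval (x : ℂ)‖ ≤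
    (n + 1) * √β ^ n) (measurableSet_le (measurable_eval _).norm measurable_const)
    fun θ hθ => norm_eval_shiftedChebU_le n α β hθ
  have := norm_integral_le_of_norm_le_const hae
  rw [functional_apply]
  refine this.trans (le_of_eq (by ring))

end IsAdmissible

/-! ### The Stieltjes transform of the semicircular distribution -/

/-- The weight `1 / (x - x₀)`, `x₀ = α - √β (r + 1 / r)`. -/
def stieltjesWeight (α β r x : ℝ) : ℝ := (x - (α - √β * (r + r⁻¹)))⁻¹

theorem circleParam_sub_eq (α β r θ : ℝ) :
    circleParam α β θ - (α - √β * (r + r⁻¹)) = √β * (r + r⁻¹ + 2 * Real.cos θ) := by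
  rw [circleParam]; ring

theorem two_le_add_inv {r : ℝ} (hr : 0 < r) : 2 ≤ r + r⁻¹ := by
  have : r + r⁻¹ - 2 = (r - 1) ^ 2 / r := by field_simp; ring
  have h2 : 0 ≤ (r - 1) ^ 2 / r := by positivity
  linarith

theorem one_add_cos_pos {θ : ℝ} (hθ : θ ∈ Set.Ioo 0 Real.pi) : 0 < 1 + Real.cos θ := by
  have h1 := Real.sin_pos_of_mem_Ioo hθ
  have h2 := Real.sin_sq_add_cos_sq θ
  nlinarith [Real.neg_one_le_cos θ, Real.cos_le_one θ]

theorem circleParam_sub_ge {α β r θ : ℝ} (hr : 0 < r) :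
    √β * (2 * (1 + Real.cos θ)) ≤ circleParam α β θ - (α - √β * (r + r⁻¹)) := by
  rw [circleParam_sub_eq]
  have := two_le_add_inv hr
  gcongr
  linarith

theorem circleParam_sub_pos {α β r θ : ℝ} (hβ : 0 < β) (hr : 0 < r)
    (hθ : θ ∈ Set.Ioo 0 Real.pi) : 0 < circleParam α β θ - (α - √β * (r + r⁻¹)) := by
  have := one_add_cos_pos hθ
  have hs := Real.sqrt_pos.2 hβ
  exact lt_of_lt_of_le (by positivity) (circleParam_sub_ge hr)

/-- Since `sin² θ ≤ 2 (1 + cos θ)`, the bound is uniform in `r` and includes `r = 1`, where the pole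
lies on the left edge of the support. -/
theorem sin_sq_mul_stieltjesWeight_le {α β r θ : ℝ} (hβ : 0 < β) (hr : 0 < r)
    (hθ : θ ∈ Set.Ioo 0 Real.pi) :
    Real.sin θ ^ 2 * stieltjesWeight α β r (circleParam α β θ) ≤ (√β)⁻¹ := by
  have h1 := circleParam_sub_pos (α := α) hβ hr hθ
  have h2 := circleParam_sub_ge (α := α) (β := β) (θ := θ) hr
  have hs := Real.sqrt_pos.2 hβ
  rw [stieltjesWeight, ← div_eq_mul_inv, div_le_iff₀ h1]
  have h3 : Real.sin θ ^ 2 ≤ 2 * (1 + Real.cos θ) := by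
    nlinarith [Real.sin_sq_add_cos_sq θ, one_add_cos_pos hθ, Real.cos_le_one θ,
      Real.neg_one_le_cos θ]
  calc Real.sin θ ^ 2 ≤ 2 * (1 + Real.cos θ) := h3
    _ = (√β)⁻¹ * (√β * (2 * (1 + Real.cos θ))) := by field_simp
    _ ≤ _ := by gcongr

theorem isAdmissible_stieltjesWeight (α : ℝ) {β r : ℝ} (hβ : 0 < β) (hr : 0 < r) :
    IsAdmissible α β (stieltjesWeight α β r) :=
  ⟨hβ, by unfold stieltjesWeight; fun_prop,
    fun _ hθ => inv_nonneg.2 (circleParam_sub_pos hβ hr hθ).le,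
    (√β)⁻¹, fun _ hθ => sin_sq_mul_stieltjesWeight_le hβ hr hθ⟩

/-- For `r = 1` the growth argument used for `r < 1` fails, because the root has modulus exactly
`√β`. Here `sin² θ` cancels against `1 + cos θ` and the integral is elementary. -/
theorem functional_stieltjesWeight_edge (α : ℝ) {β : ℝ} (hβ : 0 < β) :
    (isAdmissible_stieltjesWeight α hβ one_pos).functional 1 = (((√β)⁻¹ : ℝ) : ℂ) := by
  have hs := Real.sqrt_pos.2 hβ
  rw [IsAdmissible.functional_apply,
    (isAdmissible_stieltjesWeight α hβ one_pos).integral_eq (IsAdmissible.measurable_eval 1)]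
  have : ∀ θ ∈ Set.Ioo 0 Real.pi, ((2 / Real.pi * Real.sin θ ^ 2 *
      stieltjesWeight α β 1 (circleParam α β θ) : ℝ) : ℂ) *
        (1 : Polynomial ℂ).eval (circleParam α β θ : ℂ) =
      (((Real.pi)⁻¹ * (√β)⁻¹ * (1 - Real.cos θ) : ℝ) : ℂ) := by
    intro θ hθ
    have h1 := one_add_cos_pos hθ
    have h2 : Real.sin θ ^ 2 = (1 - Real.cos θ) * (1 + Real.cos θ) := by
      nlinarith [Real.sin_sq_add_cos_sq θ]
    rw [Polynomial.eval_one, mul_one, stieltjesWeight, circleParam_sub_eq, h2]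
    congr 1
    have h3 : (1 : ℝ) + 1⁻¹ + 2 * Real.cos θ = 2 * (1 + Real.cos θ) := by ring
    rw [h3]
    field_simp
  rw [setIntegral_congr_fun measurableSet_Ioo this, integral_complex_ofReal, integral_const_mul,
    ← integral_Ioc_eq_integral_Ioo, ← intervalIntegral.integral_of_le Real.pi_pos.le,
    intervalIntegral.integral_sub (by simp) (by apply Continuous.intervalIntegrable; fun_prop)]
  have := Real.pi_ne_zero
  congr 1
  simp
  field_simp

/-- Write `s = √β`. Clearing the pole, the integrals of the Chebyshev polynomials satisfy a
second-order recursion with roots `-s r` and `-s / r`. The latter is too large for the growth bound,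
so its component vanishes, and the equation at index `0` then gives the mass. -/
theorem functional_stieltjesWeight_one (α : ℝ) {β r : ℝ} (hβ : 0 < β) (hr : 0 < r) (hr1 : r ≤ 1) :
    (isAdmissible_stieltjesWeight α hβ hr).functional 1 = ((r * (√β)⁻¹ : ℝ) : ℂ) := by
  rcases hr1.eq_or_lt with rfl | hr1
  · rw [functional_stieltjesWeight_edge α hβ, one_mul]
  set h := isAdmissible_stieltjesWeight α hβ hr with hh
  have hs := Real.sqrt_pos.2 hβ
  set s := √β with hsdef
  have hss : s * s = β := Real.mul_self_sqrt hβ.le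
  set Q := fun k => shiftedChebU k α β with hQ
  have hq : ∀ θ ∈ Set.Ioo 0 Real.pi,
      (Polynomial.X - Polynomial.C ((α - s * (r + r⁻¹) : ℝ) : ℂ) : Polynomial ℂ).eval
        (circleParam α β θ : ℂ) *
        stieltjesWeight α β r (circleParam α β θ) = 1 := by
    intro θ hθ
    have := (circleParam_sub_pos (α := α) hβ hr hθ).ne'
    rw [stieltjesWeight, Polynomial.eval_sub, Polynomial.eval_X, Polynomial.eval_C]
    rw [← Complex.ofReal_sub, ← Complex.ofReal_mul, mul_inv_cancel₀ this, Complex.ofReal_one]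
  have hL := h.functional_mul_shiftedChebU hq
  -- This combination removes the root `-s r`, so `T` is geometric with ratio `-s / r`.
  set T := fun k => h.functional (Q (k + 1)) + (s * r : ℝ) * h.functional (Q k) with hT
  have hT0 : T 0 + (s * r⁻¹ : ℝ) * h.functional 1 = 1 := by
    have := hL 0
    rw [if_pos rfl] at this
    rw [← this]
    simp only [hT, hQ]
    rw [zero_add, shiftedChebU_zero, shiftedChebU_one, mul_one, map_sub, map_sub,
      h.functional_C, h.functional_C]
    push_cast
    ring
  have hTs : ∀ k, T (k + 1) = -((s * r⁻¹ : ℝ) : ℂ) * T k := by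
    intro k
    have := hL (k + 1)
    rw [if_neg k.succ_ne_zero] at this
    have e : (Polynomial.X - Polynomial.C ((α - s * (r + r⁻¹) : ℝ) : ℂ)) *
        shiftedChebU (k + 1) α β = Q (k + 2) + Polynomial.C ((s * (r + r⁻¹) : ℝ) : ℂ) * Q (k + 1)
          + Polynomial.C (β : ℂ) * Q k := by
      simp only [hQ]
      rw [shiftedChebU_add_two α hβ.le k, Complex.ofReal_sub, map_sub]
      ring
    rw [e, map_add, map_add, h.functional_C_mul, h.functional_C_mul] at this
    simp only [hT]
    have hrr : (r : ℂ)⁻¹ * r = 1 := inv_mul_cancel₀ (by exact_mod_cast hr.ne')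
    have hss' : (s : ℂ) * s = β := by exact_mod_cast hss
    push_cast at this ⊢
    linear_combination this + (h.functional (Q k)) * hss' +
      (h.functional (Q k)) * (s : ℂ) * s * (hrr)
  have hT00 : T 0 = 0 := by
    set K := (weighted α β (stieltjesWeight α β r)).real Set.univ with hK
    have hK0 : 0 ≤ K := measureReal_nonneg
    refine eq_zero_of_geometric (C := K * (3 * s)) hs ?_ hTs (fun k => ?_) 0
    · rw [norm_neg, Complex.norm_real, Real.norm_of_nonneg (by positivity)]
      exact lt_mul_of_one_lt_right hs ((one_lt_inv₀ hr).2 hr1)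
    · have h1 := h.norm_functional_shiftedChebU_le (k + 1)
      have h2 := h.norm_functional_shiftedChebU_le k
      simp only [hT]
      refine (norm_add_le _ _).trans ?_
      rw [norm_mul, Complex.norm_real, Real.norm_of_nonneg (by positivity : 0 ≤ s * r)]
      have hk : (0 : ℝ) ≤ k := Nat.cast_nonneg k
      have h3 : s * r * ‖h.functional (Q k)‖ ≤ s * 1 * (K * (k + 1) * s ^ k) := by gcongr
      have h4 : K * ((k + 1 : ℕ) + 1) * s ^ (k + 1) ≤ K * (2 * (k + 1)) * s ^ (k + 1) := by
        gcongr
        push_cast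
        linarith
      calc _ ≤ K * (2 * (k + 1)) * s ^ (k + 1) + s * 1 * (K * (k + 1) * s ^ k) :=
            add_le_add (h1.trans h4) h3
        _ = _ := by ring
  rw [hT00, zero_add] at hT0
  have hrr : (r : ℂ) ≠ 0 := by exact_mod_cast hr.ne'
  have hsC : (s : ℂ) ≠ 0 := by exact_mod_cast hs.ne'
  push_cast at hT0 ⊢
  field_simp at hT0 ⊢
  linear_combination hT0

/-! ### The explicit polynomials -/

theorem isThreeTerm_semicircularPoly : IsThreeTerm 0 0 0 1 semicircularPoly where
  zero _ := rfl
  one t := by simp [semicircularPoly]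
  two t := by simp [semicircularPoly]
  add_three n t := by rw [semicircularPoly]; simp

theorem isThreeTerm_poissonPoly : IsThreeTerm 1 1 0 1 poissonPoly where
  zero _ := rfl
  one t := by simp [poissonPoly]
  two t := by simp [poissonPoly, add_comm]
  add_three n t := by rw [poissonPoly, add_comm (t : ℝ)]; simp

theorem isThreeTerm_meixnerPoly (a : ℝ) : IsThreeTerm (2 * a) a 1 1 (meixnerPoly a) where
  zero _ := rfl
  one t := by simp [meixnerPoly]
  two t := by
    rw [meixnerPoly, meixnerPoly, alphaCoeff, show a * ((t : ℝ) + 2) = 2 * a + a * t by ring]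
    simp [meixnerPoly]
  add_three n t := by
    rw [meixnerPoly, alphaCoeff, betaCoeff, show a * ((t : ℝ) + 2) = 2 * a + a * t by ring]
    simp [add_comm]

theorem semicircularPoly_eq (n : ℕ) (t : ℝ≥0) : semicircularPoly n t = chebU n t := by
  induction n using Nat.twoStepInduction with
  | zero => simp [semicircularPoly, chebU_zero]
  | one => simp [semicircularPoly, chebU_one]
  | more n ih1 ih2 => rw [semicircularPoly, ih1, ih2, chebU_add_two t.coe_nonneg]

theorem poissonPoly_eq (n : ℕ) (t : ℝ≥0) : poissonPoly (n + 1) t =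
    shiftedChebU (n + 1) (t + 1) t + shiftedChebU n (t + 1) t := by
  induction n using Nat.twoStepInduction with
  | zero =>
    rw [zero_add, shiftedChebU_one, shiftedChebU_zero, poissonPoly]
    simp
    ring
  | one =>
    rw [shiftedChebU_add_two _ t.coe_nonneg 0, zero_add, shiftedChebU_one, shiftedChebU_zero, poissonPoly,
      poissonPoly, poissonPoly]
    simp
    ring
  | more n ih1 ih2 =>
    rw [poissonPoly, ih1, ih2, shiftedChebU_add_two _ t.coe_nonneg (n + 1), shiftedChebU_add_two _ t.coe_nonneg n]
    ring

theorem betaCoeff_pos (t : ℝ≥0) : 0 < betaCoeff t := by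
  have := t.coe_nonneg
  rw [betaCoeff]; positivity

theorem meixnerPoly_one_eq (a : ℝ) (t : ℝ≥0) :
    meixnerPoly a 1 t = shiftedChebU 1 (alphaCoeff a t) (betaCoeff t)
      + Polynomial.C ((2 * a : ℝ) : ℂ) * shiftedChebU 0 (alphaCoeff a t) (betaCoeff t) := by
  rw [meixnerPoly, shiftedChebU_one, shiftedChebU_zero, alphaCoeff, sub_add,
    mul_one, ← map_sub, ← Complex.ofReal_sub]
  congr 3
  ring

theorem meixnerPoly_add_two_eq (a : ℝ) (t : ℝ≥0) (n : ℕ) :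
    meixnerPoly a (n + 2) t = shiftedChebU (n + 2) (alphaCoeff a t) (betaCoeff t)
      + Polynomial.C ((2 * a : ℝ) : ℂ) * shiftedChebU (n + 1) (alphaCoeff a t) (betaCoeff t)
      + shiftedChebU n (alphaCoeff a t) (betaCoeff t) := by
  have hβ := (betaCoeff_pos t).le
  have h2 : meixnerPoly a 2 t = shiftedChebU 2 (alphaCoeff a t) (betaCoeff t)
      + Polynomial.C ((2 * a : ℝ) : ℂ) * shiftedChebU 1 (alphaCoeff a t) (betaCoeff t)
      + shiftedChebU 0 (alphaCoeff a t) (betaCoeff t) := by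
    have e : Polynomial.C (betaCoeff t : ℂ) = Polynomial.C ((t : ℝ) : ℂ) + 1 := by
      simp [betaCoeff]
    rw [meixnerPoly, meixnerPoly_one_eq, shiftedChebU_add_two _ hβ, zero_add, shiftedChebU_one,
      shiftedChebU_zero, meixnerPoly, e]
    ring
  induction n using Nat.twoStepInduction with
  | zero => exact h2
  | one =>
    rw [meixnerPoly, zero_add, zero_add, h2, meixnerPoly_one_eq, shiftedChebU_add_two _ hβ 1,
      shiftedChebU_add_two _ hβ 0, shiftedChebU_one, shiftedChebU_zero]
    ring
  | more n ih1 ih2 =>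
    rw [meixnerPoly, ih1, ih2, shiftedChebU_add_two _ hβ (n + 2), shiftedChebU_add_two _ hβ (n + 1),
      shiftedChebU_add_two _ hβ n]
    ring

/-! ### Measures with an atom -/

/-- `ν` is moreover compactly supported. -/
structure IsBoundedCentering (ν : Measure ℝ) (p : ℕ → Polynomial ℂ) : Prop
    extends IsCentering ν p where
  bounded : ∃ M, ∀ᵐ x ∂ν, |x| ≤ M

/-- At `t = 0` both `P_1` and `P_2` vanish at the origin, and the recursion propagates this. -/
theorem IsThreeTerm.isBoundedCentering_dirac {a b c d : ℝ} {P : ℕ → ℝ≥0 → Polynomial ℂ}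
    (h : IsThreeTerm a b c d P) :
    IsBoundedCentering (Measure.dirac 0) (fun n => P n 0) := by
  have hb : ∀ᵐ x ∂(Measure.dirac (0 : ℝ)), |x| ≤ 0 := by
    rw [ae_dirac_iff (measurableSet_le (by fun_prop) (by fun_prop))]; simp
  refine ⟨⟨inferInstance, hasAllMoments_of_ae_abs_le hb, fun n => ?_⟩, 0, hb⟩
  rw [integral_dirac, Complex.ofReal_zero]
  suffices H : (P (n + 1) 0).eval 0 = 0 ∧ (P (n + 2) 0).eval 0 = 0 from H.1
  induction n with
  | zero => simp [h.one, h.two]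
  | succ n ih => exact ⟨ih.2, by rw [h.add_three]; simp [ih.1, ih.2]⟩

/-- Integration of polynomials against a weighted semicircular distribution with an atom. -/
def IsAdmissible.atomFunctional {α β : ℝ} {w : ℝ → ℝ} (h : IsAdmissible α β w) (m x₁ : ℝ) :
    Polynomial ℂ →ₗ[ℂ] ℂ :=
  h.functional + (m : ℂ) • Polynomial.leval (x₁ : ℂ)

theorem IsAdmissible.atomFunctional_apply {α β : ℝ} {w : ℝ → ℝ} (h : IsAdmissible α β w)
    (m x₁ : ℝ) (p : Polynomial ℂ) :
    h.atomFunctional m x₁ p = h.functional p + m * p.eval (x₁ : ℂ) := rfl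

theorem IsAdmissible.isBoundedCentering {α β : ℝ} {w : ℝ → ℝ} (h : IsAdmissible α β w)
    {m x₁ : ℝ} (hm : 0 ≤ m) {p : ℕ → Polynomial ℂ} (h1 : h.atomFunctional m x₁ 1 = 1)
    (hp : ∀ n, h.atomFunctional m x₁ (p (n + 1)) = 0) :
    IsBoundedCentering (weighted α β w + ENNReal.ofReal m • Measure.dirac x₁) p := by
  have hfin := h.isFiniteMeasure
  set ν := weighted α β w + ENNReal.ofReal m • Measure.dirac x₁ with hν
  have hfin' : IsFiniteMeasure (ENNReal.ofReal m • Measure.dirac x₁) :=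
    Measure.smul_finite _ ENNReal.ofReal_ne_top
  have hbd : ∀ᵐ x ∂ν, |x| ≤ max (|α| + 2 * √β) |x₁| := by
    rw [hν, ae_add_measure_iff]
    constructor
    · filter_upwards [h.ae_abs_le] with x hx using hx.trans (le_max_left _ _)
    · refine Measure.ae_smul_measure ?_ _
      rw [ae_dirac_iff (measurableSet_le (by fun_prop) (by fun_prop))]
      exact le_max_right _ _
  have hmom := hasAllMoments_of_ae_abs_le hbd
  have hint : ∀ q : Polynomial ℂ, ∫ x : ℝ, q.eval (x : ℂ) ∂ν = h.atomFunctional m x₁ q := by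
    intro q
    have hi := integrable_eval hmom q
    rw [hν, integral_add_measure (hi.mono_measure (Measure.le_add_right le_rfl))
      (hi.mono_measure (Measure.le_add_left le_rfl)), integral_smul_measure, integral_dirac,
      ENNReal.toReal_ofReal hm, h.atomFunctional_apply, h.functional_apply, Complex.real_smul]
  have hprob : IsProbabilityMeasure ν := by
    rw [isProbabilityMeasure_iff_real]
    have := hint 1
    rw [h1] at this
    simp only [Polynomial.eval_one, integral_const, Complex.real_smul, mul_one] at this
    exact_mod_cast this
  exact ⟨⟨hprob, hmom, fun n => by rw [hint, hp]⟩, _, hbd⟩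

/-! ### Semicircular and Poisson -/

theorem isBoundedCentering_semicircular (t : ℝ≥0) :
    IsBoundedCentering (semicircularMeasure t) (fun n => semicircularPoly n t) := by
  rcases eq_or_ne t 0 with rfl | ht
  · have := isThreeTerm_semicircularPoly.isBoundedCentering_dirac
    simpa [semicircularMeasure, semicircle] using this
  have ht' : (0 : ℝ) < t := NNReal.coe_pos.2 (pos_iff_ne_zero.2 ht)
  have h := isAdmissible_one 0 ht'
  have hf : ∀ n, h.functional (semicircularPoly n t) = if n = 0 then 1 else 0 := by
    intro n
    rw [h.functional_apply, ← semicircle_eq_weighted, ← integral_shiftedChebU n 0 ht',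
      semicircularPoly_eq]
    simp [shiftedChebU]
  have := h.isBoundedCentering (m := 0) (x₁ := 0) le_rfl (p := fun n => semicircularPoly n t)
    (by rw [h.atomFunctional_apply]; simpa [semicircularPoly] using hf 0)
    (fun n => by rw [h.atomFunctional_apply, hf]; simp)
  simpa [semicircularMeasure, semicircle_eq_weighted] using this

/-- Multiplication by `x` clears the density and kills the atom. As `x Q_{n+1} = P_{n+2} + t
P_{n+1}`, the means of the `P_n` satisfy a first-order recursion starting at zero once the total
mass is one. That mass comes from the Stieltjes transform at the point `0`. -/
theorem isBoundedCentering_poisson (t : ℝ≥0) :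
    IsBoundedCentering (poissonMeasure t) (fun n => poissonPoly n t) := by
  rcases eq_or_ne t 0 with rfl | ht
  · have := isThreeTerm_poissonPoly.isBoundedCentering_dirac
    simpa [poissonMeasure] using this
  rw [poissonMeasure, if_neg ht, add_comm (1 : ℝ)]
  have htp : (0 : ℝ) < t := NNReal.coe_pos.2 (pos_iff_ne_zero.2 ht)
  set τ : ℝ := (t : ℝ) with hτ
  have hs := Real.sqrt_pos.2 htp
  have hss : √τ * √τ = τ := Real.mul_self_sqrt htp.le
  -- The pole `0` corresponds to both `√τ` and its inverse. The one that is at most `1` gives the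
  -- mass, and for `τ < 1` the deficit `1 - τ` is the atom.
  obtain ⟨r, hr0, hr1, hx0, hmass⟩ : ∃ r : ℝ, 0 < r ∧ r ≤ 1 ∧ τ + 1 - √τ * (r + r⁻¹) = 0 ∧
      √τ * r + max (1 - τ) 0 = 1 := by
    rcases le_total τ 1 with h1 | h1
    · refine ⟨√τ, hs, Real.sqrt_le_one.2 h1, ?_, ?_⟩
      · rw [mul_add, mul_inv_cancel₀ hs.ne', hss]; ring
      · rw [hss, max_eq_left (by linarith)]; ring
    · refine ⟨(√τ)⁻¹, inv_pos.2 hs, inv_le_one_of_one_le₀ (Real.one_le_sqrt.2 h1), ?_, ?_⟩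
      · rw [mul_add, mul_inv_cancel₀ hs.ne', inv_inv, hss]; ring
      · rw [mul_inv_cancel₀ hs.ne', max_eq_right (by linarith)]; ring
  have hk := isAdmissible_stieltjesWeight (τ + 1) htp hr0
  have hk1 := functional_stieltjesWeight_one (τ + 1) htp hr0 hr1
  have hpos : ∀ θ ∈ Set.Ioo 0 Real.pi, 0 < circleParam (τ + 1) τ θ := by
    intro θ hθ
    have := circleParam_sub_pos (α := τ + 1) htp hr0 hθ
    rwa [hx0, sub_zero] at this
  have hw : ∀ x, τ / x = τ * stieltjesWeight (τ + 1) τ r x := by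
    intro x
    rw [stieltjesWeight, hx0, sub_zero, div_eq_mul_inv]
  have h : IsAdmissible (τ + 1) τ (fun x => τ / x) := by
    refine ⟨htp, by fun_prop, fun θ hθ => (div_pos htp (hpos θ hθ)).le, τ * (√τ)⁻¹,
      fun θ hθ => ?_⟩
    have := sin_sq_mul_stieltjesWeight_le (α := τ + 1) htp hr0 hθ
    rw [hw, mul_left_comm]
    exact mul_le_mul_of_nonneg_left this htp.le
  set m := max (1 - τ) 0 with hm
  set ψ := h.atomFunctional m 0 with hψ
  have hone : ψ 1 = 1 := by
    have e : h.functional 1 = τ * hk.functional 1 := by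
      rw [← h.functional_mul hk (q := 1) (κ := (τ : ℂ)) (fun θ _ => ?_), mul_one]
      rw [hw]; push_cast; simp
    rw [hψ, h.atomFunctional_apply, e, hk1, Polynomial.eval_one, mul_one]
    rw [← Complex.ofReal_mul, ← Complex.ofReal_add, ← Complex.ofReal_one, ← hmass]
    congr 2
    nth_rw 1 [← hss]
    field_simp
  have hX : ∀ k, ψ (Polynomial.X * shiftedChebU k (τ + 1) τ) = if k = 0 then (τ : ℂ) else 0 := by
    intro k
    rw [hψ, h.atomFunctional_apply, h.functional_mul_shiftedChebU (κ := (τ : ℂ))]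
    · simp
    · intro θ hθ
      have := (hpos θ hθ).ne'
      rw [Polynomial.eval_X, ← Complex.ofReal_mul, mul_div_cancel₀ _ this]
  refine h.isBoundedCentering (le_max_right _ _) hone fun n => ?_
  change ψ (poissonPoly (n + 1) t) = 0
  induction n with
  | zero =>
    have e := hX 0
    rw [if_pos rfl, shiftedChebU_zero, mul_one] at e
    rw [zero_add, poissonPoly, map_sub, e, ← mul_one (Polynomial.C _), ← Polynomial.smul_eq_C_mul,
      map_smul, hone]
    simp [hτ]
  | succ n ih =>
    have e := hX (n + 1)
    have e2 : (Polynomial.X : Polynomial ℂ) * shiftedChebU (n + 1) (τ + 1) τ =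
        poissonPoly (n + 2) t + (τ : ℂ) • poissonPoly (n + 1) t := by
      rw [Polynomial.smul_eq_C_mul, poissonPoly_eq, poissonPoly_eq, ← hτ,
        shiftedChebU_add_two _ htp.le n, Complex.ofReal_add, map_add]
      simp
      ring
    rw [e2, map_add, map_smul, ih, if_neg n.succ_ne_zero, smul_zero, add_zero] at e
    exact e

/-! ### The three cases with a parameter -/

/-- The density of the absolutely continuous part with respect to the semicircular distribution. -/
def meixnerWeight (a : ℝ) (t : ℝ≥0) (x : ℝ) : ℝ :=
  t * betaCoeff t / (x ^ 2 - t ^ 2 * (a ^ 2 - 1))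

/-- The denominator of `meixnerWeight`. -/
def meixnerQuad (a : ℝ) (t : ℝ≥0) : Polynomial ℂ :=
  Polynomial.X ^ 2 - Polynomial.C ((t ^ 2 * (a ^ 2 - 1) : ℝ) : ℂ)

theorem eval_meixnerQuad (a : ℝ) (t : ℝ≥0) (x : ℝ) :
    (meixnerQuad a t).eval (x : ℂ) = ((x ^ 2 - t ^ 2 * (a ^ 2 - 1) : ℝ) : ℂ) := by
  simp [meixnerQuad]

theorem meixnerQuad_eq (a : ℝ) (t : ℝ≥0) : meixnerQuad a t = meixnerPoly a 2 t +
    ((2 * a * betaCoeff t : ℝ) : ℂ) • meixnerPoly a 1 t +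
      ((t * betaCoeff t : ℝ) : ℂ) • meixnerPoly a 0 t := by
  simp only [meixnerPoly, meixnerQuad, alphaCoeff, betaCoeff, Polynomial.smul_eq_C_mul]
  push_cast
  simp only [map_add, map_mul, map_sub, map_pow, map_one, map_ofNat]
  ring

/-- This is dual to the expansion of the `P_n` in three Chebyshev polynomials. It turns Chebyshev
orthogonality into a recursion for the means of the `P_n`. -/
theorem meixnerQuad_mul_shiftedChebU (a : ℝ) (t : ℝ≥0) (n : ℕ) :
    meixnerQuad a t * shiftedChebU (n + 1) (alphaCoeff a t) (betaCoeff t) =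
      meixnerPoly a (n + 3) t + ((2 * a * betaCoeff t : ℝ) : ℂ) • meixnerPoly a (n + 2) t +
        ((betaCoeff t ^ 2 : ℝ) : ℂ) • meixnerPoly a (n + 1) t := by
  have hβ := (betaCoeff_pos t).le
  rw [meixnerPoly_add_two_eq a t (n + 1), meixnerPoly_add_two_eq]
  cases n with
  | zero =>
    rw [meixnerPoly_one_eq, shiftedChebU_add_two _ hβ 1, shiftedChebU_add_two _ hβ 0, zero_add,
      shiftedChebU_one, shiftedChebU_zero]
    simp only [meixnerQuad, alphaCoeff, betaCoeff, Polynomial.smul_eq_C_mul]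
    push_cast
    simp only [map_add, map_mul, map_sub, map_pow, map_one, map_ofNat]
    ring
  | succ n =>
    rw [meixnerPoly_add_two_eq, shiftedChebU_add_two _ hβ (n + 2), shiftedChebU_add_two _ hβ (n + 1),
      shiftedChebU_add_two _ hβ n]
    simp only [meixnerQuad, alphaCoeff, betaCoeff, Polynomial.smul_eq_C_mul]
    push_cast
    simp only [map_add, map_mul, map_sub, map_pow, map_one, map_ofNat]
    ring

/-- The recursion has characteristic polynomial `y² + 2 a β y + β²`, with roots `β (-a ± √(a² -
1))`. -/
theorem two_term_of_meixnerQuad {a : ℝ} {t : ℝ≥0} {ψ : Polynomial ℂ →ₗ[ℂ] ℂ}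
    (h : ∀ n, ψ (meixnerQuad a t * shiftedChebU n (alphaCoeff a t) (betaCoeff t)) =
      if n = 0 then ((t * betaCoeff t : ℝ) : ℂ) else 0) :
    ψ (meixnerPoly a 2 t) + (2 * a * betaCoeff t : ℝ) * ψ (meixnerPoly a 1 t) +
        (t * betaCoeff t : ℝ) * ψ 1 = (t * betaCoeff t : ℝ) ∧
      ∀ n, ψ (meixnerPoly a (n + 3) t) + (2 * a * betaCoeff t : ℝ) * ψ (meixnerPoly a (n + 2) t) +
        (betaCoeff t ^ 2 : ℝ) * ψ (meixnerPoly a (n + 1) t) = 0 := by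
  constructor
  · have := h 0
    rw [if_pos rfl, shiftedChebU_zero, mul_one, meixnerQuad_eq, map_add, map_add, map_smul,
      map_smul, smul_eq_mul, smul_eq_mul] at this
    exact this
  · intro n
    have := h (n + 1)
    rw [if_neg n.succ_ne_zero, meixnerQuad_mul_shiftedChebU, map_add, map_add, map_smul,
      map_smul, smul_eq_mul, smul_eq_mul] at this
    exact this

theorem IsAdmissible.functional_meixnerQuad {a : ℝ} {t : ℝ≥0}
    (h : IsAdmissible (alphaCoeff a t) (betaCoeff t) (meixnerWeight a t))
    (hq : ∀ θ ∈ Set.Ioo 0 Real.pi,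
      circleParam (alphaCoeff a t) (betaCoeff t) θ ^ 2 - t ^ 2 * (a ^ 2 - 1) ≠ 0) (n : ℕ) :
    h.functional (meixnerQuad a t * shiftedChebU n (alphaCoeff a t) (betaCoeff t)) =
      if n = 0 then ((t * betaCoeff t : ℝ) : ℂ) else 0 := by
  refine h.functional_mul_shiftedChebU (fun θ hθ => ?_) n
  rw [eval_meixnerQuad, ← Complex.ofReal_mul, meixnerWeight, mul_div_cancel₀ _ (hq θ hθ)]

theorem measurable_meixnerWeight (a : ℝ) (t : ℝ≥0) : Measurable (meixnerWeight a t) := by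
  unfold meixnerWeight; fun_prop

/-! #### No atom -/

theorem exists_le_circleParam_sq_sub {a : ℝ} (ha0 : 0 ≤ a) (ha : a ≤ 1) {t : ℝ≥0} (ht : 0 < t) :
    ∃ δ : ℝ, 0 < δ ∧ ∀ θ : ℝ,
      δ ≤ circleParam (alphaCoeff a t) (betaCoeff t) θ ^ 2 - t ^ 2 * (a ^ 2 - 1) := by
  have htp : (0 : ℝ) < t := ht
  rcases ha.eq_or_lt with rfl | ha1
  · have hs1 : 1 < √(betaCoeff t) := by
      rw [Real.lt_sqrt zero_le_one, betaCoeff]; linarith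
    have hss : √(betaCoeff t) ^ 2 = t + 1 := Real.sq_sqrt (betaCoeff_pos t).le
    -- For `a = 1` the left edge `α - 2 √β` equals `(√β - 1)²`, which is positive, and the
    -- denominator is `x²`.
    refine ⟨((√(betaCoeff t) - 1) ^ 2) ^ 2, by
      have : 0 < √(betaCoeff t) - 1 := by linarith
      positivity, fun θ => ?_⟩
    have h1 : (√(betaCoeff t) - 1) ^ 2 ≤ circleParam (alphaCoeff 1 t) (betaCoeff t) θ := by
      rw [circleParam, alphaCoeff]
      nlinarith [Real.neg_one_le_cos θ]
    have := pow_le_pow_left₀ (sq_nonneg _) h1 2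
    simpa using this
  · refine ⟨t ^ 2 * (1 - a ^ 2), ?_, fun θ => ?_⟩
    · have : 0 < 1 - a ^ 2 := by nlinarith
      positivity
    · nlinarith [sq_nonneg (circleParam (alphaCoeff a t) (betaCoeff t) θ)]

theorem isAdmissible_meixnerWeight {a : ℝ} (ha0 : 0 ≤ a) (ha : a ≤ 1) {t : ℝ≥0} (ht : 0 < t) :
    IsAdmissible (alphaCoeff a t) (betaCoeff t) (meixnerWeight a t) := by
  have htp : (0 : ℝ) < t := ht
  have hβ := betaCoeff_pos t
  obtain ⟨δ, hδ, hq⟩ := exists_le_circleParam_sq_sub ha0 ha ht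
  refine ⟨hβ, measurable_meixnerWeight a t, fun θ _ => ?_, t * betaCoeff t / δ, fun θ _ => ?_⟩
  · have := hδ.trans_le (hq θ)
    rw [meixnerWeight]; positivity
  · have h1 : meixnerWeight a t (circleParam (alphaCoeff a t) (betaCoeff t) θ) ≤
        t * betaCoeff t / δ := by
      rw [meixnerWeight]
      have := hq θ
      gcongr
    have h0 : 0 ≤ meixnerWeight a t (circleParam (alphaCoeff a t) (betaCoeff t) θ) := by
      have := hδ.trans_le (hq θ)
      rw [meixnerWeight]; positivity
    calc _ ≤ 1 * meixnerWeight a t (circleParam (alphaCoeff a t) (betaCoeff t) θ) :=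
          mul_le_mul_of_nonneg_right (Real.sin_sq_le_one θ) h0
      _ ≤ _ := by rwa [one_mul]

/-- Expand in Chebyshev polynomials; as `√β ≥ 1`, the lower terms are absorbed in the top one. -/
theorem IsAdmissible.norm_functional_meixnerPoly_le {a : ℝ} (ha0 : 0 ≤ a) {t : ℝ≥0}
    (h : IsAdmissible (alphaCoeff a t) (betaCoeff t) (meixnerWeight a t)) :
    ∃ C, ∀ n, ‖h.functional (meixnerPoly a (n + 1) t)‖ ≤ C * (n + 1) * √(betaCoeff t) ^ n := by
  set s := √(betaCoeff t) with hs
  have hs1 : 1 ≤ s := by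
    rw [hs, Real.one_le_sqrt, betaCoeff]; linarith [t.coe_nonneg]
  set K := (weighted (alphaCoeff a t) (betaCoeff t) (meixnerWeight a t)).real Set.univ with hK
  have hK0 : 0 ≤ K := measureReal_nonneg
  have hb : ∀ n, ‖h.functional (shiftedChebU n (alphaCoeff a t) (betaCoeff t))‖ ≤
      K * (n + 1) * s ^ n := h.norm_functional_shiftedChebU_le
  have hn2a : ‖((2 * a : ℝ) : ℂ)‖ = 2 * a := by
    rw [Complex.norm_real, Real.norm_of_nonneg (by positivity)]
  refine ⟨K * (2 * s + 2 * a + 1), fun n => ?_⟩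
  cases n with
  | zero =>
    rw [zero_add, meixnerPoly_one_eq, map_add, h.functional_C_mul]
    refine (norm_add_le _ _).trans ?_
    rw [norm_mul, hn2a]
    have h1 := hb 1
    have h0 := mul_le_mul_of_nonneg_left (hb 0) (by positivity : 0 ≤ 2 * a)
    norm_num at h1 h0 ⊢
    nlinarith
  | succ n =>
    rw [meixnerPoly_add_two_eq, map_add, map_add, h.functional_C_mul]
    refine (norm_add_le _ _).trans ((add_le_add_left (norm_add_le _ _) _).trans ?_)
    rw [norm_mul, hn2a]
    have h2 := hb (n + 2)
    have h1 := mul_le_mul_of_nonneg_left (hb (n + 1)) (by positivity : 0 ≤ 2 * a)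
    have h0 := hb n
    have hn : (0 : ℝ) ≤ n := Nat.cast_nonneg n
    have h2' : K * ((n + 2 : ℕ) + 1) * s ^ (n + 2) ≤ K * (2 * ((n + 1 : ℕ) + 1)) * s ^ (n + 2) := by
      gcongr
      push_cast
      linarith
    have h0' : K * (n + 1) * s ^ n ≤ K * ((n + 1 : ℕ) + 1) * s ^ (n + 1) := by
      refine mul_le_mul (mul_le_mul_of_nonneg_left ?_ hK0) (pow_le_pow_right₀ hs1 n.le_succ)
        (by positivity) (by positivity)
      push_cast
      linarith
    calc _ ≤ K * (2 * ((n + 1 : ℕ) + 1)) * s ^ (n + 2) +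
          2 * a * (K * ((n + 1 : ℕ) + 1) * s ^ (n + 1)) +
          K * ((n + 1 : ℕ) + 1) * s ^ (n + 1) :=
          add_le_add (add_le_add (h2.trans h2') h1) (h0.trans h0')
      _ = _ := by ring

/-- For `a ≤ 1` both roots `β (-a ± i √(1 - a²))` have modulus `β > √β`, so all the means vanish.
The equation at index `0` then shows that the total mass is one, without evaluating an integral. -/
theorem isBoundedCentering_weighted_meixnerWeight {a : ℝ} (ha0 : 0 ≤ a) (ha : a ≤ 1) {t : ℝ≥0}
    (ht : 0 < t) : IsBoundedCentering
      (weighted (alphaCoeff a t) (betaCoeff t) (meixnerWeight a t)) (fun n => meixnerPoly a n t) := by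
  have htp : (0 : ℝ) < t := ht
  have hβ := betaCoeff_pos t
  have h := isAdmissible_meixnerWeight ha0 ha ht
  obtain ⟨δ, hδ, hq⟩ := exists_le_circleParam_sq_sub ha0 ha ht
  obtain ⟨e0, es⟩ := two_term_of_meixnerQuad
    (h.functional_meixnerQuad fun θ _ => (hδ.trans_le (hq θ)).ne')
  obtain ⟨C, hC⟩ := h.norm_functional_meixnerPoly_le ha0
  set β := betaCoeff t with hβdef
  have hβ1 : 1 < β := by rw [hβdef, betaCoeff]; linarith
  have hs : √β < β := by
    rw [Real.sqrt_lt' hβ]; nlinarith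
  have ha2 : √(1 - a ^ 2) ^ 2 = 1 - a ^ 2 := Real.sq_sqrt (by nlinarith)
  have hnorm : ∀ ε : ℝ, ε ^ 2 = 1 →
      ‖(-(β * a) : ℝ) + ((ε * β * √(1 - a ^ 2) : ℝ) : ℂ) * Complex.I‖ = β := by
    intro ε hε
    rw [Complex.norm_add_mul_I, Real.sqrt_eq_iff_mul_self_eq (by positivity) hβ.le]
    linear_combination β ^ 2 * ha2 + β ^ 2 * √(1 - a ^ 2) ^ 2 * hε
  have hz : ∀ n, h.functional (meixnerPoly a (n + 1) t) = 0 := by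
    refine eq_zero_of_two_term (p := fun n => h.functional (meixnerPoly a (n + 1) t))
      (Real.sqrt_pos.2 hβ) (hs.trans_eq (hnorm 1 (by norm_num)).symm)
      (hs.trans_eq (hnorm (-1) (by norm_num)).symm) (fun n => ?_) hC
    have ha2' : ((√(1 - a ^ 2) : ℝ) : ℂ) ^ 2 = 1 - (a : ℂ) ^ 2 := by exact_mod_cast ha2
    have := es n
    push_cast at this ⊢
    linear_combination this + h.functional (meixnerPoly a (n + 1) t) * (β : ℂ) ^ 2 *
      (-ha2' * Complex.I ^ 2 + (a ^ 2 - 1) * Complex.I_sq)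
  rw [hz 1, hz 0] at e0
  have hone : h.functional 1 = 1 := by
    have hne : ((t * β : ℝ) : ℂ) ≠ 0 := by
      exact_mod_cast (mul_pos htp hβ).ne'
    refine mul_left_cancel₀ hne ?_
    simpa using e0
  have := h.isBoundedCentering (m := 0) (x₁ := 0) le_rfl (p := fun n => meixnerPoly a n t)
    (by rw [h.atomFunctional_apply, hone]; simp)
    (fun n => by rw [h.atomFunctional_apply, hz]; simp)
  simpa using this

theorem isBoundedCentering_continuousBinomial {a : ℝ} (ha0 : 0 ≤ a) (ha : a < 1) (t : ℝ≥0) :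
    IsBoundedCentering (continuousBinomialMeasure a t) (fun n => meixnerPoly a n t) := by
  rcases eq_or_ne t 0 with rfl | ht
  · simpa [continuousBinomialMeasure] using (isThreeTerm_meixnerPoly a).isBoundedCentering_dirac
  have := isBoundedCentering_weighted_meixnerWeight ha0 ha.le (pos_iff_ne_zero.2 ht)
  have e : meixnerWeight a t = fun x => t * betaCoeff t / (x ^ 2 + t ^ 2 * (1 - a ^ 2)) := by
    ext x
    rw [meixnerWeight, show x ^ 2 - (t : ℝ) ^ 2 * (a ^ 2 - 1) = x ^ 2 + t ^ 2 * (1 - a ^ 2) by ring]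
  rw [continuousBinomialMeasure, if_neg ht]
  rwa [e] at this

theorem isBoundedCentering_gamma (t : ℝ≥0) :
    IsBoundedCentering (gammaMeasure t) (fun n => meixnerPoly 1 n t) := by
  rcases eq_or_ne t 0 with rfl | ht
  · simpa [gammaMeasure] using (isThreeTerm_meixnerPoly 1).isBoundedCentering_dirac
  have := isBoundedCentering_weighted_meixnerWeight zero_le_one le_rfl (pos_iff_ne_zero.2 ht)
  have e : meixnerWeight 1 t = fun x : ℝ => t * (1 + t) / x ^ 2 := by
    ext x
    rw [meixnerWeight, betaCoeff, add_comm (1 : ℝ)]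
    simp
  have e1 : alphaCoeff 1 t = 2 + t := by rw [alphaCoeff]; ring
  have e2 : betaCoeff t = 1 + t := by rw [betaCoeff]; ring
  rw [gammaMeasure, if_neg ht]
  rwa [e, e1, e2] at this

/-! #### Negative binomial -/

/-- For `a > 1` the smaller root has modulus `β (a - √(a² - 1))`, which can be below `√β`, so growth
does not decide. Instead, multiplying the density by `x ± t s` leaves a single pole; the two
Stieltjes transforms give total mass and mean, and these start the recursion at zero. -/
theorem isBoundedCentering_negativeBinomial {a : ℝ} (ha : 1 < a) (t : ℝ≥0) :
    IsBoundedCentering (negativeBinomialMeasure a t) (fun n => meixnerPoly a n t) := by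
  rcases eq_or_ne t 0 with rfl | ht
  · simpa [negativeBinomialMeasure] using (isThreeTerm_meixnerPoly a).isBoundedCentering_dirac
  rw [negativeBinomialMeasure, if_neg ht]
  have htp : (0 : ℝ) < t := NNReal.coe_pos.2 (pos_iff_ne_zero.2 ht)
  have hβ := betaCoeff_pos t
  have hβt : betaCoeff t = t + 1 := rfl
  have hα : alphaCoeff a t = a * (t + 2) := rfl
  set s := √(a ^ 2 - 1) with hs
  have hs2 : s ^ 2 = a ^ 2 - 1 := Real.sq_sqrt (by nlinarith)
  have hs0 : 0 < s := Real.sqrt_pos.2 (by nlinarith)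
  have hsa : 0 < a - s := by nlinarith
  have hprod : (a - s) * (a + s) = 1 := by linear_combination -hs2
  have hinv : (a - s)⁻¹ = a + s := inv_eq_of_mul_eq_one_right hprod
  set α := alphaCoeff a t with hαdef
  set β := betaCoeff t with hβdef
  have hσ := Real.sqrt_pos.2 hβ
  have hσσ : √β * √β = β := Real.mul_self_sqrt hβ.le
  have hii : √β * (√β)⁻¹ = 1 := mul_inv_cancel₀ hσ.ne'
  have hσ1 : 1 < √β := by rw [Real.lt_sqrt zero_le_one, hβt]; linarith
  set m := max (1 - t * ((a - s) / (2 * s))) 0 with hm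
  -- the two poles of the density
  obtain ⟨r, hr0, hr1, hrx, hr⟩ : ∃ r : ℝ, 0 < r ∧ r ≤ 1 ∧ α - √β * (r + r⁻¹) = t * s ∧
      √β * r = a + s - 2 * s * m := by
    -- The pole `t s` corresponds to `√β (a - s)` and its inverse. The first is at most `1` exactly
    -- when `t (a - s) ≤ 2 s`, which is also where the atom formula is non-negative.
    rcases le_total (t * (a - s)) (2 * s) with h1 | h1
    · refine ⟨√β * (a - s), by positivity, ?_, ?_, ?_⟩
      · have : (√β * (a - s)) ^ 2 ≤ 1 := by
          have : (√β * (a - s)) ^ 2 = t * (a - s) * (a - s) + (a - s) ^ 2 := by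
            linear_combination (a - s) ^ 2 * hσσ + (a - s) ^ 2 * hβt
          nlinarith
        exact (sq_le_one_iff₀ (by positivity)).1 this
      · rw [mul_inv, hinv, hα]
        linear_combination -(a - s) * hσσ - (a + s) * hii - (a - s) * hβt
      · rw [hm, max_eq_left, ← mul_assoc, hσσ, hβt]
        · field_simp
          ring
        · rw [mul_div_assoc', sub_nonneg, div_le_one (by positivity)]; exact h1
    · refine ⟨(√β * (a - s))⁻¹, by positivity, ?_, ?_, ?_⟩
      · have : 1 ≤ (√β * (a - s)) ^ 2 := by
          have : (√β * (a - s)) ^ 2 = t * (a - s) * (a - s) + (a - s) ^ 2 := by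
            linear_combination (a - s) ^ 2 * hσσ + (a - s) ^ 2 * hβt
          nlinarith
        exact inv_le_one_of_one_le₀ ((one_le_sq_iff₀ (by positivity)).1 this)
      · rw [inv_inv, mul_inv, hinv, hα]
        linear_combination -(a - s) * hσσ - (a + s) * hii - (a - s) * hβt
      · rw [hm, max_eq_right, mul_inv, ← mul_assoc, mul_inv_cancel₀ hσ.ne', hinv]
        · ring
        · rw [mul_div_assoc', sub_nonpos, one_le_div (by positivity)]; exact h1
  -- For the pole `-t s` no case distinction arises, since `a - s ≤ 1 < √β`.
  obtain ⟨r', hr'0, hr'1, hrx', hr'⟩ : ∃ r : ℝ, 0 < r ∧ r ≤ 1 ∧ α - √β * (r + r⁻¹) = -(t * s) ∧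
      √β * r = a - s := by
    have has : a - s ≤ 1 := by nlinarith
    refine ⟨(a - s) / √β, by positivity, ?_, ?_, ?_⟩
    · rw [div_le_one hσ]; linarith
    · rw [inv_div, div_eq_mul_inv √β, hinv, hα, div_eq_mul_inv]
      linear_combination -(a + s) * hσσ - (a - s) * hii - (a + s) * hβt
    · rw [div_eq_mul_inv]
      linear_combination (a - s) * hii
  have hk := isAdmissible_stieltjesWeight α hβ hr0
  have hk1 := functional_stieltjesWeight_one α hβ hr0 hr1
  have hk' := isAdmissible_stieltjesWeight α hβ hr'0
  have hk1' := functional_stieltjesWeight_one α hβ hr'0 hr'1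
  have hpos : ∀ θ ∈ Set.Ioo 0 Real.pi, 0 < circleParam α β θ - t * s := by
    intro θ hθ
    have := circleParam_sub_pos (α := α) hβ hr0 hθ
    rwa [hrx] at this
  have hpos' : ∀ θ ∈ Set.Ioo 0 Real.pi, 2 * (t * s) ≤ circleParam α β θ + t * s := by
    intro θ hθ
    linarith [hpos θ hθ]
  have hfac : ∀ x : ℝ, x ^ 2 - t ^ 2 * (a ^ 2 - 1) = (x - t * s) * (x + t * s) := by
    intro x; rw [← hs2]; ring
  have hw : ∀ x, meixnerWeight a t x =
      t * β * (stieltjesWeight α β r x * stieltjesWeight α β r' x) := by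
    intro x
    rw [meixnerWeight, hfac, stieltjesWeight, stieltjesWeight, hrx, hrx', sub_neg_eq_add,
      ← mul_inv, div_eq_mul_inv]
  have hts : 0 < t * s := mul_pos htp hs0
  have h : IsAdmissible α β (meixnerWeight a t) := by
    refine ⟨hβ, measurable_meixnerWeight a t, fun θ hθ => ?_,
      t * β * ((√β)⁻¹ * (2 * (t * s))⁻¹), fun θ hθ => ?_⟩
    · have h1 := hk.nonneg θ hθ
      have h2 := hk'.nonneg θ hθ
      rw [hw]; positivity
    · have h1 := sin_sq_mul_stieltjesWeight_le (α := α) hβ hr0 hθ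
      have h2 : stieltjesWeight α β r' (circleParam α β θ) ≤ (2 * (t * s))⁻¹ := by
        rw [stieltjesWeight, hrx', sub_neg_eq_add]
        exact inv_anti₀ (by positivity) (hpos' θ hθ)
      have h3 := hk'.nonneg θ hθ
      rw [hw]
      calc _ = t * β * ((Real.sin θ ^ 2 * stieltjesWeight α β r (circleParam α β θ)) *
            stieltjesWeight α β r' (circleParam α β θ)) := by ring
        _ ≤ _ := by gcongr
  set ψ := h.atomFunctional m (t * s) with hψ
  -- total mass and mean
  have e1 : h.functional (Polynomial.X + Polynomial.C ((t * s : ℝ) : ℂ)) =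
      ((t * (√β * r) : ℝ) : ℂ) := by
    rw [← mul_one (Polynomial.X + _), h.functional_mul hk (κ := ((t * β : ℝ) : ℂ)), hk1,
      ← Complex.ofReal_mul]
    · congr 1
      nth_rw 1 [← hσσ]
      field_simp
    · intro θ hθ
      have hne : circleParam α β θ + t * s ≠ 0 := by linarith [hpos' θ hθ]
      rw [hw, Polynomial.eval_add, Polynomial.eval_X, Polynomial.eval_C, ← Complex.ofReal_add,
        ← Complex.ofReal_mul, ← Complex.ofReal_mul]
      congr 1
      have : stieltjesWeight α β r' (circleParam α β θ) = (circleParam α β θ + t * s)⁻¹ := by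
        rw [stieltjesWeight, hrx', sub_neg_eq_add]
      rw [this]
      field_simp
  have e2 : h.functional (Polynomial.X - Polynomial.C ((t * s : ℝ) : ℂ)) =
      ((t * (√β * r') : ℝ) : ℂ) := by
    rw [← mul_one (Polynomial.X - _), h.functional_mul hk' (κ := ((t * β : ℝ) : ℂ)), hk1',
      ← Complex.ofReal_mul]
    · congr 1
      nth_rw 1 [← hσσ]
      field_simp
    · intro θ hθ
      have hne : circleParam α β θ - t * s ≠ 0 := (hpos θ hθ).ne'
      rw [hw, Polynomial.eval_sub, Polynomial.eval_X, Polynomial.eval_C, ← Complex.ofReal_sub,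
        ← Complex.ofReal_mul, ← Complex.ofReal_mul]
      congr 1
      have : stieltjesWeight α β r (circleParam α β θ) = (circleParam α β θ - t * s)⁻¹ := by
        rw [stieltjesWeight, hrx]
      rw [this]
      field_simp
  rw [map_add, h.functional_C, hr] at e1
  rw [map_sub, h.functional_C, hr'] at e2
  have hne : (t : ℂ) * s ≠ 0 := by exact_mod_cast hts.ne'
  have hone' : h.functional 1 = 1 - m := by
    refine mul_left_cancel₀ hne ?_
    push_cast at e1 e2
    linear_combination (e1 - e2) / 2
  have hone : ψ 1 = 1 := by
    rw [hψ, h.atomFunctional_apply, hone']; simp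
  have hXψ : ψ Polynomial.X = ((a * t : ℝ) : ℂ) := by
    rw [hψ, h.atomFunctional_apply, Polynomial.eval_X]
    push_cast at e1 e2 ⊢
    linear_combination (e1 + e2) / 2
  have hquad : ∀ n, ψ (meixnerQuad a t * shiftedChebU n α β) =
      if n = 0 then ((t * β : ℝ) : ℂ) else 0 := by
    intro n
    rw [hψ, h.atomFunctional_apply, Polynomial.eval_mul]
    -- The atom sits at a zero of the denominator and therefore does not contribute.
    have : (meixnerQuad a t).eval ((t * s : ℝ) : ℂ) = 0 := by
      rw [eval_meixnerQuad, hfac, sub_self, zero_mul, Complex.ofReal_zero]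
    rw [this, zero_mul, mul_zero, add_zero]
    refine h.functional_meixnerQuad (fun θ hθ => ?_) n
    rw [hfac]
    have := hpos θ hθ
    have := hpos' θ hθ
    exact mul_ne_zero (by linarith) (by linarith)
  obtain ⟨f0, fs⟩ := two_term_of_meixnerQuad hquad
  have hp1 : ψ (meixnerPoly a 1 t) = 0 := by
    rw [meixnerPoly, map_sub, hXψ, ← mul_one (Polynomial.C _), ← Polynomial.smul_eq_C_mul,
      map_smul, hone]
    simp
  have hp2 : ψ (meixnerPoly a 2 t) = 0 := by
    rw [hp1, hone] at f0
    simpa using f0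
  have hp : ∀ n, ψ (meixnerPoly a (n + 1) t) = 0 ∧ ψ (meixnerPoly a (n + 2) t) = 0 := by
    intro n
    induction n with
    | zero => exact ⟨hp1, hp2⟩
    | succ n ih =>
      refine ⟨ih.2, ?_⟩
      have := fs n
      rw [ih.1, ih.2] at this
      simpa using this
  exact h.isBoundedCentering (le_max_right _ _) hone fun n => (hp n).1

/-! ### The explicit series -/

section PowerSeries

open PowerSeries

theorem shefferU_zero_zero : shefferU 0 0 = X := by
  have : quadSeries 0 0 = 1 := by simp [quadSeries]
  have h := quadSeries_mul_inv 0 0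
  rw [this, one_mul] at h
  rw [shefferU, this, h, mul_one]

theorem shefferU_one_zero : shefferU 1 0 = X * (1 + X)⁻¹ := by
  simp [shefferU, quadSeries]

theorem shefferU_two_mul_one (a : ℝ) : shefferU (2 * a) 1 = meixnerU a := by
  simp [shefferU, quadSeries, meixnerU]

theorem IsThreeTerm.rTransform_one_subst {a b c d : ℝ} {P : ℕ → ℝ≥0 → Polynomial ℂ}
    (h : IsThreeTerm a b c d P) {ν : Measure ℝ} (hν : IsCentering ν (fun n => P n 1)) :
    (rTransform ν).subst (shefferU a c) = C (b : ℂ) + C (d : ℂ) * X := by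
  simpa using h.rTransform_subst hν

theorem rTransform_semicircular : rTransform (semicircularMeasure 1) = X := by
  have := isThreeTerm_semicircularPoly.rTransform_one_subst
    (isBoundedCentering_semicircular 1).toIsCentering
  rw [shefferU_zero_zero, X_subst] at this
  simpa using this

/-- With `u = z / (1 + z)` one has `1 / (1 - u) = 1 + z = R(u)`. -/
theorem rTransform_poisson : rTransform (poissonMeasure 1) = (1 - X)⁻¹ := by
  have h := isThreeTerm_poissonPoly.rTransform_one_subst
    (isBoundedCentering_poisson 1).toIsCentering
  have hu := isP01_shefferU 1 0
  have hs : HasSubst (shefferU 1 0) := HasSubst.of_constantCoeff_zero' hu.1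
  refine subst_left_injective hu.1 hu.2 ?_
  have h1 : (1 - X : PowerSeries ℂ) * (1 - X)⁻¹ = 1 := PowerSeries.mul_inv_cancel _ (by simp)
  have h2 := congrArg (substAlgHom (R := ℂ) hs) h1
  simp only [map_mul, map_sub, map_one, coe_substAlgHom, subst_X hs] at h2
  have hAu := quadSeries_mul_shefferU 1 0
  have hA : quadSeries 1 0 = 1 + X := by simp [quadSeries]
  rw [hA] at hAu
  rw [h]
  simp only [Complex.ofReal_one, map_one, one_mul]
  linear_combination (-(1 + X : PowerSeries ℂ)) * h2 -
    ((1 - X : PowerSeries ℂ)⁻¹).subst (shefferU 1 0) * hAu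

/-- Take `S = 1 - 2 z R`. After substituting `u`, the difference of the two sides of the equation
for `S²` is `4 u (u (1 + 2 a z + z²) - z)`, which is zero. -/
theorem isMeixnerR_of_subst {a : ℝ} {R : PowerSeries ℂ}
    (h : R.subst (shefferU (2 * a) 1) = C (a : ℂ) + C ((1 : ℝ) : ℂ) * X) : IsMeixnerR a R := by
  have hu := isP01_shefferU (2 * a) 1
  have hs : HasSubst (shefferU (2 * a) 1) := HasSubst.of_constantCoeff_zero' hu.1
  have hAu := quadSeries_mul_shefferU (2 * a) 1
  have h2a : (C ((2 * a : ℝ) : ℂ) : PowerSeries ℂ) = 2 * C (a : ℂ) := by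
    rw [Complex.ofReal_mul, map_mul, Complex.ofReal_ofNat, map_ofNat]
  refine ⟨1 - 2 * X * R, by simp, subst_left_injective hu.1 hu.2 ?_, by ring⟩
  have hC : (C (a : ℂ) : PowerSeries ℂ).subst (shefferU (2 * a) 1) = C (a : ℂ) := subst_C _
  rw [← coe_substAlgHom hs] at h hC ⊢
  simp only [h2a, map_mul, map_sub, map_pow, map_one, map_ofNat, h, hC]
  rw [coe_substAlgHom hs, subst_X hs]
  rw [quadSeries, h2a] at hAu
  set u := shefferU (2 * a) 1
  simp only [Complex.ofReal_one, map_one, one_mul] at hAu ⊢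
  linear_combination 4 * u * hAu

theorem isMeixnerR_rTransform {a : ℝ} {ν : Measure ℝ}
    (hν : IsBoundedCentering ν (fun n => meixnerPoly a n 1)) : IsMeixnerR a (rTransform ν) :=
  isMeixnerR_of_subst ((isThreeTerm_meixnerPoly a).rTransform_one_subst hν.toIsCentering)

end PowerSeries

/-! ### Affine changes -/

/-- The drift `e` changes only `b`, the time scale only `b` and `d`. Hence for `c > 0` the sole
invariant is `a² / c`. -/
theorem IsThreeTerm.affinePoly {a b c d : ℝ} {P : ℕ → ℝ≥0 → Polynomial ℂ}
    (h : IsThreeTerm a b c d P) {k : ℝ} (hk : k ≠ 0) (e : ℝ) (l : ℝ≥0) :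
    IsThreeTerm (k * a) (k * l * b + e) (k ^ 2 * c) (k ^ 2 * l * d) (affinePoly k e l P) := by
  have hkk : (Polynomial.C (k : ℂ) : Polynomial ℂ) * Polynomial.C ((k : ℂ)⁻¹) = 1 := by
    rw [← map_mul, mul_inv_cancel₀ (by exact_mod_cast hk), map_one]
  have h1 : ∀ t, FreeMeixner.affinePoly k e l P 1 t =
      Polynomial.X - Polynomial.C (((k * l * b + e) * t : ℝ) : ℂ) := by
    intro t
    simp only [FreeMeixner.affinePoly, h.one, Polynomial.sub_comp, Polynomial.X_comp,
      Polynomial.C_comp, pow_one, NNReal.coe_mul]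
    push_cast
    simp only [map_add, map_mul]
    linear_combination (Polynomial.X - Polynomial.C (e : ℂ) * Polynomial.C ((t : ℝ) : ℂ)) * hkk
  refine ⟨fun t => by simp [FreeMeixner.affinePoly, h.zero], h1, fun t => ?_, fun n t => ?_⟩
  · simp only [FreeMeixner.affinePoly, h.two, Polynomial.sub_comp, Polynomial.X_comp,
      Polynomial.C_comp, Polynomial.mul_comp, NNReal.coe_mul]
    push_cast
    simp only [map_add, map_mul, map_pow]
    linear_combination (Polynomial.C (k : ℂ) * (P 1 (l * t)).comp (Polynomial.C ((k : ℂ)⁻¹) *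
      (Polynomial.X - Polynomial.C (e : ℂ) * Polynomial.C ((t : ℝ) : ℂ))) *
      (Polynomial.X - Polynomial.C (e : ℂ) * Polynomial.C ((t : ℝ) : ℂ))) * hkk
  · simp only [FreeMeixner.affinePoly, h.add_three, Polynomial.sub_comp, Polynomial.X_comp,
      Polynomial.C_comp, Polynomial.mul_comp, NNReal.coe_mul]
    push_cast
    simp only [map_add, map_mul, map_pow]
    linear_combination (Polynomial.C (k : ℂ) ^ (n + 2) * (P (n + 2) (l * t)).comp
      (Polynomial.C ((k : ℂ)⁻¹) *
      (Polynomial.X - Polynomial.C (e : ℂ) * Polynomial.C ((t : ℝ) : ℂ))) *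
      (Polynomial.X - Polynomial.C (e : ℂ) * Polynomial.C ((t : ℝ) : ℂ))) * hkk

theorem eval_affinePoly {k : ℝ} (hk : k ≠ 0) (e : ℝ) (l : ℝ≥0) (P : ℕ → ℝ≥0 → Polynomial ℂ)
    (n : ℕ) (t : ℝ≥0) (x : ℝ) :
    (affinePoly k e l P n t).eval ((k * x + e * t : ℝ) : ℂ) =
      (k : ℂ) ^ n * (P n (l * t)).eval (x : ℂ) := by
  have hk' : (k : ℂ) ≠ 0 := by exact_mod_cast hk
  rw [affinePoly, Polynomial.eval_mul, Polynomial.eval_C, Polynomial.eval_comp]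
  congr 2
  simp only [Polynomial.eval_mul, Polynomial.eval_C, Polynomial.eval_sub, Polynomial.eval_X]
  push_cast
  field_simp
  ring

theorem IsCentering.affine {μ : ℝ≥0 → Measure ℝ} {P : ℕ → ℝ≥0 → Polynomial ℂ} {k : ℝ}
    (hk : k ≠ 0) (e : ℝ) (l t : ℝ≥0) (h : IsCentering (μ (l * t)) (fun n => P n (l * t))) :
    IsCentering (affineMeasure k e l μ t) (fun n => affinePoly k e l P n t) := by
  have hm : Measurable fun x : ℝ => k * x + e * t := by fun_prop
  have := h.isProbabilityMeasure
  refine ⟨Measure.isProbabilityMeasure_map hm.aemeasurable, fun n => ?_, fun n => ?_⟩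
  · rw [affineMeasure, integrable_map_measure (by fun_prop) hm.aemeasurable]
    have := (integrable_eval h.hasAllMoments ((Polynomial.C (k : ℂ) * Polynomial.X +
      Polynomial.C ((e * t : ℝ) : ℂ)) ^ n)).re
    refine this.congr (Filter.Eventually.of_forall fun x => ?_)
    simp only [Polynomial.eval_pow, Polynomial.eval_add, Polynomial.eval_mul, Polynomial.eval_C,
      Polynomial.eval_X, ← Complex.ofReal_mul, ← Complex.ofReal_add, ← Complex.ofReal_pow]
    exact Complex.ofReal_re _
  · rw [affineMeasure, integral_map hm.aemeasurable
      (IsAdmissible.measurable_eval _).aestronglyMeasurable]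
    simp only [eval_affinePoly hk]
    rw [integral_const_mul, h.integral_eq_zero, mul_zero]

theorem affineMeasure_affineMeasure_inv {k : ℝ} (hk : k ≠ 0) (e : ℝ) {l : ℝ≥0} (hl : 0 < l)
    (μ : ℝ≥0 → Measure ℝ) :
    affineMeasure k⁻¹ (-(e * (l : ℝ)⁻¹ * k⁻¹)) l⁻¹ (affineMeasure k e l μ) = μ := by
  ext1 t
  rw [affineMeasure, affineMeasure, mul_inv_cancel_left₀ hl.ne',
    Measure.map_map (by fun_prop) (by fun_prop)]
  convert Measure.map_id
  ext x
  simp only [Function.comp_apply, NNReal.coe_mul, NNReal.coe_inv, id]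
  field_simp
  ring

theorem affinePoly_affinePoly_inv {k : ℝ} (hk : k ≠ 0) (e : ℝ) {l : ℝ≥0} (hl : 0 < l)
    (P : ℕ → ℝ≥0 → Polynomial ℂ) :
    affinePoly k⁻¹ (-(e * (l : ℝ)⁻¹ * k⁻¹)) l⁻¹ (affinePoly k e l P) = P := by
  have hk' : (k : ℂ) ≠ 0 := by exact_mod_cast hk
  ext1 n
  ext1 t
  rw [affinePoly, affinePoly, mul_inv_cancel_left₀ hl.ne', Polynomial.mul_comp,
    Polynomial.C_comp, Polynomial.comp_assoc, ← mul_assoc, ← map_mul, ← mul_pow]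
  rw [Complex.ofReal_inv, inv_mul_cancel₀ hk', one_pow, map_one, one_mul]
  have hkk : (Polynomial.C (k : ℂ) : Polynomial ℂ) * Polynomial.C ((k : ℂ)⁻¹) = 1 := by
    rw [← map_mul, mul_inv_cancel₀ hk', map_one]
  have e1 : (Polynomial.C ((k : ℂ)⁻¹) * (Polynomial.X - Polynomial.C ((e : ℂ) *
      (((l⁻¹ * t : ℝ≥0) : ℝ) : ℂ)))).comp (Polynomial.C ((k : ℂ)⁻¹⁻¹) * (Polynomial.X -
        Polynomial.C (((-(e * (l : ℝ)⁻¹ * k⁻¹) : ℝ) : ℂ) * ((t : ℝ) : ℂ)))) = Polynomial.X := by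
    simp only [Polynomial.sub_comp, Polynomial.X_comp, Polynomial.C_comp, Polynomial.mul_comp,
      inv_inv]
    push_cast
    simp only [map_neg, map_mul]
    linear_combination (Polynomial.X + Polynomial.C ((k : ℂ)⁻¹) * Polynomial.C (e : ℂ) *
      Polynomial.C (((l : ℝ) : ℂ)⁻¹) * Polynomial.C ((t : ℝ) : ℂ)) * hkk
  rw [e1, Polynomial.comp_X]

/-- The listed system is carried back by the inverse change. Recursion and centering are easy to
transport, so free convolution need not be. -/
theorem isFreeMeixner_of_affine {a b c d : ℝ} {μ μ' : ℝ≥0 → Measure ℝ}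
    {P P' : ℕ → ℝ≥0 → Polynomial ℂ} {k e : ℝ} {l : ℝ≥0} (hk : k ≠ 0) (hl : 0 < l)
    (hP : IsThreeTerm a b c d P') (hd : d ≠ 0) (hμ0 : μ' 0 = Measure.dirac 0)
    (hμ : ∀ t, IsBoundedCentering (μ' t) (fun n => P' n t))
    (h : affineMeasure k e l μ = μ' ∧ affinePoly k e l P = P') :
    IsFreeMeixner μ P ∧ IsNontrivial μ := by
  have hk' := inv_ne_zero hk
  rw [← affineMeasure_affineMeasure_inv hk e hl μ, ← affinePoly_affinePoly_inv hk e hl P, h.1, h.2]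
  have key := isFreeMeixnerWith_of_isThreeTerm
    (hP.affinePoly hk' (-(e * (l : ℝ)⁻¹ * k⁻¹)) l⁻¹)
    (by have : (l : ℝ) ≠ 0 := by exact_mod_cast hl.ne'
        rw [NNReal.coe_inv]; positivity)
    (by rw [affineMeasure, mul_zero, hμ0, Measure.map_dirac' (by fun_prop)]; simp)
    (fun t => (hμ (l⁻¹ * t)).toIsCentering.affine hk' (-(e * (l : ℝ)⁻¹ * k⁻¹)) l⁻¹ t)
  exact ⟨key.isFreeMeixner, key.isNontrivial⟩

/-- The parameters determine the polynomials; centering and the bounded support of the target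
determine the measure. -/
theorem affine_eq_of_isThreeTerm {a b c d a' b' c' d' : ℝ} {μ μ' : ℝ≥0 → Measure ℝ}
    {P P' : ℕ → ℝ≥0 → Polynomial ℂ} {k e : ℝ} {l : ℝ≥0} (hk : k ≠ 0)
    (hP : IsThreeTerm a b c d P) (hμ : ∀ t, IsCentering (μ t) (fun n => P n t))
    (hP' : IsThreeTerm a' b' c' d' P') (hμ' : ∀ t, IsBoundedCentering (μ' t) (fun n => P' n t))
    (ha : k * a = a') (hb : k * l * b + e = b') (hc : k ^ 2 * c = c') (hd : k ^ 2 * l * d = d') :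
    affineMeasure k e l μ = μ' ∧ affinePoly k e l P = P' := by
  subst ha hb hc hd
  have e1 := (hP.affinePoly hk e l).unique hP'
  refine ⟨funext fun t => ?_, e1⟩
  have h1 := (hμ (l * t)).affine hk e l t
  rw [e1] at h1
  obtain ⟨M, hM⟩ := (hμ' t).bounded
  exact h1.ext (hμ' t).toIsCentering (hP'.zero t) (fun n => (hP'.monic_and_natDegree t n).1)
    (fun n => (hP'.monic_and_natDegree t n).2) hM

/-! ### The list of free Meixner systems -/

theorem isFreeMeixnerWith_semicircular :
    IsFreeMeixnerWith semicircularMeasure semicircularPoly PowerSeries.X := by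
  rw [← shefferU_zero_zero]
  exact isFreeMeixnerWith_of_isThreeTerm isThreeTerm_semicircularPoly one_ne_zero
    (by simp [semicircularMeasure, semicircle])
    fun t => (isBoundedCentering_semicircular t).toIsCentering

theorem isFreeMeixnerWith_poisson : IsFreeMeixnerWith poissonMeasure poissonPoly
    (PowerSeries.X * (1 + PowerSeries.X)⁻¹) := by
  rw [← shefferU_one_zero]
  exact isFreeMeixnerWith_of_isThreeTerm isThreeTerm_poissonPoly one_ne_zero
    (by simp [poissonMeasure]) fun t => (isBoundedCentering_poisson t).toIsCentering

theorem isFreeMeixnerWith_meixnerPoly {a : ℝ} {μ : ℝ≥0 → Measure ℝ}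
    (h0 : μ 0 = Measure.dirac 0) (h : ∀ t, IsBoundedCentering (μ t) (fun n => meixnerPoly a n t)) :
    IsFreeMeixnerWith μ (meixnerPoly a) (meixnerU a) := by
  rw [← shefferU_two_mul_one]
  exact isFreeMeixnerWith_of_isThreeTerm (isThreeTerm_meixnerPoly a) one_ne_zero h0
    fun t => (h t).toIsCentering

theorem exists_nnreal_eq {x : ℝ} (hx : 0 < x) : ∃ l : ℝ≥0, 0 < l ∧ (l : ℝ) = x :=
  ⟨⟨x, hx.le⟩, hx, rfl⟩

theorem exists_affine_eq {μ : ℝ≥0 → Measure ℝ} {P : ℕ → ℝ≥0 → Polynomial ℂ}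
    (h : IsFreeMeixner μ P) (hnt : IsNontrivial μ) :
    ∃ (c d : ℝ) (l : ℝ≥0), c ≠ 0 ∧ 0 < l ∧
        ((affineMeasure c d l μ = semicircularMeasure ∧
            affinePoly c d l P = semicircularPoly) ∨
          (affineMeasure c d l μ = poissonMeasure ∧
            affinePoly c d l P = poissonPoly) ∨
          (∃ a : ℝ, 0 ≤ a ∧ a < 1 ∧
            affineMeasure c d l μ = continuousBinomialMeasure a ∧
            affinePoly c d l P = meixnerPoly a) ∨
          (affineMeasure c d l μ = gammaMeasure ∧
            affinePoly c d l P = meixnerPoly 1) ∨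
          (∃ a : ℝ, 1 < a ∧
            affineMeasure c d l μ = negativeBinomialMeasure a ∧
            affinePoly c d l P = meixnerPoly a)) := by
  obtain ⟨a, b, c, d, hc, hd, hP⟩ := h.exists_isThreeTerm hnt
  have hμ := h.isCentering
  rcases hc.eq_or_lt with rfl | hc
  · rcases eq_or_ne a 0 with rfl | ha
    · obtain ⟨l, hl, hld⟩ := exists_nnreal_eq (inv_pos.2 hd)
      refine ⟨1, -(d⁻¹ * b), l, one_ne_zero, hl, Or.inl ?_⟩
      refine affine_eq_of_isThreeTerm one_ne_zero hP hμ isThreeTerm_semicircularPoly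
        isBoundedCentering_semicircular (by ring) ?_ (by ring) ?_
      · rw [hld]; ring
      · rw [hld]; field_simp
    · obtain ⟨l, hl, hld⟩ := exists_nnreal_eq (by positivity : 0 < a ^ 2 / d)
      refine ⟨a⁻¹, 1 - a⁻¹ * (a ^ 2 / d) * b, l, inv_ne_zero ha, hl,
        Or.inr (Or.inl ?_)⟩
      refine affine_eq_of_isThreeTerm (inv_ne_zero ha) hP hμ isThreeTerm_poissonPoly
        isBoundedCentering_poisson (inv_mul_cancel₀ ha) ?_ (by ring) ?_
      · rw [hld]; ring
      · rw [hld]; field_simp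
  -- The normal form requires `k² c = 1`, `k² l d = 1` and `k a = 2 s`, so `k = ± 1 / √c` and `l = c
  -- / d`. The sign `ε` reflects the line so that `s ≥ 0`.
  · obtain ⟨l, hl, hld⟩ := exists_nnreal_eq (by positivity : 0 < c / d)
    have hσ := Real.sqrt_pos.2 hc
    have hσσ : √c ^ 2 = c := Real.sq_sqrt hc.le
    obtain ⟨ε, hε, hεa⟩ : ∃ ε : ℝ, ε ^ 2 = 1 ∧ ε * a = |a| := by
      rcases le_total 0 a with h0 | h0
      · exact ⟨1, by norm_num, by rw [abs_of_nonneg h0, one_mul]⟩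
      · exact ⟨-1, by norm_num, by rw [abs_of_nonpos h0]; ring⟩
    have hε0 : ε ≠ 0 := by rintro rfl; norm_num at hε
    set k := ε / √c with hk
    have hk0 : k ≠ 0 := div_ne_zero hε0 hσ.ne'
    have hk2 : k ^ 2 * c = 1 := by
      rw [hk, div_pow, hε, hσσ]; field_simp
    set s := |a| / (2 * √c) with hs
    have hs0 : 0 ≤ s := by positivity
    have key : ∀ ν : ℝ≥0 → Measure ℝ,
        (∀ t, IsBoundedCentering (ν t) (fun n => meixnerPoly s n t)) →
        affineMeasure k (s - k * (c / d) * b) l μ = ν ∧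
          affinePoly k (s - k * (c / d) * b) l P = meixnerPoly s := by
      intro ν hν
      refine affine_eq_of_isThreeTerm hk0 hP hμ (isThreeTerm_meixnerPoly s) hν ?_ ?_ hk2 ?_
      · rw [hk, hs, ← hεa]; field_simp
      · rw [hld]; ring
      · rw [hld, mul_assoc, div_mul_cancel₀ _ hd.ne', hk2]
    refine ⟨k, s - k * (c / d) * b, l, hk0, hl, Or.inr (Or.inr ?_)⟩
    rcases lt_trichotomy s 1 with h1 | h1 | h1
    · exact Or.inl ⟨s, hs0, h1, key _ (isBoundedCentering_continuousBinomial hs0 h1)⟩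
    · have := key gammaMeasure (by rw [h1]; exact isBoundedCentering_gamma)
      refine Or.inr (Or.inl ?_)
      rwa [h1] at this ⊢
    · exact Or.inr (Or.inr ⟨s, h1, key _ (isBoundedCentering_negativeBinomial h1)⟩)

theorem isFreeMeixner_of_exists_affine_eq {μ : ℝ≥0 → Measure ℝ} {P : ℕ → ℝ≥0 → Polynomial ℂ}
    {c d : ℝ} {l : ℝ≥0} (hc : c ≠ 0) (hl : 0 < l)
    (h : (affineMeasure c d l μ = semicircularMeasure ∧
            affinePoly c d l P = semicircularPoly) ∨
          (affineMeasure c d l μ = poissonMeasure ∧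
            affinePoly c d l P = poissonPoly) ∨
          (∃ a : ℝ, 0 ≤ a ∧ a < 1 ∧
            affineMeasure c d l μ = continuousBinomialMeasure a ∧
            affinePoly c d l P = meixnerPoly a) ∨
          (affineMeasure c d l μ = gammaMeasure ∧
            affinePoly c d l P = meixnerPoly 1) ∨
          (∃ a : ℝ, 1 < a ∧
            affineMeasure c d l μ = negativeBinomialMeasure a ∧
            affinePoly c d l P = meixnerPoly a)) : IsFreeMeixner μ P ∧ IsNontrivial μ := by
  rcases h with h | h | ⟨a, h0, h1, h⟩ | h | ⟨a, h1, h⟩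
  · exact isFreeMeixner_of_affine hc hl isThreeTerm_semicircularPoly one_ne_zero
      (by simp [semicircularMeasure, semicircle]) isBoundedCentering_semicircular h
  · exact isFreeMeixner_of_affine hc hl isThreeTerm_poissonPoly one_ne_zero
      (by simp [poissonMeasure]) isBoundedCentering_poisson h
  · exact isFreeMeixner_of_affine hc hl (isThreeTerm_meixnerPoly a) one_ne_zero
      (by simp [continuousBinomialMeasure]) (isBoundedCentering_continuousBinomial h0 h1) h
  · exact isFreeMeixner_of_affine hc hl (isThreeTerm_meixnerPoly 1) one_ne_zero
      (by simp [gammaMeasure]) isBoundedCentering_gamma h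
  · exact isFreeMeixner_of_affine hc hl (isThreeTerm_meixnerPoly a) one_ne_zero
      (by simp [negativeBinomialMeasure]) (isBoundedCentering_negativeBinomial h1) h

end FreeMeixner

end

open FreeMeixner in
theorem mainTheorem1 :
    -- Semicircular / Chebyshev
    (IsFreeMeixnerWith semicircularMeasure semicircularPoly PowerSeries.X ∧
      rTransform (semicircularMeasure 1) = PowerSeries.X ∧
      ∀ (n : ℕ) (t : ℝ≥0), semicircularPoly n t = chebU n t) ∧
    -- Poisson / Charlier
    (IsFreeMeixnerWith poissonMeasure poissonPoly (PowerSeries.X * (1 + PowerSeries.X)⁻¹) ∧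
      rTransform (poissonMeasure 1) = (1 - PowerSeries.X)⁻¹ ∧
      ∀ (n : ℕ) (t : ℝ≥0), poissonPoly (n + 1) t =
        shiftedChebU (n + 1) (t + 1) t + shiftedChebU n (t + 1) t) ∧
    -- the three cases with a parameter `a ≥ 0`: polynomials
    (∀ a : ℝ, 0 ≤ a → ∀ t : ℝ≥0,
      meixnerPoly a 1 t = shiftedChebU 1 (alphaCoeff a t) (betaCoeff t)
        + Polynomial.C ((2 * a : ℝ) : ℂ) * shiftedChebU 0 (alphaCoeff a t) (betaCoeff t) ∧
      ∀ n : ℕ, meixnerPoly a (n + 2) t = shiftedChebU (n + 2) (alphaCoeff a t) (betaCoeff t)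
        + Polynomial.C ((2 * a : ℝ) : ℂ) * shiftedChebU (n + 1) (alphaCoeff a t) (betaCoeff t)
        + shiftedChebU n (alphaCoeff a t) (betaCoeff t)) ∧
    -- continuous binomial / Meixner-Pollaczek
    (∀ a : ℝ, 0 ≤ a → a < 1 →
      IsFreeMeixnerWith (continuousBinomialMeasure a) (meixnerPoly a) (meixnerU a) ∧
      IsMeixnerR a (rTransform (continuousBinomialMeasure a 1))) ∧
    -- gamma / Laguerre
    (IsFreeMeixnerWith gammaMeasure (meixnerPoly 1) (meixnerU 1) ∧
      IsMeixnerR 1 (rTransform (gammaMeasure 1))) ∧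
    -- negative binomial / Meixner
    (∀ a : ℝ, 1 < a →
      IsFreeMeixnerWith (negativeBinomialMeasure a) (meixnerPoly a) (meixnerU a) ∧
      IsMeixnerR a (rTransform (negativeBinomialMeasure a 1))) ∧
    -- up to affine changes of `x` and rescaling of `t`, these are all of them
    (∀ (μ : ℝ≥0 → Measure ℝ) (P : ℕ → ℝ≥0 → Polynomial ℂ),
      (IsFreeMeixner μ P ∧ IsNontrivial μ) ↔
      ∃ (c d : ℝ) (l : ℝ≥0), c ≠ 0 ∧ 0 < l ∧
        ((affineMeasure c d l μ = semicircularMeasure ∧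
            affinePoly c d l P = semicircularPoly) ∨
          (affineMeasure c d l μ = poissonMeasure ∧
            affinePoly c d l P = poissonPoly) ∨
          (∃ a : ℝ, 0 ≤ a ∧ a < 1 ∧
            affineMeasure c d l μ = continuousBinomialMeasure a ∧
            affinePoly c d l P = meixnerPoly a) ∨
          (affineMeasure c d l μ = gammaMeasure ∧
            affinePoly c d l P = meixnerPoly 1) ∨
          (∃ a : ℝ, 1 < a ∧
            affineMeasure c d l μ = negativeBinomialMeasure a ∧
            affinePoly c d l P = meixnerPoly a))) := by
  exact ⟨⟨isFreeMeixnerWith_semicircular, rTransform_semicircular, semicircularPoly_eq⟩,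
    ⟨isFreeMeixnerWith_poisson, rTransform_poisson, poissonPoly_eq⟩,
    fun a _ t => ⟨meixnerPoly_one_eq a t, meixnerPoly_add_two_eq a t⟩,
    fun a h0 h1 => ⟨isFreeMeixnerWith_meixnerPoly (by simp [continuousBinomialMeasure])
      (isBoundedCentering_continuousBinomial h0 h1),
      isMeixnerR_rTransform (isBoundedCentering_continuousBinomial h0 h1 1)⟩,
    ⟨isFreeMeixnerWith_meixnerPoly (by simp [gammaMeasure]) isBoundedCentering_gamma,
      isMeixnerR_rTransform (isBoundedCentering_gamma 1)⟩,
    fun a h1 => ⟨isFreeMeixnerWith_meixnerPoly (by simp [negativeBinomialMeasure])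
      (isBoundedCentering_negativeBinomial h1),
      isMeixnerR_rTransform (isBoundedCentering_negativeBinomial h1 1)⟩,
    fun μ P => ⟨fun h => exists_affine_eq h.1 h.2,
      fun ⟨_, _, _, hc, hl, h⟩ => isFreeMeixner_of_exists_affine_eq hc hl h⟩⟩
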